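/- Let $d\ge 2$, let $a\in L^\infty(\mathbb S^{d-1})$ be real-valued with $a\ge 0$ almost everywhere (with respect to the surface measure), and set $-\Delta_a\psi(x)=-\Delta\psi(x)+\frac{a(x/|x|)}{|x|^2}\psi(x)$. The self-adjoint operator $-\Delta_{\mathbb S^{d-1}}+a(\theta)$ in $L^2(\mathbb S^{d-1})$ has purely discrete spectrum: there are real numbers $\mu_0\le\mu_1\le\mu_2\le\dots$ with $\mu_k\to\infty$ (its eigenvalues, repeated according to multiplicity) and an orthonormal basis $(u_k)_{k\ge0}$ of $L^2(\mathbb S^{d-1})$ such that $u_k$ is an eigenfunction with eigenvalue $\mu_k$. Moreover $\mu_0\ge\operatorname{ess\,inf}_{\mathbb S^{d-1}}a$, and for every $\alpha\in\mathbb R$ and every complex-valued $\psi\in C_c^\infty(\mathbb R^d\setminus\{0\})$ the following integrals are finite and $$\int_{\mathbb R^d}\frac{|-\Delta_a\psi(x)|^2}{|x|^\alpha}\,dx\ \ge\ C_a(d,\alpha)\left[\int_{\mathbb R^d}\frac{|\nabla\psi(x)|^2}{|x|^{\alpha+2}}\,dx+\int_{\mathbb R^d}a\!\left(\tfrac{x}{|x|}\right)\frac{|\psi(x)|^2}{|x|^{\alpha+4}}\,dx\right],$$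 where $$C_a(d,\alpha)=\begin{cases}\displaystyle\min_{k\ge0}\frac{\bigl(4\mu_k+(d+\alpha)(d-\alpha-4)\bigr)^2}{4\bigl(4\mu_k+(d-\alpha-4)^2\bigr)}&\text{if }d-\alpha-4\ne0,\\[3mm]\displaystyle\min\Bigl((d-2)^2,\ \min_{k\ge0,\ \mu_k\ne0}\mu_k\Bigr)&\text{if }d-\alpha-4=0,\end{cases}$$ and the minima are attained. -/

import Mathlib

open MeasureTheory Filter Metric Set
open scoped ENNReal ContDiff Topology

noncomputable section

namespace HardyRellich

/-- The Euclidean space `ℝ^d`. -/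
abbrev E (d : ℕ) : Type := EuclideanSpace ℝ (Fin d)

/-- The unit sphere `S^{d-1}` in `ℝ^d`. -/
abbrev S (d : ℕ) : Type := sphere (0 : E d) 1

/-- The surface measure on `S^{d-1}`. -/
def σ (d : ℕ) : Measure (S d) := (volume : Measure (E d)).toSphere

instance (d : ℕ) : IsFiniteMeasure (σ d) :=
  inferInstanceAs (IsFiniteMeasure (volume : Measure (E d)).toSphere)

/-- The complex Hilbert space `L²(S^{d-1})`. -/
abbrev L2S (d : ℕ) : Type := Lp ℂ 2 (σ d)

/-- The extension `x ↦ g (x / |x|)` of a function `g` on the sphere to a function on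
`ℝ^d \ {0}` that is homogeneous of degree `0` (with the value `0` at the origin). -/
def homExt {d : ℕ} {F : Type*} [Zero F] (g : S d → F) (x : E d) : F :=
  if h : x = 0 then 0
  else g ⟨‖x‖⁻¹ • x, by
    rw [mem_sphere_zero_iff_norm, norm_smul, norm_inv, norm_norm,
      inv_mul_cancel₀ (norm_ne_zero_iff.mpr h)]⟩

/-- Smooth functions on the sphere: the homogeneous extension is smooth off the origin. -/
def SmoothOnSphere {d : ℕ} (φ : S d → ℂ) : Prop :=
  ContDiffOn ℝ ∞ (homExt φ) {0}ᶜ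

/-- The Laplace–Beltrami operator `Δ_{S^{d-1}}` on smooth functions: the Euclidean Laplacian of
the extension homogeneous of degree `0`, restricted to the sphere. -/
def sphereLaplacian {d : ℕ} (φ : S d → ℂ) (θ : S d) : ℂ :=
  Laplacian.laplacian (homExt φ) (θ : E d)

/-- `u` lies in the domain of the self-adjoint Laplace–Beltrami operator in `L²(S^{d-1})` and
`Δ_{S^{d-1}} u = f`, in the sense of distributions on the sphere. -/
def HasSphereLaplacian {d : ℕ} (u f : L2S d) : Prop :=
  ∀ φ : S d → ℂ, SmoothOnSphere φ →
    ∫ θ, u θ * sphereLaplacian φ θ ∂(σ d) = ∫ θ, f θ * φ θ ∂(σ d)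

/-- `u` is an eigenfunction of `-Δ_{S^{d-1}} + a(θ)` in `L²(S^{d-1})` with eigenvalue `μ`. -/
def IsAngularEigenfunction {d : ℕ} (a : S d → ℝ) (μ : ℝ) (u : L2S d) : Prop :=
  u ≠ 0 ∧ ∃ f : L2S d, HasSphereLaplacian u f ∧
    ∀ᵐ θ ∂(σ d), -f θ + (a θ : ℂ) * u θ = (μ : ℂ) * u θ

/-- `μ₀ ≤ μ₁ ≤ … → ∞` is the sequence of the eigenvalues of `-Δ_{S^{d-1}} + a(θ)`, repeated
according to multiplicity, and the spectrum of this operator is purely discrete: there is a Hilbert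
basis of `L²(S^{d-1})` whose `k`-th element is an eigenfunction with eigenvalue `μ_k`. -/
def IsAngularEigenvalueSeq {d : ℕ} (a : S d → ℝ) (μ : ℕ → ℝ) : Prop :=
  Monotone μ ∧ Tendsto μ atTop atTop ∧
    ∃ u : HilbertBasis ℕ ℂ (L2S d), ∀ k, IsAngularEigenfunction a (μ k) (u k)

/-- The quotient whose minimum over the eigenvalues `l` is the constant if `d - α - 4 ≠ 0`. -/
def quotient (d : ℕ) (α l : ℝ) : ℝ :=
  (4 * l + (d + α) * (d - α - 4)) ^ 2 / (4 * (4 * l + (d - α - 4) ^ 2))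

/-- The constant `C_a(d, α)` in terms of the eigenvalues `μ_k`. -/
def hrConst (d : ℕ) (α : ℝ) (μ : ℕ → ℝ) : ℝ :=
  if (d : ℝ) - α - 4 ≠ 0 then sInf (range fun k => quotient d α (μ k))
  else min (((d : ℝ) - 2) ^ 2) (sInf (range μ \ {0}))

/-- `C_c^∞(ℝ^d \ {0})`, complex valued. -/
def IsTestFunction {d : ℕ} (ψ : E d → ℂ) : Prop :=
  ContDiff ℝ ∞ ψ ∧ HasCompactSupport ψ ∧ (0 : E d) ∉ tsupport ψ

/-- `|∇ψ|² = ∑ⱼ |∂ⱼψ|²`. -/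
def gradSq {d : ℕ} (ψ : E d → ℂ) (x : E d) : ℝ :=
  ∑ j : Fin d, ‖fderiv ℝ ψ x (EuclideanSpace.single j 1)‖ ^ 2

/-- `-Δ_a ψ = -Δψ + a(x/|x|) / |x|² ψ`. -/
def electricOp {d : ℕ} (a : S d → ℝ) (ψ : E d → ℂ) (x : E d) : ℂ :=
  -Laplacian.laplacian ψ x + ((homExt a x / ‖x‖ ^ 2 : ℝ) : ℂ) * ψ x

end HardyRellich

end

/-! Write x = e^t θ and ψ(e^t θ) = e^{st} w(t, θ) with s = (4 + α - d)/2; this value of s cancels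
every power of |x| in the three integrals. Let (u_k) be an eigenbasis of -Δ_S + a, let w_k(t) be the
coefficient of w(t, ·) along u_k, and put b = 2s + d - 2, A_k = μ_k - s(s + d - 2). Parseval on the
sphere (`hasSum_emdenOp`, `hasSum_emdenForm`) turns the left side into the sum of ∫ |w_k'' + b w_k'
- A_k w_k|² dt and the bracket into the sum of ∫ (|w_k' + s w_k|² + μ_k |w_k|²) dt. The modes
decouple, and the problem becomes one-dimensional.

Integration by parts rewrites these integrals as ∫ (|w''|² + (b² + 2A)|w'|² + A²|w|²) and ∫ (|w'|² +
(s² + μ)|w|²). Hence C is admissible for a mode as soon as C ≤ b² + 2A and C(s² + μ) ≤ A²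
(`mode_inequality`). For s ≠ 0 the second condition is C ≤ A²/(s² + μ), which is `quotient`, and it
implies the first because (s² + μ)(b² + 2A) - A² = (s² + μ)² + μ b² ≥ 0. For s = 0 the conditions
are C ≤ (d - 2)² + 2μ and Cμ ≤ μ²; the second is void for μ = 0, whence the other form of the
constant (`hrConst_bounds`).

The eigenbasis is built by perturbation. Green's formula on the sphere follows from Euclidean
integration by parts with a radial cutoff (`integral_greenDensity`). The Laplacian is triangular
with respect to the degree on polynomials, so by symmetry it acts as a scalar on each successive
orthogonal complement (`exists_eigenfunction_of_mem_harmonicSpace`); Stone–Weierstrass makes these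
harmonics a Hilbert basis. So -Δ_S is diagonal with eigenvalues tending to infinity. For M > ‖a‖,
the operator (-Δ_S + a + M)⁻¹ = R(1 + aR)⁻¹ with R = (-Δ_S + M)⁻¹ is compact, symmetric and
injective (`exists_resolvent`), and its eigenvectors are the u_k. Since quotients and eigenvalues
tend to infinity, the minima are attained. -/

noncomputable section

namespace HardyRellich

/-! ### Second derivatives along curves -/

section SecondDerivatives

variable {V G : Type*} [NormedAddCommGroup V] [NormedSpace ℝ V]
  [NormedAddCommGroup G] [NormedSpace ℝ G]

/-- Second derivative of `F` along a curve. -/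
theorem hasDerivAt_comp_curve {F : V → G} {γ γ' : ℝ → V} {γ'' : V} {t₀ : ℝ}
    (hF : ContDiffAt ℝ 2 F (γ t₀)) (h1 : ∀ t, HasDerivAt γ (γ' t) t)
    (h2 : HasDerivAt γ' γ'' t₀) :
    (∀ᶠ t in 𝓝 t₀, HasDerivAt (fun t => F (γ t)) (fderiv ℝ F (γ t) (γ' t)) t) ∧
    HasDerivAt (fun t => fderiv ℝ F (γ t) (γ' t))
      (fderiv ℝ (fderiv ℝ F) (γ t₀) (γ' t₀) (γ' t₀) + fderiv ℝ F (γ t₀) γ'') t₀ := by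
  have hc : ContinuousAt γ t₀ := (h1 t₀).continuousAt
  have hev : ∀ᶠ x in 𝓝 (γ t₀), ContDiffAt ℝ 2 F x := hF.eventually (by simp)
  constructor
  · filter_upwards [hc.eventually hev] with t ht
    exact ((ht.differentiableAt (by simp)).hasFDerivAt).comp_hasDerivAt t (h1 t)
  · have h3 : DifferentiableAt ℝ (fderiv ℝ F) (γ t₀) :=
      (hF.fderiv_right (m := 1) (by norm_num)).differentiableAt (by simp)
    have h4 : HasDerivAt (fun t => fderiv ℝ F (γ t)) (fderiv ℝ (fderiv ℝ F) (γ t₀) (γ' t₀)) t₀ :=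
      h3.hasFDerivAt.comp_hasDerivAt t₀ (h1 t₀)
    exact h4.clm_apply h2

/-- Two functions that agree along a curve have the same second derivative along it. -/
theorem second_derivative_curve_congr {F₁ F₂ : V → G} {γ γ' : ℝ → V} {γ'' : V} {t₀ : ℝ}
    (hF₁ : ContDiffAt ℝ 2 F₁ (γ t₀)) (hF₂ : ContDiffAt ℝ 2 F₂ (γ t₀))
    (h1 : ∀ t, HasDerivAt γ (γ' t) t) (h2 : HasDerivAt γ' γ'' t₀)
    (h : ∀ᶠ t in 𝓝 t₀, F₁ (γ t) = F₂ (γ t)) :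
    fderiv ℝ (fderiv ℝ F₁) (γ t₀) (γ' t₀) (γ' t₀) + fderiv ℝ F₁ (γ t₀) γ'' =
      fderiv ℝ (fderiv ℝ F₂) (γ t₀) (γ' t₀) (γ' t₀) + fderiv ℝ F₂ (γ t₀) γ'' := by
  obtain ⟨a1, a2⟩ := hasDerivAt_comp_curve hF₁ h1 h2
  obtain ⟨b1, b2⟩ := hasDerivAt_comp_curve hF₂ h1 h2
  have e : (fun t => fderiv ℝ F₁ (γ t) (γ' t)) =ᶠ[𝓝 t₀] fun t => fderiv ℝ F₂ (γ t) (γ' t) := by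
    filter_upwards [a1, b1, h.eventually_nhds] with t ha hb ht
    exact ha.unique (hb.congr_of_eventuallyEq ht)
  exact a2.unique (b2.congr_of_eventuallyEq e)

end SecondDerivatives

/-! ### Homogeneous extensions, and the Laplacian and gradient on the sphere -/

theorem laplacian_apply {d : ℕ} {ι : Type*} [Fintype ι] (b : OrthonormalBasis ι ℝ (E d))
    (F : E d → ℂ) (x : E d) :
    Laplacian.laplacian F x = ∑ i, fderiv ℝ (fderiv ℝ F) x (b i) (b i) := by
  rw [InnerProductSpace.laplacian_eq_iteratedFDeriv_orthonormalBasis F b]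
  simp [iteratedFDeriv_two_apply]

theorem laplacian_apply_single {d : ℕ} (F : E d → ℂ) (x : E d) :
    Laplacian.laplacian F x = ∑ j, fderiv ℝ (fderiv ℝ F) x (EuclideanSpace.single j 1)
      (EuclideanSpace.single j 1) := by
  simpa using laplacian_apply (EuclideanSpace.basisFun (Fin d) ℝ) F x

theorem norm_coe_sphere {d : ℕ} (θ : S d) : ‖(θ : E d)‖ = 1 := by
  simp

theorem coe_sphere_ne_zero {d : ℕ} (θ : S d) : (θ : E d) ≠ 0 := by
  intro h
  simpa [h] using norm_coe_sphere θ

theorem homExt_restrict {d : ℕ} {F : Type*} [Zero F] (f : E d → F) {x : E d} (hx : x ≠ 0) :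
    homExt (fun θ : S d => f θ) x = f (‖x‖⁻¹ • x) := by
  simp [homExt, hx]

theorem homExt_coe {d : ℕ} {F : Type*} [Zero F] (g : S d → F) (θ : S d) :
    homExt g (θ : E d) = g θ := by
  rw [homExt, dif_neg (coe_sphere_ne_zero θ)]
  congr 1
  ext1
  simp

theorem homExt_smul {d : ℕ} {F : Type*} [Zero F] (g : S d → F) {r : ℝ} (hr : 0 < r) (x : E d) :
    homExt g (r • x) = homExt g x := by
  by_cases hx : x = 0
  · simp [hx]
  rw [homExt, homExt, dif_neg hx, dif_neg (by simp [hx, hr.ne'])]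
  congr 2
  rw [norm_smul, Real.norm_of_nonneg hr.le, mul_inv, smul_smul]
  congr 1
  field_simp

theorem contDiffOn_normalize {d : ℕ} :
    ContDiffOn ℝ ∞ (fun x : E d => ‖x‖⁻¹ • x) {0}ᶜ := by
  intro x hx
  have hx : x ≠ 0 := by simpa using hx
  exact (((contDiffAt_norm ℝ hx).inv (by simpa using hx)).smul contDiffAt_id).contDiffWithinAt

theorem smoothOnSphere_restrict {d : ℕ} {F : E d → ℂ} (hF : ContDiffOn ℝ ∞ F {0}ᶜ) :
    SmoothOnSphere (fun θ : S d => F θ) := by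
  have h : ContDiffOn ℝ ∞ (fun x => F (‖x‖⁻¹ • x)) {0}ᶜ :=
    hF.comp contDiffOn_normalize (fun x hx => by
      have : x ≠ 0 := by simpa using hx
      simpa using this)
  exact h.congr fun x hx => homExt_restrict F (by simpa using hx)

theorem SmoothOnSphere.contDiffAt {d : ℕ} {φ : S d → ℂ} (h : SmoothOnSphere φ) {x : E d}
    (hx : x ≠ 0) : ContDiffAt ℝ ∞ (homExt φ) x :=
  ContDiffOn.contDiffAt h (isOpen_compl_singleton.mem_nhds (by simpa using hx))

theorem SmoothOnSphere.continuous {d : ℕ} {φ : S d → ℂ} (h : SmoothOnSphere φ) :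
    Continuous φ := by
  have h1 : Continuous fun θ : S d => homExt φ (θ : E d) := by
    rw [continuous_iff_continuousAt]
    intro θ
    exact ((h.contDiffAt (coe_sphere_ne_zero θ)).continuousAt).comp continuous_subtype_val.continuousAt
  simpa [homExt_coe] using h1

theorem fderiv_homExt_radial {d : ℕ} (φ : S d → ℂ) {x : E d} (hx : x ≠ 0)
    (h : SmoothOnSphere φ) : fderiv ℝ (homExt φ) x x = 0 := by
  have h1 : HasDerivAt (fun t : ℝ => homExt φ (x + t • x)) (fderiv ℝ (homExt φ) x x) 0 := by
    have h2 : HasDerivAt (fun t : ℝ => x + t • x) x 0 := by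
      simpa using ((hasDerivAt_id (0 : ℝ)).smul_const x).const_add x
    have h3 : HasFDerivAt (homExt φ) (fderiv ℝ (homExt φ) x) (x + (0 : ℝ) • x) := by
      simpa using ((h.contDiffAt hx).differentiableAt (by simp)).hasFDerivAt
    exact h3.comp_hasDerivAt 0 h2
  have h2 : (fun t : ℝ => homExt φ (x + t • x)) =ᶠ[𝓝 0] fun _ => homExt φ x := by
    filter_upwards [eventually_gt_nhds (show (-1 : ℝ) < 0 by norm_num)] with t ht
    have : x + t • x = (1 + t) • x := by rw [add_smul, one_smul]
    rw [this, homExt_smul φ (by linarith)]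
  exact h1.unique ((hasDerivAt_const (0 : ℝ) (homExt φ x)).congr_of_eventuallyEq h2)

theorem second_fderiv_homExt_radial {d : ℕ} (φ : S d → ℂ) {x : E d} (hx : x ≠ 0)
    (h : SmoothOnSphere φ) : fderiv ℝ (fderiv ℝ (homExt φ)) x x x = 0 := by
  have h2 : ∀ t : ℝ, HasDerivAt (fun t : ℝ => x + t • x) x t := fun t => by
    simpa using ((hasDerivAt_id t).smul_const x).const_add x
  have key := second_derivative_curve_congr (F₁ := homExt φ) (F₂ := fun _ => homExt φ x)
    (γ := fun t : ℝ => x + t • x) (γ' := fun _ => x) (γ'' := 0) (t₀ := 0)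
    (by simpa using (h.contDiffAt hx).of_le (by norm_cast)) contDiffAt_const h2
    (hasDerivAt_const _ _) (by
      filter_upwards [eventually_gt_nhds (show (-1 : ℝ) < 0 by norm_num)] with t ht
      have : x + t • x = (1 + t) • x := by rw [add_smul, one_smul]
      rw [this, homExt_smul φ (by linarith)])
  simpa using key

/-- On the great circle cos t θ + sin t e the function and its extension agree. Its acceleration at
t = 0 is -θ, which contributes the first-order term for F and nothing for the extension, whose
radial derivative vanishes. -/
theorem second_fderiv_homExt_tangential {d : ℕ} {F : E d → ℂ} (hF : ContDiffOn ℝ ∞ F {0}ᶜ)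
    (θ : S d) {e : E d} (he : ‖e‖ = 1) (hθe : inner ℝ (θ : E d) e = 0) :
    fderiv ℝ (fderiv ℝ (homExt fun η : S d => F η)) θ e e =
      fderiv ℝ (fderiv ℝ F) θ e e - fderiv ℝ F θ θ := by
  set γ : ℝ → E d := fun t => Real.cos t • (θ : E d) + Real.sin t • e
  have hn : ∀ t, ‖γ t‖ = 1 := by
    intro t
    have : ‖γ t‖ ^ 2 = 1 := by
      simp only [γ]
      rw [norm_add_sq_real, norm_smul, norm_smul, inner_smul_left, inner_smul_right, hθe, he,
        norm_coe_sphere]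
      simp
    nlinarith [norm_nonneg (γ t)]
  have hsm := smoothOnSphere_restrict hF
  have h0 : γ 0 = θ := by simp [γ]
  have key := second_derivative_curve_congr (F₁ := homExt fun η : S d => F η) (F₂ := F)
    (γ := γ) (γ' := fun t => (-Real.sin t) • (θ : E d) + Real.cos t • e)
    (γ'' := -(θ : E d)) (t₀ := 0)
    (by rw [h0]; exact (hsm.contDiffAt (coe_sphere_ne_zero θ)).of_le (by norm_cast))
    (by
      rw [h0]
      exact (hF.contDiffAt (isOpen_compl_singleton.mem_nhds
        (by simpa using coe_sphere_ne_zero θ))).of_le (by norm_cast))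
    (fun t => ((Real.hasDerivAt_cos t).smul_const _).add ((Real.hasDerivAt_sin t).smul_const _))
    (by
      have := (((Real.hasDerivAt_sin 0).neg).smul_const (θ : E d)).add
        ((Real.hasDerivAt_cos 0).smul_const e)
      simp only [Real.cos_zero, Real.sin_zero, neg_zero, zero_smul, add_zero, neg_smul,
        one_smul] at this
      exact this)
    (by
      refine Eventually.of_forall fun t => ?_
      rw [homExt_restrict F (by rw [← norm_ne_zero_iff, hn t]; simp), hn t]
      simp)
  rw [h0] at key
  simp only [Real.sin_zero, Real.cos_zero, neg_zero, zero_smul, one_smul, zero_add, map_neg] at key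
  rw [fderiv_homExt_radial _ (coe_sphere_ne_zero θ) hsm] at key
  rw [neg_zero, add_zero] at key
  rw [key, sub_eq_add_neg]

/-- An orthonormal basis that contains a given point of the sphere. -/
theorem exists_orthonormalBasis_mem {d : ℕ} (θ : S d) :
    ∃ (b : OrthonormalBasis (Fin d) ℝ (E d)) (i₀ : Fin d), b i₀ = θ := by
  have hd : 0 < d := by
    rcases Nat.eq_zero_or_pos d with rfl | h
    · exact absurd (Subsingleton.elim _ _) (coe_sphere_ne_zero θ)
    · exact h
  let i₀ : Fin d := ⟨0, hd⟩
  obtain ⟨b, hb⟩ := Orthonormal.exists_orthonormalBasis_extension_of_card_eq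
    (𝕜 := ℝ) (E := E d) (ι := Fin d) (by simp) (v := fun _ => (θ : E d)) (s := {i₀})
    ⟨fun i => norm_coe_sphere θ, fun i j hij => absurd (Subsingleton.elim i j) hij⟩
  exact ⟨b, i₀, hb i₀ rfl⟩

/-- The spherical Laplacian of the restriction of a function to the sphere. -/
theorem sphereLaplacian_restrict {d : ℕ} {F : E d → ℂ} (hF : ContDiffOn ℝ ∞ F {0}ᶜ) (θ : S d) :
    sphereLaplacian (fun η : S d => F η) θ = Laplacian.laplacian F (θ : E d)
      - fderiv ℝ (fderiv ℝ F) θ θ θ - ((d : ℂ) - 1) * fderiv ℝ F θ θ := by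
  obtain ⟨b, i₀, hb⟩ := exists_orthonormalBasis_mem θ
  have hsm := smoothOnSphere_restrict hF
  unfold sphereLaplacian
  rw [laplacian_apply b, laplacian_apply b,
    ← Finset.add_sum_erase _ _ (Finset.mem_univ i₀),
    ← Finset.add_sum_erase (a := i₀) _ (fun i => fderiv ℝ (fderiv ℝ F) θ (b i) (b i))
      (Finset.mem_univ i₀), hb, second_fderiv_homExt_radial _ (coe_sphere_ne_zero θ) hsm]
  -- The radial direction contributes zero to the Laplacian of the extension; each of the d - 1
  -- others contributes one copy of the radial derivative.
  have : ∀ i ∈ Finset.univ.erase i₀,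
      fderiv ℝ (fderiv ℝ (homExt fun η : S d => F η)) θ (b i) (b i) =
      fderiv ℝ (fderiv ℝ F) θ (b i) (b i) - fderiv ℝ F θ θ := by
    intro i hi
    refine second_fderiv_homExt_tangential hF θ (b.orthonormal.1 i) ?_
    rw [← hb]
    exact b.orthonormal.2 (Finset.ne_of_mem_erase hi).symm
  rw [Finset.sum_congr rfl this, Finset.sum_sub_distrib, Finset.sum_const,
    Finset.card_erase_of_mem (Finset.mem_univ _)]
  have hd : 1 ≤ d := i₀.pos
  simp only [Finset.card_univ, Fintype.card_fin, nsmul_eq_mul]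
  push_cast [hd]
  ring

/-- The derivative of x ↦ x/|x| at θ is the orthogonal projection onto the tangent space, so only
the tangential part of v survives. -/
theorem fderiv_homExt_restrict {d : ℕ} {F : E d → ℂ} (hF : ContDiffOn ℝ ∞ F {0}ᶜ) (θ : S d)
    (v : E d) :
    fderiv ℝ (homExt fun η : S d => F η) θ v =
      fderiv ℝ F θ v - (inner ℝ (θ : E d) v : ℝ) * fderiv ℝ F θ θ := by
  have hsm := smoothOnSphere_restrict hF
  have hFd : DifferentiableAt ℝ F θ := (hF.contDiffAt (isOpen_compl_singleton.mem_nhds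
        (by simpa using coe_sphere_ne_zero θ))).differentiableAt (by simp)
  have hΦd := (hsm.contDiffAt (coe_sphere_ne_zero θ)).differentiableAt (by simp)
  have tang : ∀ e : E d, inner ℝ (θ : E d) e = 0 → 
      fderiv ℝ (homExt fun η : S d => F η) θ e = fderiv ℝ F θ e := by
    intro e he
    have hc : HasDerivAt (fun t : ℝ => ‖(θ : E d) + t • e‖⁻¹ • ((θ : E d) + t • e)) e 0 := by
      have h1 : HasDerivAt (fun t : ℝ => (θ : E d) + t • e) e 0 := by
        simpa using ((hasDerivAt_id (0 : ℝ)).smul_const e).const_add (θ : E d)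
      have h2 : HasDerivAt (fun t : ℝ => ‖(θ : E d) + t • e‖ ^ 2) 0 0 := by
        simpa [he] using h1.norm_sq
      have h3 : HasDerivAt (fun t : ℝ => ‖(θ : E d) + t • e‖⁻¹) 0 0 := by
        have h4 := h2.sqrt (by simp)
        simp only [norm_nonneg, Real.sqrt_sq, zero_div] at h4
        have h5 := h4.inv (by simp)
        simp only [neg_zero, zero_div] at h5
        exact h5
      have h4 := h3.smul h1
      simp only [zero_smul, add_zero, norm_coe_sphere, inv_one, one_smul] at h4
      exact h4
    have h1 : HasDerivAt (fun t : ℝ => (θ : E d) + t • e) e 0 := by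
      simpa using ((hasDerivAt_id (0 : ℝ)).smul_const e).const_add (θ : E d)
    have a1 : HasDerivAt (fun t : ℝ => homExt (fun η : S d => F η) ((θ : E d) + t • e))
        (fderiv ℝ (homExt fun η : S d => F η) θ e) 0 := by
      have h3 : HasFDerivAt (homExt fun η : S d => F η)
          (fderiv ℝ (homExt fun η : S d => F η) θ) ((θ : E d) + (0 : ℝ) • e) := by
        simpa using hΦd.hasFDerivAt
      exact h3.comp_hasDerivAt 0 h1
    have a2 : HasDerivAt (fun t : ℝ => F (‖(θ : E d) + t • e‖⁻¹ • ((θ : E d) + t • e)))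
        (fderiv ℝ F θ e) 0 := by
      have h3 : HasFDerivAt F (fderiv ℝ F θ)
          (‖(θ : E d) + (0 : ℝ) • e‖⁻¹ • ((θ : E d) + (0 : ℝ) • e)) := by
        simpa using hFd.hasFDerivAt
      exact h3.comp_hasDerivAt 0 hc
    refine a1.unique (a2.congr_of_eventuallyEq ?_)
    have : ∀ᶠ t : ℝ in 𝓝 0, (θ : E d) + t • e ≠ 0 := by
      have h2 : ContinuousAt (fun t : ℝ => (θ : E d) + t • e) 0 := by fun_prop
      refine h2.eventually_ne ?_
      simpa using coe_sphere_ne_zero θ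
    filter_upwards [this] with t ht
    exact homExt_restrict F ht
  have hv : v = (v - (inner ℝ (θ : E d) v : ℝ) • (θ : E d)) + (inner ℝ (θ : E d) v : ℝ) • (θ : E d) := by
    simp
  have h1 := tang (v - (inner ℝ (θ : E d) v : ℝ) • (θ : E d)) (by
    rw [inner_sub_right, inner_smul_right, real_inner_self_eq_norm_sq, norm_coe_sphere]; simp)
  conv_lhs => rw [hv]
  rw [map_add, h1, map_smul, fderiv_homExt_radial _ (coe_sphere_ne_zero θ) hsm, map_sub, map_smul]
  simp

/-- Pythagoras: the gradient of the extension is the tangential part of the gradient of F. -/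
theorem gradSq_homExt_restrict {d : ℕ} {F : E d → ℂ} (hF : ContDiffOn ℝ ∞ F {0}ᶜ) (θ : S d) :
    gradSq (homExt fun η : S d => F η) θ = gradSq F θ - ‖fderiv ℝ F θ θ‖ ^ 2 := by
  have hθ : (θ : E d) = ∑ j, (θ : E d) j • EuclideanSpace.single j (1 : ℝ) := by
    have := (EuclideanSpace.basisFun (Fin d) ℝ).sum_repr (θ : E d)
    simpa using this.symm
  have hsq : ∑ j, ((θ : E d) j) ^ 2 = 1 := by
    rw [← EuclideanSpace.real_norm_sq_eq, norm_coe_sphere]; simp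
  set L := fderiv ℝ F (θ : E d)
  have hL : L θ = ∑ j, ((θ : E d) j : ℂ) * L (EuclideanSpace.single j 1) := by
    conv_lhs => rw [hθ]
    rw [map_sum]
    simp
  have key : ∑ j, ((θ : E d) j) * (L (EuclideanSpace.single j 1) * (starRingEnd ℂ) (L θ)).re
      = ‖L θ‖ ^ 2 := by
    rw [← Complex.normSq_eq_norm_sq, ← Complex.ofReal_re (Complex.normSq _), ← Complex.mul_conj]
    conv_rhs => 
      enter [1, 1]
      rw [hL]
    rw [Finset.sum_mul, Complex.re_sum]
    refine Finset.sum_congr rfl fun j _ => ?_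
    rw [mul_assoc, Complex.re_ofReal_mul]
  have hj : ∀ j, ‖L (EuclideanSpace.single j 1) - ((θ : E d) j : ℂ) * L θ‖ ^ 2 =
      ‖L (EuclideanSpace.single j 1)‖ ^ 2 
        - 2 * (((θ : E d) j) * (L (EuclideanSpace.single j 1) * (starRingEnd ℂ) (L θ)).re)
        + ((θ : E d) j) ^ 2 * ‖L θ‖ ^ 2 := by
    intro j
    simp only [← Complex.normSq_eq_norm_sq, Complex.normSq_apply]
    simp
    ring
  have hin : ∀ j, inner ℝ (θ : E d) (EuclideanSpace.single j 1) = (θ : E d) j := by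
    intro j
    rw [EuclideanSpace.inner_single_right]
    simp
  simp only [gradSq]
  simp_rw [fderiv_homExt_restrict hF θ, hin]
  simp_rw [show fderiv ℝ F (θ : E d) = L from rfl, hj]
  rw [Finset.sum_add_distrib, Finset.sum_sub_distrib, ← Finset.mul_sum, key, ← Finset.sum_mul, hsq]
  ring

/-! ### Logarithmic polar coordinates -/

/-- The measure `e^{dt} dt` on the line. -/
def expMeasure (d : ℕ) : Measure ℝ :=
  volume.withDensity fun t => ENNReal.ofReal (Real.exp (d * t))

instance (d : ℕ) : SFinite (expMeasure d) :=
  inferInstanceAs (SFinite (volume.withDensity _))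

/-- Logarithmic polar coordinates. -/
def polarMap (d : ℕ) (p : ℝ × S d) : E d := Real.exp p.1 • (p.2 : E d)

theorem continuous_polarMap (d : ℕ) : Continuous (polarMap d) := by
  unfold polarMap; fun_prop

/-- The substitution r = e^t gives r^{d-1} dr = e^{dt} dt. -/
theorem measurePreserving_exp {d : ℕ} (hd : 1 ≤ d) :
    MeasurePreserving Real.expOrderIso (expMeasure d) (Measure.volumeIoiPow (d - 1)) := by
  have hmeas : Measurable Real.expOrderIso := Real.expOrderIso.toHomeomorph.measurable
  refine ⟨hmeas, ?_⟩
  ext s hs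
  rw [Measure.map_apply hmeas hs, expMeasure, withDensity_apply _ (hmeas hs),
    Measure.volumeIoiPow, withDensity_apply _ hs,
    setLIntegral_subtype measurableSet_Ioi _ fun a : ℝ => ENNReal.ofReal (a ^ (d - 1))]
  have him : (Subtype.val '' s : Set ℝ) = Real.exp '' (Real.expOrderIso ⁻¹' s) := by
    ext x
    constructor
    · rintro ⟨y, hy, rfl⟩
      refine ⟨Real.log y, ?_, Real.exp_log y.2⟩
      have : Real.expOrderIso (Real.log y) = y := Subtype.ext (by simp [Real.exp_log y.2])
      simpa [this] using hy
    · rintro ⟨t, ht, rfl⟩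
      exact ⟨_, ht, by simp⟩
  rw [him, lintegral_image_eq_lintegral_abs_deriv_mul (hmeas hs)
    (fun x _ => (Real.hasDerivAt_exp x).hasDerivWithinAt) Real.exp_injective.injOn]
  refine lintegral_congr fun t => ?_
  rw [← ENNReal.ofReal_mul (abs_nonneg _), abs_of_pos (Real.exp_pos t), ← pow_succ',
    Nat.sub_add_cancel hd, ← Real.exp_nat_mul]

theorem measurePreserving_polarMap {d : ℕ} (hd : 1 ≤ d) :
    MeasurePreserving (polarMap d) ((expMeasure d).prod (σ d)) volume := by
  have h1 : MeasurePreserving (Prod.map Real.expOrderIso (id : S d → S d))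
      ((expMeasure d).prod (σ d)) ((Measure.volumeIoiPow (d - 1)).prod (σ d)) :=
    (measurePreserving_exp hd).prod (MeasurePreserving.id _)
  have h2 : MeasurePreserving (Prod.swap : Ioi (0 : ℝ) × S d → _)
      ((Measure.volumeIoiPow (d - 1)).prod (σ d)) ((σ d).prod (Measure.volumeIoiPow (d - 1))) :=
    Measure.measurePreserving_swap
  have h3 := (volume : Measure (E d)).measurePreserving_homeomorphUnitSphereProd
  have h4 : MeasurePreserving (homeomorphUnitSphereProd (E d)).symm
      ((σ d).prod (Measure.volumeIoiPow (d - 1))) (volume.comap Subtype.val) := by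
    have := MeasurePreserving.symm (homeomorphUnitSphereProd (E d)).toMeasurableEquiv h3
    simpa [σ] using this
  have h5 := measurePreserving_subtype_coe (μa := (volume : Measure (E d)))
    (measurableSet_singleton (0 : E d)).compl
  -- In positive dimension the origin is a null set, so removing it does not change the measure.
  have : Nonempty (Fin d) := ⟨⟨0, hd⟩⟩
  rw [restrict_compl_singleton] at h5
  exact h5.comp (h4.comp (h2.comp h1))

theorem measurableEmbedding_polarMap (d : ℕ) : MeasurableEmbedding (polarMap d) := by
  refine Continuous.measurableEmbedding (continuous_polarMap d) ?_
  rintro ⟨t, θ⟩ ⟨s, η⟩ h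
  simp only [polarMap] at h
  have hts : Real.exp t = Real.exp s := by
    have := congrArg norm h
    simpa [norm_smul] using this
  have hts' := Real.exp_injective hts
  subst hts'
  have := smul_right_injective (E d) (Real.exp_pos t).ne' h
  exact Prod.ext rfl (Subtype.ext this)

theorem integrable_comp_polarMap {d : ℕ} (hd : 1 ≤ d) {F : Type*} [NormedAddCommGroup F]
    {f : E d → F} : Integrable (fun p => f (polarMap d p)) ((expMeasure d).prod (σ d)) ↔
      Integrable f :=
  (measurePreserving_polarMap hd).integrable_comp_emb (measurableEmbedding_polarMap d)

theorem integral_polar {d : ℕ} (hd : 1 ≤ d) {F : Type*} [NormedAddCommGroup F] [NormedSpace ℝ F]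
    {f : E d → F} (hf : Integrable f) :
    ∫ x, f x = ∫ t : ℝ, Real.exp (d * t) • ∫ θ, f (Real.exp t • (θ : E d)) ∂(σ d) := by
  rw [← (measurePreserving_polarMap hd).integral_comp (measurableEmbedding_polarMap d),
    integral_prod _ ((integrable_comp_polarMap hd).mpr hf), expMeasure,
    integral_withDensity_eq_integral_toReal_smul (by fun_prop) (by simp)]
  refine integral_congr_ae (Eventually.of_forall fun t => ?_)
  simp [ENNReal.toReal_ofReal (Real.exp_pos _).le, polarMap]

theorem integrable_of_continuousOn_annulus {d : ℕ} {F : Type*} [NormedAddCommGroup F]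
    {h : E d → F} (hc : ContinuousOn h {0}ᶜ) {K : Set (E d)} (hK : IsCompact K)
    (h0 : (0 : E d) ∉ K) (hs : ∀ x ∉ K, h x = 0) : Integrable h := by
  have h1 : IntegrableOn h K :=
    (hc.mono fun x hx => by rintro rfl; exact h0 hx).integrableOn_compact hK
  rwa [integrableOn_iff_integrable_of_support_subset] at h1
  intro x hx
  by_contra hxK
  exact hx (hs x hxK)

/-! ### Green's formula on the sphere -/

theorem fderiv_comp_const_smul {d : ℕ} (F : E d → ℂ) (c : ℝ) (x : E d) :
    fderiv ℝ (fun y => F (c • y)) x = c • fderiv ℝ F (c • x) :=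
  fderiv_comp_smul c

theorem fderiv_fderiv_comp_const_smul {d : ℕ} (F : E d → ℂ) (c : ℝ) (x : E d) :
    fderiv ℝ (fderiv ℝ fun y => F (c • y)) x = c ^ 2 • fderiv ℝ (fderiv ℝ F) (c • x) := by
  have : (fderiv ℝ fun y => F (c • y)) = c • fun y => fderiv ℝ F (c • y) := by
    funext y; exact fderiv_comp_const_smul F c y
  rw [this]
  have h2 : fderiv ℝ (fun y => fderiv ℝ F (c • y)) x = c • fderiv ℝ (fderiv ℝ F) (c • x) :=
    fderiv_comp_smul c
  have h3 := congrFun (fderiv_const_smul_field (f := fun y => fderiv ℝ F (c • y)) (𝕜 := ℝ) c) x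
  rw [h3, Pi.smul_apply, h2, smul_smul, sq]

theorem laplacian_comp_const_smul {d : ℕ} (F : E d → ℂ) (c : ℝ) (x : E d) :
    Laplacian.laplacian (fun y => F (c • y)) x = (c : ℂ) ^ 2 * Laplacian.laplacian F (c • x) := by
  rw [laplacian_apply_single, laplacian_apply_single, Finset.mul_sum]
  refine Finset.sum_congr rfl fun j _ => ?_
  rw [fderiv_fderiv_comp_const_smul]
  simp

theorem SmoothOnSphere.continuousOn_fderiv {d : ℕ} {φ : S d → ℂ} (h : SmoothOnSphere φ) :
    ContinuousOn (fderiv ℝ (homExt φ)) {0}ᶜ :=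
  ContDiffOn.continuousOn_fderiv_of_isOpen h isOpen_compl_singleton (by norm_cast)

theorem SmoothOnSphere.contDiffOn_fderiv {d : ℕ} {φ : S d → ℂ} (h : SmoothOnSphere φ) :
    ContDiffOn ℝ ∞ (fderiv ℝ (homExt φ)) {0}ᶜ :=
  ContDiffOn.fderiv_of_isOpen h isOpen_compl_singleton (by norm_cast)

theorem SmoothOnSphere.continuousOn_fderiv_fderiv {d : ℕ} {φ : S d → ℂ} (h : SmoothOnSphere φ) :
    ContinuousOn (fderiv ℝ (fderiv ℝ (homExt φ))) {0}ᶜ :=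
  h.contDiffOn_fderiv.continuousOn_fderiv_of_isOpen isOpen_compl_singleton (by norm_cast)

theorem SmoothOnSphere.continuousOn_laplacian {d : ℕ} {φ : S d → ℂ} (h : SmoothOnSphere φ) :
    ContinuousOn (Laplacian.laplacian (homExt φ)) {0}ᶜ := by
  have : Laplacian.laplacian (homExt φ) = fun x => ∑ j, fderiv ℝ (fderiv ℝ (homExt φ)) x
      (EuclideanSpace.single j 1) (EuclideanSpace.single j 1) := by
    funext x; exact laplacian_apply_single _ x
  rw [this]
  exact continuousOn_finsetSum _ fun j _ =>
    (h.continuousOn_fderiv_fderiv.clm_apply continuousOn_const).clm_apply continuousOn_const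

/-- The integrand of Green's formula on the sphere, as a function homogeneous of degree `-2`. -/
def greenDensity {d : ℕ} (φ ψ : S d → ℂ) (x : E d) : ℂ :=
  homExt φ x * Laplacian.laplacian (homExt ψ) x +
    ∑ j : Fin d, fderiv ℝ (homExt φ) x (EuclideanSpace.single j 1) *
      fderiv ℝ (homExt ψ) x (EuclideanSpace.single j 1)

/-- The extensions have degree 0 and every term carries two derivatives, so the density is
homogeneous of degree -2. -/
theorem greenDensity_smul {d : ℕ} (φ ψ : S d → ℂ) {r : ℝ} (hr : 0 < r) (x : E d) :
    greenDensity φ ψ x = (r : ℂ) ^ 2 * greenDensity φ ψ (r • x) := by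
  have e : ∀ χ : S d → ℂ, (fun y => homExt χ (r • y)) = homExt χ := fun χ => by
    funext y; exact homExt_smul χ hr y
  have h1 := laplacian_comp_const_smul (homExt ψ) r x
  have h2 := fderiv_comp_const_smul (homExt ψ) r x
  have h3 := fderiv_comp_const_smul (homExt φ) r x
  rw [e] at h1 h2 h3
  rw [greenDensity, greenDensity, h1, h2, h3, homExt_smul φ hr, mul_add, Finset.mul_sum]
  congr 1
  · ring
  · refine Finset.sum_congr rfl fun j _ => ?_
    simp
    ring

/-- A one-dimensional bump function that is supported in `[1, 3]`. -/
def radialBump : ContDiffBump (2 : ℝ) := ⟨1 / 2, 1, by norm_num, by norm_num⟩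

theorem radialBump_eq_zero {s : ℝ} (h : s ∉ Icc (1 : ℝ) 3) : radialBump s = 0 := by
  apply radialBump.zero_of_le_dist
  rw [Real.dist_eq]
  change 1 ≤ |s - 2|
  by_contra hlt
  rw [not_le, abs_lt] at hlt
  exact h ⟨by linarith, by linarith⟩

/-- Integration by parts in ℝ^d of the cut-off extension of φ against the gradient of the extension
of ψ. The gradient of a radial cutoff is parallel to x, and the extension of ψ has no radial
derivative, so the cutoff is never differentiated in the result. -/
theorem integral_radialBump_mul_greenDensity {d : ℕ} {φ ψ : S d → ℂ} (hφ : SmoothOnSphere φ)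
    (hψ : SmoothOnSphere ψ) :
    Integrable (fun x : E d => (radialBump (‖x‖ ^ 2) : ℂ) * greenDensity φ ψ x) ∧
      ∫ x : E d, (radialBump (‖x‖ ^ 2) : ℂ) * greenDensity φ ψ x = 0 := by
  set K : Set (E d) := {x | ‖x‖ ^ 2 ∈ Icc (1 : ℝ) 3} with hKdef
  have hKc : IsClosed K := isClosed_Icc.preimage (by fun_prop)
  have hK : IsCompact K := by
    refine Metric.isCompact_of_isClosed_isBounded hKc ?_
    refine (Metric.isBounded_iff_subset_closedBall 0).mpr ⟨2, fun x hx => ?_⟩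
    rw [mem_closedBall_zero_iff]
    nlinarith [hx.2]
  have h0 : (0 : E d) ∉ K := by simp [hKdef]
  set χ : E d → ℂ := fun x => (radialBump (‖x‖ ^ 2) : ℂ)
  have hχ0 : ∀ x ∉ K, χ x = 0 := fun x hx => by simp [χ, radialBump_eq_zero hx]
  have hbump : ContDiff ℝ ∞ (radialBump : ℝ → ℝ) := radialBump.contDiff
  have hχs : ContDiff ℝ ∞ χ := Complex.ofRealCLM.contDiff.comp (hbump.comp (contDiff_norm_sq ℝ))
  set f : E d → ℂ := fun x => χ x * homExt φ x
  have hf0 : ∀ x ∉ K, f x = 0 := fun x hx => by simp [f, hχ0 x hx]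
  have hfsupp : tsupport f ⊆ K :=
    closure_minimal (fun x hx => by by_contra hxK; exact hx (hf0 x hxK)) hKc
  have hne : ∀ x ∈ K, x ≠ 0 := fun x hx h => h0 (h ▸ hx)
  have hfs : ContDiff ℝ ∞ f := contDiff_iff_contDiffAt.mpr fun x => by
    by_cases hx : x ∈ K
    · exact hχs.contDiffAt.mul (hφ.contDiffAt (hne x hx))
    · refine (contDiffAt_const (c := (0 : ℂ))).congr_of_eventuallyEq ?_
      filter_upwards [hKc.isOpen_compl.mem_nhds hx] with y hy using hf0 y hy
  have hf0' : ∀ x ∉ K, fderiv ℝ f x = 0 := fun x hx => by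
    have : f =ᶠ[𝓝 x] fun _ => 0 := by
      filter_upwards [hKc.isOpen_compl.mem_nhds hx] with y hy using hf0 y hy
    rw [this.fderiv_eq]; simp
  have hsecond : ∀ (j : Fin d) (x : E d), x ≠ 0 →
      fderiv ℝ (fun y => fderiv ℝ (homExt ψ) y (EuclideanSpace.single j 1)) x
        (EuclideanSpace.single j 1) =
      fderiv ℝ (fderiv ℝ (homExt ψ)) x (EuclideanSpace.single j 1) (EuclideanSpace.single j 1) := by
    intro j x hx
    have hd := (hψ.contDiffOn_fderiv.contDiffAt (isOpen_compl_singleton.mem_nhds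
      (show x ∈ ({0}ᶜ : Set (E d)) by simpa using hx))).differentiableAt (by simp)
    rw [fderiv_clm_apply hd (by fun_prop)]
    simp
  have hI1 : ∀ j : Fin d, Integrable fun x => fderiv ℝ f x (EuclideanSpace.single j 1) *
      fderiv ℝ (homExt ψ) x (EuclideanSpace.single j 1) := fun j =>
    integrable_of_continuousOn_annulus
      (((hfs.continuous_fderiv (by simp)).continuousOn.clm_apply continuousOn_const).mul
        (hψ.continuousOn_fderiv.clm_apply continuousOn_const)) hK h0
      (fun x hx => by simp [hf0' x hx])
  have hI2' : ∀ j : Fin d, Integrable fun x => f x * fderiv ℝ (fderiv ℝ (homExt ψ)) x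
      (EuclideanSpace.single j 1) (EuclideanSpace.single j 1) := fun j =>
    integrable_of_continuousOn_annulus (hfs.continuous.continuousOn.mul
      ((hψ.continuousOn_fderiv_fderiv.clm_apply continuousOn_const).clm_apply continuousOn_const))
      hK h0 (fun x hx => by simp [hf0 x hx])
  -- The formula for the second derivative may fail at the origin, where `f` vanishes.
  have heq2 : ∀ j : Fin d, (fun x => f x * fderiv ℝ (fun y => fderiv ℝ (homExt ψ) y
      (EuclideanSpace.single j 1)) x (EuclideanSpace.single j 1)) =
      fun x => f x * fderiv ℝ (fderiv ℝ (homExt ψ)) x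
      (EuclideanSpace.single j 1) (EuclideanSpace.single j 1) := by
    intro j
    funext x
    by_cases hx : x ∈ K
    · rw [hsecond j x (hne x hx)]
    · simp [hf0 x hx]
  have hI2 := hI2'
  simp_rw [← heq2] at hI2
  have hI3 : ∀ j : Fin d, Integrable fun x => f x *
      fderiv ℝ (homExt ψ) x (EuclideanSpace.single j 1) := fun j =>
    integrable_of_continuousOn_annulus (hfs.continuous.continuousOn.mul
        (hψ.continuousOn_fderiv.clm_apply continuousOn_const)) hK h0
      (fun x hx => by simp [hf0 x hx])
  have hparts : ∀ j : Fin d, ∫ x, f x * fderiv ℝ (fderiv ℝ (homExt ψ)) x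
      (EuclideanSpace.single j 1) (EuclideanSpace.single j 1) +
      fderiv ℝ f x (EuclideanSpace.single j 1) *
      fderiv ℝ (homExt ψ) x (EuclideanSpace.single j 1) = 0 := by
    intro j
    have := integral_mul_fderiv_eq_neg_fderiv_mul_of_integrable (hI1 j) (hI2 j) (hI3 j)
      (fun x _ => hfs.differentiable (by simp) x) (fun x hx =>
        (((hψ.contDiffOn_fderiv.contDiffAt (isOpen_compl_singleton.mem_nhds
          (show x ∈ ({0}ᶜ : Set (E d)) by simpa using hne x (hfsupp hx)))).differentiableAt
            (by simp)).clm_apply (differentiableAt_const _)))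
    rw [heq2 j] at this
    rw [integral_add (hI2' j) (hI1 j), this, neg_add_cancel]
  have hpt : ∀ x, χ x * greenDensity φ ψ x = ∑ j : Fin d, (f x * fderiv ℝ (fderiv ℝ (homExt ψ)) x
      (EuclideanSpace.single j 1) (EuclideanSpace.single j 1) +
      fderiv ℝ f x (EuclideanSpace.single j 1) *
      fderiv ℝ (homExt ψ) x (EuclideanSpace.single j 1)) := by
    intro x
    by_cases hx : x ∈ K
    · have hx0 := hne x hx
      have hfd : fderiv ℝ f x = χ x • fderiv ℝ (homExt φ) x + homExt φ x • fderiv ℝ χ x :=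
        fderiv_mul (hχs.differentiable (by simp) x)
          ((hφ.contDiffAt hx0).differentiableAt (by simp))
      have hχd : ∀ v, fderiv ℝ χ x v =
          ((deriv radialBump (‖x‖ ^ 2) * (2 * inner ℝ x v) : ℝ) : ℂ) := by
        intro v
        have a1 : HasFDerivAt (fun y : E d => ‖y‖ ^ 2) (2 • innerSL ℝ x) x :=
          (hasStrictFDerivAt_norm_sq x).hasFDerivAt
        have a2 : HasDerivAt (radialBump : ℝ → ℝ) (deriv radialBump (‖x‖ ^ 2)) (‖x‖ ^ 2) :=
          (hbump.differentiable (by simp) _).hasDerivAt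
        have a3 := Complex.ofRealCLM.hasFDerivAt.comp x (a2.comp_hasFDerivAt x a1)
        have a4 : fderiv ℝ χ x = _ := a3.fderiv
        rw [a4]
        simp
      have hrad : ∑ j : Fin d, (x j : ℂ) * fderiv ℝ (homExt ψ) x (EuclideanSpace.single j 1) = 0 := by
        rw [← fderiv_homExt_radial ψ hx0 hψ]
        have hxs : x = ∑ j, x j • EuclideanSpace.single j (1 : ℝ) := by
          have := (EuclideanSpace.basisFun (Fin d) ℝ).sum_repr x
          simpa using this.symm
        conv_rhs => 
          enter [2]
          rw [hxs]
        rw [map_sum]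
        simp
      have hj : ∀ j : Fin d, fderiv ℝ f x (EuclideanSpace.single j 1) *
          fderiv ℝ (homExt ψ) x (EuclideanSpace.single j 1) =
          χ x * (fderiv ℝ (homExt φ) x (EuclideanSpace.single j 1) *
            fderiv ℝ (homExt ψ) x (EuclideanSpace.single j 1)) +
          (homExt φ x * (deriv radialBump (‖x‖ ^ 2) * 2 : ℝ)) *
            ((x j : ℂ) * fderiv ℝ (homExt ψ) x (EuclideanSpace.single j 1)) := by
        intro j
        have hin : inner ℝ x (EuclideanSpace.single j (1 : ℝ)) = x j := by
          rw [EuclideanSpace.inner_single_right]; simp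
        rw [hfd]
        simp only [add_apply, smul_apply, smul_eq_mul,
          hχd, hin]
        push_cast
        ring
      rw [Finset.sum_add_distrib, Finset.sum_congr rfl fun j _ => hj j, Finset.sum_add_distrib,
        ← Finset.mul_sum, ← Finset.mul_sum, ← Finset.mul_sum, hrad, greenDensity,
        laplacian_apply_single]
      simp only [f]
      ring
    · simp [hχ0 x hx, hf0 x hx, hf0' x hx]
  have hfun : (fun x => χ x * greenDensity φ ψ x) = fun x => ∑ j : Fin d,
      (f x * fderiv ℝ (fderiv ℝ (homExt ψ)) x
      (EuclideanSpace.single j 1) (EuclideanSpace.single j 1) +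
      fderiv ℝ f x (EuclideanSpace.single j 1) *
      fderiv ℝ (homExt ψ) x (EuclideanSpace.single j 1)) := funext hpt
  refine ⟨?_, ?_⟩
  · rw [hfun]
    exact integrable_finsetSum _ fun j _ => (hI2' j).add (hI1 j)
  · rw [hfun]
    refine (integral_finsetSum _ fun j _ => (hI2' j).add (hI1 j)).trans ?_
    exact Finset.sum_eq_zero fun j _ => hparts j

/-- Green's formula on the sphere. -/
theorem integral_greenDensity {d : ℕ} (hd : 1 ≤ d) {φ ψ : S d → ℂ} (hφ : SmoothOnSphere φ)
    (hψ : SmoothOnSphere ψ) : ∫ θ : S d, greenDensity φ ψ θ ∂(σ d) = 0 := by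
  obtain ⟨hI, h0⟩ := integral_radialBump_mul_greenDensity hφ hψ
  rw [integral_polar hd hI] at h0
  -- By homogeneity the integral is a radial integral times the integral over the sphere; it remains
  -- to see that the radial factor is not zero.
  have hin : ∀ t : ℝ, ∫ θ : S d, (radialBump (‖Real.exp t • (θ : E d)‖ ^ 2) : ℂ) *
      greenDensity φ ψ (Real.exp t • (θ : E d)) ∂(σ d) =
      ((radialBump (Real.exp t ^ 2) * (Real.exp t ^ 2)⁻¹ : ℝ) : ℂ) *
        ∫ θ : S d, greenDensity φ ψ θ ∂(σ d) := by
    intro t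
    rw [← integral_const_mul]
    refine integral_congr_ae (Eventually.of_forall fun θ => ?_)
    have hne : (Real.exp t : ℂ) ≠ 0 := by exact_mod_cast (Real.exp_pos t).ne'
    have hn : ‖Real.exp t • (θ : E d)‖ = Real.exp t := by
      rw [norm_smul, norm_coe_sphere, mul_one, Real.norm_of_nonneg (Real.exp_pos t).le]
    simp only [hn]
    rw [greenDensity_smul φ ψ (Real.exp_pos t) θ]
    push_cast
    field_simp
  simp_rw [hin] at h0
  have h1 : (fun t : ℝ => Real.exp (d * t) • (((radialBump (Real.exp t ^ 2) *
      (Real.exp t ^ 2)⁻¹ : ℝ) : ℂ) * ∫ θ : S d, greenDensity φ ψ θ ∂(σ d))) = fun t : ℝ =>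
      (((Real.exp (d * t) * (radialBump (Real.exp t ^ 2) * (Real.exp t ^ 2)⁻¹) : ℝ) : ℂ) *
        ∫ θ : S d, greenDensity φ ψ θ ∂(σ d)) := by
    funext t
    simp [mul_assoc]
  rw [h1, integral_mul_const, integral_complex_ofReal, mul_eq_zero] at h0
  refine h0.resolve_left ?_
  norm_cast
  set g : ℝ → ℝ := fun t => Real.exp (d * t) * (radialBump (Real.exp t ^ 2) * (Real.exp t ^ 2)⁻¹)
  have hgc : Continuous g := by
    have : Continuous (radialBump : ℝ → ℝ) := radialBump.continuous
    refine Continuous.mul (by fun_prop) (Continuous.mul (by fun_prop) ?_)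
    exact Continuous.inv₀ (by fun_prop) fun t => by positivity
  have hgs : HasCompactSupport g := by
    refine HasCompactSupport.intro (isCompact_Icc (a := (0 : ℝ)) (b := 3)) fun t ht => ?_
    have : Real.exp t ^ 2 ∉ Icc (1 : ℝ) 3 := by
      intro h
      apply ht
      constructor
      · by_contra hlt
        have : Real.exp t < 1 := by simpa using not_le.mp hlt
        nlinarith [h.1, Real.exp_pos t]
      · have := Real.add_one_le_exp t
        nlinarith [h.2]
    simp [g, radialBump_eq_zero this]
  have hg0 : 0 ≤ g := fun t => mul_nonneg (Real.exp_pos _).le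
    (mul_nonneg radialBump.nonneg (by positivity))
  have hpos : 0 < ∫ t, g t := by
    -- At t = log 2 / 2 the argument e^{2t} is 2, the centre of the bump.
    refine hgc.integral_pos_of_hasCompactSupport_nonneg_nonzero hgs hg0 
      (x := Real.log 2 / 2) ?_
    have : Real.exp (Real.log 2 / 2) ^ 2 = 2 := by
      rw [← Real.exp_nat_mul]
      push_cast
      rw [mul_div_cancel₀ _ (by norm_num), Real.exp_log (by norm_num)]
    simp only [g, this]
    rw [radialBump.one_of_mem_closedBall (by simp [radialBump])]
    positivity
  exact hpos.ne'

theorem greenDensity_coe {d : ℕ} (φ ψ : S d → ℂ) (θ : S d) :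
    greenDensity φ ψ θ = φ θ * sphereLaplacian ψ θ +
      ∑ j : Fin d, fderiv ℝ (homExt φ) θ (EuclideanSpace.single j 1) *
        fderiv ℝ (homExt ψ) θ (EuclideanSpace.single j 1) := by
  rw [greenDensity, homExt_coe, sphereLaplacian]

theorem SmoothOnSphere.continuous_sphereLaplacian {d : ℕ} {φ : S d → ℂ} (h : SmoothOnSphere φ) :
    Continuous (sphereLaplacian φ) :=
  h.continuousOn_laplacian.comp_continuous continuous_subtype_val
    fun θ => by simpa using coe_sphere_ne_zero θ

theorem integrable_of_continuous {d : ℕ} {F : Type*} [NormedAddCommGroup F] {f : S d → F}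
    (hf : Continuous f) : Integrable f (σ d) := by
  have := hf.continuousOn.integrableOn_compact (μ := σ d) isCompact_univ
  rwa [integrableOn_univ] at this

theorem continuous_tangential {d : ℕ} {φ ψ : S d → ℂ} (hφ : SmoothOnSphere φ)
    (hψ : SmoothOnSphere ψ) : Continuous fun θ : S d =>
      ∑ j : Fin d, fderiv ℝ (homExt φ) θ (EuclideanSpace.single j 1) *
        fderiv ℝ (homExt ψ) θ (EuclideanSpace.single j 1) := by
  have h : ∀ {χ : S d → ℂ}, SmoothOnSphere χ → Continuous fun θ : S d => fderiv ℝ (homExt χ) θ :=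
    fun hχ => hχ.continuousOn_fderiv.comp_continuous continuous_subtype_val
      fun θ => by simpa using coe_sphere_ne_zero θ
  exact continuous_finsetSum _ fun j _ => ((h hφ).clm_apply continuous_const).mul
    ((h hψ).clm_apply continuous_const)

theorem integral_mul_sphereLaplacian {d : ℕ} (hd : 1 ≤ d) {φ ψ : S d → ℂ}
    (hφ : SmoothOnSphere φ) (hψ : SmoothOnSphere ψ) :
    ∫ θ, φ θ * sphereLaplacian ψ θ ∂(σ d) =
      -∫ θ : S d, ∑ j : Fin d, fderiv ℝ (homExt φ) θ (EuclideanSpace.single j 1) *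
        fderiv ℝ (homExt ψ) θ (EuclideanSpace.single j 1) ∂(σ d) := by
  have h := integral_greenDensity hd hφ hψ
  simp_rw [greenDensity_coe] at h
  exact eq_neg_of_add_eq_zero_left ((integral_add (integrable_of_continuous
    (hφ.continuous.mul hψ.continuous_sphereLaplacian))
    (integrable_of_continuous (continuous_tangential hφ hψ))).symm.trans h)

/-- The Laplace–Beltrami operator is symmetric. -/
theorem integral_mul_sphereLaplacian_comm {d : ℕ} (hd : 1 ≤ d) {φ ψ : S d → ℂ}
    (hφ : SmoothOnSphere φ) (hψ : SmoothOnSphere ψ) :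
    ∫ θ, φ θ * sphereLaplacian ψ θ ∂(σ d) = ∫ θ, sphereLaplacian φ θ * ψ θ ∂(σ d) := by
  rw [integral_mul_sphereLaplacian hd hφ hψ]
  simp_rw [mul_comm (sphereLaplacian φ _)]
  rw [integral_mul_sphereLaplacian hd hψ hφ]
  simp_rw [mul_comm (fderiv ℝ (homExt φ) _ _)]

theorem homExt_map {d : ℕ} {F G : Type*} [Zero F] [Zero G] (g : S d → F) (L : F → G)
    (hL : L 0 = 0) : homExt (fun θ => L (g θ)) = fun x : E d => L (homExt g x) := by
  funext x
  by_cases hx : x = 0 <;> simp [homExt, hx, hL]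

theorem homExt_conj {d : ℕ} (φ : S d → ℂ) :
    homExt (fun θ => (starRingEnd ℂ) (φ θ)) = fun x : E d => Complex.conjCLE (homExt φ x) :=
  homExt_map φ Complex.conjCLE (map_zero _)

theorem SmoothOnSphere.conj {d : ℕ} {φ : S d → ℂ} (h : SmoothOnSphere φ) :
    SmoothOnSphere fun θ => (starRingEnd ℂ) (φ θ) := by
  rw [SmoothOnSphere, homExt_conj]
  exact Complex.conjCLE.contDiff.comp_contDiffOn h

theorem sphereLaplacian_conj {d : ℕ} (φ : S d → ℂ) (θ : S d) :
    sphereLaplacian (fun θ => (starRingEnd ℂ) (φ θ)) θ = (starRingEnd ℂ) (sphereLaplacian φ θ) := by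
  unfold sphereLaplacian
  rw [homExt_conj]
  have := congrFun (InnerProductSpace.laplacian_CLE_comp_left (f := homExt φ)
    (l := Complex.conjCLE)) (θ : E d)
  simpa [Function.comp_def] using this

theorem fderiv_homExt_conj {d : ℕ} {φ : S d → ℂ} (x v : E d) :
    fderiv ℝ (homExt fun θ => (starRingEnd ℂ) (φ θ)) x v =
      (starRingEnd ℂ) (fderiv ℝ (homExt φ) x v) := by
  rw [homExt_conj]
  have : fderiv ℝ (fun x : E d => Complex.conjCLE (homExt φ x)) x =
      (Complex.conjCLE : ℂ →L[ℝ] ℂ).comp (fderiv ℝ (homExt φ) x) :=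
    Complex.conjCLE.comp_fderiv
  rw [this]
  simp

/-- The Dirichlet form of the Laplace–Beltrami operator. -/
theorem integral_conj_mul_sphereLaplacian {d : ℕ} (hd : 1 ≤ d) {φ : S d → ℂ}
    (hφ : SmoothOnSphere φ) :
    ∫ θ, (starRingEnd ℂ) (φ θ) * sphereLaplacian φ θ ∂(σ d) =
      -((∫ θ : S d, gradSq (homExt φ) θ ∂(σ d) : ℝ) : ℂ) := by
  rw [integral_mul_sphereLaplacian hd hφ.conj hφ, ← integral_complex_ofReal]
  congr 1
  refine integral_congr_ae (Eventually.of_forall fun θ => ?_)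
  simp only [gradSq]
  push_cast
  refine Finset.sum_congr rfl fun j _ => ?_
  rw [fderiv_homExt_conj, mul_comm, Complex.mul_conj, Complex.normSq_eq_norm_sq]
  push_cast
  rfl

theorem homExt_add {d : ℕ} (φ ψ : S d → ℂ) : homExt (φ + ψ) = homExt φ + homExt ψ := by
  funext x
  by_cases hx : x = 0 <;> simp [homExt, hx]

theorem homExt_const_smul {d : ℕ} (c : ℂ) (φ : S d → ℂ) : homExt (c • φ) = c • homExt φ := by
  funext x
  by_cases hx : x = 0 <;> simp [homExt, hx]

theorem SmoothOnSphere.add {d : ℕ} {φ ψ : S d → ℂ} (hφ : SmoothOnSphere φ)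
    (hψ : SmoothOnSphere ψ) : SmoothOnSphere (φ + ψ) := by
  rw [SmoothOnSphere, homExt_add]
  exact ContDiffOn.add hφ hψ

theorem SmoothOnSphere.const_smul {d : ℕ} (c : ℂ) {φ : S d → ℂ} (hφ : SmoothOnSphere φ) :
    SmoothOnSphere (c • φ) := by
  rw [SmoothOnSphere, homExt_const_smul]
  exact ContDiffOn.const_smul c hφ

theorem sphereLaplacian_add {d : ℕ} {φ ψ : S d → ℂ} (hφ : SmoothOnSphere φ)
    (hψ : SmoothOnSphere ψ) (θ : S d) :
    sphereLaplacian (φ + ψ) θ = sphereLaplacian φ θ + sphereLaplacian ψ θ := by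
  unfold sphereLaplacian
  rw [homExt_add]
  exact ((hφ.contDiffAt (coe_sphere_ne_zero θ)).of_le (by norm_cast)).laplacian_add
    ((hψ.contDiffAt (coe_sphere_ne_zero θ)).of_le (by norm_cast))

theorem sphereLaplacian_const_smul {d : ℕ} (c : ℂ) {φ : S d → ℂ} (hφ : SmoothOnSphere φ)
    (θ : S d) : sphereLaplacian (c • φ) θ = c * sphereLaplacian φ θ := by
  unfold sphereLaplacian
  rw [homExt_const_smul]
  exact InnerProductSpace.laplacian_smul c
    ((hφ.contDiffAt (coe_sphere_ne_zero θ)).of_le (by norm_cast))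

/-! ### The spherical Laplacian on powers of linear forms -/

section Powers

variable {d : ℕ}

theorem fderiv_pow_linear (ℓ : E d →L[ℝ] ℂ) (m : ℕ) (x : E d) :
    fderiv ℝ (fun y => ℓ y ^ m) x = ((m : ℂ) * ℓ x ^ (m - 1)) • ℓ := by
  have := (ℓ.hasFDerivAt (x := x)).pow m
  rw [this.fderiv]
  simp

theorem fderiv_fderiv_pow_linear (ℓ : E d →L[ℝ] ℂ) (m : ℕ) (x v : E d) :
    fderiv ℝ (fderiv ℝ fun y => ℓ y ^ m) x v v =
      (m : ℂ) * (m - 1) * ℓ x ^ (m - 2) * ℓ v ^ 2 := by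
  have h1 : (fderiv ℝ fun y => ℓ y ^ m) = fun x => ((m : ℂ) * ℓ x ^ (m - 1)) • ℓ :=
    funext fun x => fderiv_pow_linear ℓ m x
  have h2 : HasFDerivAt (fun x => (m : ℂ) * ℓ x ^ (m - 1))
      ((m : ℂ) • (((m - 1 : ℕ) : ℂ) * ℓ x ^ (m - 1 - 1)) • ℓ) x := by
    have := ((ℓ.hasFDerivAt (x := x)).pow (m - 1)).const_mul (m : ℂ)
    simpa using this
  rw [h1, (h2.smul_const ℓ).fderiv]
  rcases m with _ | m
  · simp
  · simp
    ring

theorem contDiff_pow_linear (ℓ : E d →L[ℝ] ℂ) (m : ℕ) : ContDiff ℝ ∞ fun y => ℓ y ^ m :=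
  ℓ.contDiff.pow m

theorem smoothOnSphere_pow_linear (ℓ : E d →L[ℝ] ℂ) (m : ℕ) :
    SmoothOnSphere fun θ : S d => ℓ θ ^ m :=
  smoothOnSphere_restrict (F := fun y => ℓ y ^ m) (contDiff_pow_linear ℓ m).contDiffOn

/-- The radial terms m(m - 1) and (d - 1)m add up to m(m + d - 2). The truncated exponent m - 2 is
harmless because m(m - 1) = 0 for m ≤ 1. -/
theorem sphereLaplacian_pow_linear (ℓ : E d →L[ℝ] ℂ) (m : ℕ) (θ : S d) :
    sphereLaplacian (fun θ : S d => ℓ θ ^ m) θ =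
      ((m : ℂ) * (m - 1) * ∑ j, ℓ (EuclideanSpace.single j 1) ^ 2) * ℓ θ ^ (m - 2) -
        ((m : ℂ) * (m + d - 2)) * ℓ θ ^ m := by
  rw [sphereLaplacian_restrict (F := fun y => ℓ y ^ m) (contDiff_pow_linear ℓ m).contDiffOn,
    laplacian_apply_single]
  simp_rw [fderiv_fderiv_pow_linear]
  rw [fderiv_pow_linear, ← Finset.mul_sum]
  rcases m with _ | _ | m
  · simp
  · simp
    left
    ring
  · simp
    ring

end Powers

/-! ### Hilbert bases from orthogonal families -/

section Collect

variable {H : Type*} [NormedAddCommGroup H] [InnerProductSpace ℂ H] [CompleteSpace H]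

theorem exists_hilbertBasis_of_orthogonalFamily {ι : Type*} (W : ι → Submodule ℂ H)
    [∀ i, FiniteDimensional ℂ (W i)]
    (hW : OrthogonalFamily ℂ (fun i => W i) fun i => (W i).subtypeₗᵢ) (h : (⨆ i, W i)ᗮ = ⊥) :
    ∃ b : HilbertBasis (Σ i, Fin (Module.finrank ℂ (W i))) ℂ H, ∀ p, b p ∈ W p.1 := by
  have hv : Orthonormal ℂ fun p : Σ i, Fin (Module.finrank ℂ (W i)) =>
      (W p.1).subtypeₗᵢ (stdOrthonormalBasis ℂ (W p.1) p.2) :=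
    hW.orthonormal_sigma_orthonormal fun i => (stdOrthonormalBasis ℂ (W i)).orthonormal
  have hsp : (Submodule.span ℂ (range fun p : Σ i, Fin (Module.finrank ℂ (W i)) =>
      (W p.1).subtypeₗᵢ (stdOrthonormalBasis ℂ (W p.1) p.2)))ᗮ = ⊥ := by
    rw [eq_bot_iff, ← h]
    refine Submodule.orthogonal_le (iSup_le fun i x hx => ?_)
    have hx' := (stdOrthonormalBasis ℂ (W i)).sum_repr ⟨x, hx⟩
    have := congrArg (W i).subtype hx'
    rw [map_sum] at this
    simp only [map_smul, Submodule.subtype_apply] at this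
    rw [← this]
    exact Submodule.sum_mem _ fun k _ => Submodule.smul_mem _ _
      (Submodule.subset_span ⟨⟨i, k⟩, rfl⟩)
  refine ⟨HilbertBasis.mkOfOrthogonalEqBot hv hsp, fun p => ?_⟩
  rw [HilbertBasis.coe_mkOfOrthogonalEqBot]
  exact (stdOrthonormalBasis ℂ (W p.1) p.2).2

end Collect

/-! ### Polynomials on the sphere and their density -/

variable {d : ℕ}

/-- The `m`-th power of a linear form, restricted to the sphere. -/
def linPow (ℓ : E d →L[ℝ] ℂ) (m : ℕ) : C(S d, ℂ) := ⟨fun θ => ℓ θ ^ m, by fun_prop⟩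

/-- The restrictions to the sphere of the polynomials of degree less than `n`. -/
def polySpace (d n : ℕ) : Submodule ℂ C(S d, ℂ) :=
  Submodule.span ℂ {f | ∃ (ℓ : E d →L[ℝ] ℂ) (m : ℕ), m < n ∧ f = linPow ℓ m}

theorem linPow_mem_polySpace (ℓ : E d →L[ℝ] ℂ) {m n : ℕ} (h : m < n) :
    linPow ℓ m ∈ polySpace d n := Submodule.subset_span ⟨ℓ, m, h, rfl⟩

theorem polySpace_mono : Monotone (polySpace d) := fun _ _ hab =>
  Submodule.span_mono fun _ ⟨ℓ, m, hm, hf⟩ => ⟨ℓ, m, hm.trans_le hab, hf⟩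

/-- Expanding ℓ(θ)^m in coordinates writes every power as a combination of finitely many monomials.
-/
theorem finiteDimensional_polySpace (n : ℕ) : FiniteDimensional ℂ (polySpace d n) := by
  let mono : (Σ m : Fin n, Fin m → Fin d) → C(S d, ℂ) := fun p =>
    ⟨fun θ => ∏ i, (((θ : E d) (p.2 i) : ℝ) : ℂ), by fun_prop⟩
  have hle : polySpace d n ≤ Submodule.span ℂ (range mono) := by
    refine Submodule.span_le.mpr ?_
    rintro _ ⟨ℓ, m, hm, rfl⟩
    have : linPow ℓ m = ∑ f : Fin m → Fin d,
        (∏ i, ℓ (EuclideanSpace.single (f i) 1)) • mono ⟨⟨m, hm⟩, f⟩ := by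
      ext θ
      have hθ : (θ : E d) = ∑ j, (θ : E d) j • EuclideanSpace.single j (1 : ℝ) := by
        have := (EuclideanSpace.basisFun (Fin d) ℝ).sum_repr (θ : E d)
        simpa using this.symm
      have hL : ℓ θ = ∑ j, ((θ : E d) j : ℂ) * ℓ (EuclideanSpace.single j 1) := by
        conv_lhs => rw [hθ]
        rw [map_sum]
        simp
      simp only [linPow, ContinuousMap.coe_mk, hL, ContinuousMap.coe_sum, Finset.sum_apply,
        ContinuousMap.coe_smul, Pi.smul_apply, smul_eq_mul, mono]
      rw [← Fin.prod_const, Finset.prod_univ_sum]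
      simp only [Fintype.piFinset_univ]
      refine Finset.sum_congr rfl fun f _ => ?_
      rw [Finset.prod_mul_distrib, mul_comm]
    rw [this]
    exact Submodule.sum_mem _ fun f _ => Submodule.smul_mem _ _ (Submodule.subset_span ⟨_, rfl⟩)
  have : FiniteDimensional ℂ (Submodule.span ℂ (range mono)) :=
    FiniteDimensional.span_of_finite ℂ (finite_range mono)
  exact Submodule.finiteDimensional_of_le hle

/-- The eigenvalue `n (n + d - 2)` of `-Δ` on the spherical harmonics of degree `n`. -/
def harmonicEigenvalue (d n : ℕ) : ℝ := n * (n + d - 2)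

/-- Triangularity with respect to the degree: modulo lower degree, the Laplacian acts as a scalar.
This is what becomes an eigenvalue equation on the orthogonal complement of the lower degrees. -/
theorem smooth_and_sphereLaplacian_of_mem_polySpace {n : ℕ} {f : C(S d, ℂ)}
    (hf : f ∈ polySpace d (n + 1)) : SmoothOnSphere f ∧ ∃ z ∈ polySpace d n, ∀ θ,
      sphereLaplacian f θ = z θ - harmonicEigenvalue d n * f θ := by
  induction hf using Submodule.span_induction with
  | mem f h =>
    obtain ⟨ℓ, m, hm, rfl⟩ := h
    refine ⟨smoothOnSphere_pow_linear ℓ m, ?_⟩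
    set c : ℂ := (m : ℂ) * (m - 1) * ∑ j, ℓ (EuclideanSpace.single j 1) ^ 2
    have h1 : c • linPow ℓ (m - 2) ∈ polySpace d n := by
      by_cases h2 : 2 ≤ m
      · exact Submodule.smul_mem _ _ (linPow_mem_polySpace ℓ (by omega))
      · have : c = 0 := by
          have : m = 0 ∨ m = 1 := by omega
          rcases this with rfl | rfl <;> simp [c]
        rw [this]
        convert Submodule.zero_mem _
        exact zero_smul ℂ (linPow ℓ (m - 2))
    rcases Nat.lt_succ_iff_lt_or_eq.mp hm with hlt | rfl
    -- A power of lower degree has the wrong scalar; the difference of the two eigenvalues is moved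
    -- into the remainder.
    · refine ⟨c • linPow ℓ (m - 2) +
        ((harmonicEigenvalue d n - harmonicEigenvalue d m : ℝ) : ℂ) • linPow ℓ m,
        Submodule.add_mem _ h1 (Submodule.smul_mem _ _ (linPow_mem_polySpace ℓ hlt)), fun θ => ?_⟩
      refine (sphereLaplacian_pow_linear ℓ m θ).trans ?_
      simp [linPow, harmonicEigenvalue, c]
      ring
    · refine ⟨c • linPow ℓ (m - 2), h1, fun θ => ?_⟩
      refine (sphereLaplacian_pow_linear ℓ m θ).trans ?_
      simp [linPow, harmonicEigenvalue, c]
  | zero =>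
    refine ⟨?_, 0, Submodule.zero_mem _, fun θ => ?_⟩
    · have := (smoothOnSphere_pow_linear (0 : E d →L[ℝ] ℂ) 1)
      simpa [Pi.zero_def] using this
    · have h0 := sphereLaplacian_const_smul 0 (smoothOnSphere_pow_linear (0 : E d →L[ℝ] ℂ) 1) θ
      simpa [Pi.zero_def] using h0
  | add f g _ _ hf hg =>
    obtain ⟨sf, zf, mf, ef⟩ := hf
    obtain ⟨sg, zg, mg, eg⟩ := hg
    refine ⟨sf.add sg, zf + zg, Submodule.add_mem _ mf mg, fun θ => ?_⟩
    refine (sphereLaplacian_add sf sg θ).trans ?_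
    rw [ef, eg]
    simp
    ring
  | smul c f _ hf =>
    obtain ⟨sf, zf, mf, ef⟩ := hf
    refine ⟨sf.const_smul c, c • zf, Submodule.smul_mem _ _ mf, fun θ => ?_⟩
    refine (sphereLaplacian_const_smul c sf θ).trans ?_
    rw [ef]
    simp
    ring

theorem linPow_one_pow (ℓ : E d →L[ℝ] ℂ) (m : ℕ) : linPow ℓ 1 ^ m = linPow ℓ m := by
  ext θ; simp [linPow]

theorem exp_apply_sphere (f : C(S d, ℂ)) (θ : S d) : NormedSpace.exp f θ = Complex.exp (f θ) := by
  have h := NormedSpace.exp_series_hasSum_exp' (𝕂 := ℂ) f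
  have h1 := h.map (ContinuousMap.evalCLM ℂ θ) (ContinuousMap.evalCLM ℂ θ).continuous
  have h2 := NormedSpace.exp_series_hasSum_exp' (𝕂 := ℂ) (f θ)
  rw [Complex.exp_eq_exp_ℂ]
  refine (h1.unique ?_)
  simpa [Function.comp_def] using h2

/-- Exponentials of linear forms are visibly closed under products, unlike the span of powers of
linear forms. Their power series puts them in the closure of the polynomials, so no polarization
identity is needed for Stone–Weierstrass. -/
theorem exp_linPow_mem (ℓ : E d →L[ℝ] ℂ) :
    NormedSpace.exp (linPow ℓ 1) ∈ (⨆ n, polySpace d n).topologicalClosure := by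
  have h := NormedSpace.exp_series_hasSum_exp' (𝕂 := ℂ) (linPow ℓ 1)
  refine isClosed_closure.mem_of_tendsto h (Eventually.of_forall fun s => ?_)
  refine subset_closure (Submodule.sum_mem _ fun m _ => Submodule.smul_mem _ _ ?_)
  rw [linPow_one_pow]
  exact Submodule.mem_iSup_of_mem (m + 1) (linPow_mem_polySpace ℓ m.lt_succ_self)

theorem exp_linPow_mul (ℓ₁ ℓ₂ : E d →L[ℝ] ℂ) :
    NormedSpace.exp (linPow ℓ₁ 1) * NormedSpace.exp (linPow ℓ₂ 1) =
      NormedSpace.exp (linPow (ℓ₁ + ℓ₂) 1) := by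
  ext θ
  simp [exp_apply_sphere, linPow, Complex.exp_add]

/-- The star subalgebra spanned by the exponentials of the linear forms. -/
def expSubalgebra (d : ℕ) : StarSubalgebra ℂ C(S d, ℂ) where
  toSubalgebra := Algebra.adjoin ℂ (range fun ℓ : E d →L[ℝ] ℂ => NormedSpace.exp (linPow ℓ 1))
  star_mem' := by
    change Algebra.adjoin ℂ (range fun ℓ : E d →L[ℝ] ℂ => NormedSpace.exp (linPow ℓ 1)) ≤
      star (Algebra.adjoin ℂ (range fun ℓ : E d →L[ℝ] ℂ => NormedSpace.exp (linPow ℓ 1)))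
    refine (Algebra.adjoin_le (R := ℂ) (A := C(S d, ℂ)) ?_)
    rintro _ ⟨ℓ, rfl⟩
    refine Algebra.subset_adjoin ⟨(Complex.conjCLE : ℂ →L[ℝ] ℂ).comp ℓ, ?_⟩
    ext θ
    simp [exp_apply_sphere, linPow, Complex.exp_conj]

/-- The exponentials form a multiplicative monoid, so the algebra they generate is merely their
linear span. -/
theorem expSubalgebra_le :
    Subalgebra.toSubmodule (expSubalgebra d).toSubalgebra ≤
      (⨆ n, polySpace d n).topologicalClosure := by
  have : Subalgebra.toSubmodule (expSubalgebra d).toSubalgebra =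
      Submodule.span ℂ (range fun ℓ : E d →L[ℝ] ℂ => NormedSpace.exp (linPow ℓ 1)) := by
    apply Algebra.adjoin_eq_span_of_subset
    refine Subset.trans ?_ Submodule.subset_span
    intro x hx
    induction hx using Submonoid.closure_induction with
    | mem x hx => exact hx
    | one => exact ⟨0, by ext θ; simp [exp_apply_sphere, linPow]⟩
    | mul x y _ _ hx hy =>
      obtain ⟨a, rfl⟩ := hx
      obtain ⟨b, rfl⟩ := hy
      exact ⟨a + b, (exp_linPow_mul a b).symm⟩
  rw [this, Submodule.span_le]
  rintro _ ⟨ℓ, rfl⟩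
  exact exp_linPow_mem ℓ

/-- The linear form `x ↦ x j`. -/
def coordForm (j : Fin d) : E d →L[ℝ] ℂ := Complex.ofRealCLM.comp (EuclideanSpace.proj j)

theorem coordForm_apply (j : Fin d) (x : E d) : coordForm j x = (x j : ℂ) := by
  simp [coordForm]

/-- Stone–Weierstrass for the exponentials: distinct points differ in a real coordinate, and the
real exponential is injective. -/
theorem dense_polySpace : (⨆ n, polySpace d n).topologicalClosure = ⊤ := by
  have hsep : (expSubalgebra d).SeparatesPoints := by
    intro θ η hne
    have : ∃ j, (θ : E d) j ≠ (η : E d) j := by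
      by_contra! h
      exact hne (Subtype.ext (PiLp.ext h))
    obtain ⟨j, hj⟩ := this
    refine ⟨_, ⟨NormedSpace.exp (linPow (coordForm j) 1), Algebra.subset_adjoin ⟨_, rfl⟩, rfl⟩, ?_⟩
    simp only [exp_apply_sphere, linPow, ContinuousMap.coe_mk, coordForm_apply, pow_one,
      ← Complex.ofReal_exp]
    intro h
    exact hj (Real.exp_injective (by exact_mod_cast h))
  have h := ContinuousMap.starSubalgebra_topologicalClosure_eq_top_of_separatesPoints _ hsep
  rw [eq_top_iff]
  intro f _
  have hf : f ∈ (expSubalgebra d).topologicalClosure := h ▸ StarSubalgebra.mem_top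
  have h2 : closure ((expSubalgebra d : StarSubalgebra ℂ C(S d, ℂ)) : Set C(S d, ℂ)) ⊆
      ((⨆ n, polySpace d n).topologicalClosure : Set C(S d, ℂ)) :=
    closure_minimal expSubalgebra_le isClosed_closure
  exact h2 hf

/-! ### Spherical harmonics as a Hilbert basis -/

section

variable {d : ℕ}

/-- The class in `L²(S^{d-1})` of a continuous function. -/
def toL2 (d : ℕ) : C(S d, ℂ) →L[ℂ] L2S d := ContinuousMap.toLp 2 (σ d) ℂ

theorem coeFn_toL2 (f : C(S d, ℂ)) : toL2 d f =ᵐ[σ d] f := ContinuousMap.coeFn_toLp (σ d) f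

theorem inner_toL2_left (f : C(S d, ℂ)) (u : L2S d) :
    inner ℂ (toL2 d f) u = ∫ θ, (starRingEnd ℂ) (f θ) * u θ ∂(σ d) := by
  rw [L2.inner_def]
  refine integral_congr_ae ?_
  filter_upwards [coeFn_toL2 f] with θ h
  rw [h, RCLike.inner_apply, mul_comm]

theorem inner_toL2_toL2 (f g : C(S d, ℂ)) :
    inner ℂ (toL2 d f) (toL2 d g) = ∫ θ, (starRingEnd ℂ) (f θ) * g θ ∂(σ d) := by
  rw [inner_toL2_left]
  refine integral_congr_ae ?_
  filter_upwards [coeFn_toL2 g] with θ h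
  rw [h]

instance : (σ d).IsOpenPosMeasure :=
  inferInstanceAs (volume : Measure (E d)).toSphere.IsOpenPosMeasure

theorem toL2_injective : Function.Injective (toL2 d) := ContinuousMap.toLp_injective (σ d)

/-- The image of `polySpace` in `L²`. -/
def polyL2 (d n : ℕ) : Submodule ℂ (L2S d) := (polySpace d n).map (toL2 d).toLinearMap

instance (n : ℕ) : FiniteDimensional ℂ (polyL2 d n) := by
  have := finiteDimensional_polySpace (d := d) n
  unfold polyL2
  infer_instance

theorem polyL2_mono : Monotone (polyL2 d) := fun _ _ h => Submodule.map_mono (polySpace_mono h)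

theorem dense_polyL2 : (⨆ n, polyL2 d n).topologicalClosure = ⊤ := by
  have h : DenseRange (toL2 d) := ContinuousMap.toLp_denseRange ℂ (σ d) ℂ (by norm_num)
  have := h.topologicalClosure_map_submodule (dense_polySpace (d := d))
  unfold polyL2
  rw [← Submodule.map_iSup]
  exact this

/-- The spherical harmonics of degree `n`, as a subspace of `L²`. -/
def harmonicSpace (d n : ℕ) : Submodule ℂ (L2S d) := polyL2 d (n + 1) ⊓ (polyL2 d n)ᗮ

instance (n : ℕ) : FiniteDimensional ℂ (harmonicSpace d n) :=
  Submodule.finiteDimensional_inf_left _ _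

theorem orthogonalFamily_harmonicSpace :
    OrthogonalFamily ℂ (fun n => harmonicSpace d n) fun n => (harmonicSpace d n).subtypeₗᵢ := by
  refine OrthogonalFamily.of_pairwise ?_
  have key : ∀ m n : ℕ, m < n → harmonicSpace d m ⟂ harmonicSpace d n := by
    intro m n hmn
    refine Submodule.IsOrtho.mono (U₁ := polyL2 d n) (V₁ := (polyL2 d n)ᗮ) ?_ inf_le_right ?_
    · exact inf_le_left.trans (polyL2_mono hmn)
    · exact Submodule.isOrtho_orthogonal_right _
  intro m n hmn
  rcases lt_or_gt_of_ne hmn with h | h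
  · exact key m n h
  · exact (key n m h).symm

theorem polyL2_le_iSup_harmonicSpace (n : ℕ) : polyL2 d n ≤ ⨆ m, harmonicSpace d m := by
  induction n with
  | zero =>
    have : polySpace d 0 = ⊥ := by
      rw [polySpace, Submodule.span_eq_bot]
      rintro _ ⟨_, _, h, _⟩
      omega
    rw [polyL2, this, Submodule.map_bot]
    exact bot_le
  | succ n ih =>
    rw [← Submodule.sup_orthogonal_inf_of_hasOrthogonalProjection
      (polyL2_mono (d := d) n.le_succ), inf_comm]
    exact sup_le ih (le_iSup (harmonicSpace d) n)

theorem iSup_harmonicSpace_orthogonal : (⨆ n, harmonicSpace d n)ᗮ = ⊥ := by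
  rw [← Submodule.topologicalClosure_eq_top_iff, eq_top_iff, ← dense_polyL2]
  exact Submodule.topologicalClosure_mono (iSup_le polyL2_le_iSup_harmonicSpace)

theorem exists_smooth_of_mem_polyL2 {n : ℕ} {y : L2S d} (hy : y ∈ polyL2 d (n + 1)) :
    ∃ (f g : C(S d, ℂ)), toL2 d f = y ∧ SmoothOnSphere f ∧ (∀ θ, sphereLaplacian f θ = g θ) ∧
      ∃ z : C(S d, ℂ), z ∈ polySpace d n ∧ g = z - (harmonicEigenvalue d n : ℂ) • f := by
  obtain ⟨f, hf, rfl⟩ := hy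
  obtain ⟨hs, z, hz, he⟩ := smooth_and_sphereLaplacian_of_mem_polySpace hf
  exact ⟨f, z - (harmonicEigenvalue d n : ℂ) • f, rfl, hs, fun θ => by simp [he], z, hz, rfl⟩

theorem inner_sphereLaplacian_symm (hd : 1 ≤ d) {f f' g g' : C(S d, ℂ)} (hf : SmoothOnSphere f)
    (hg : SmoothOnSphere g) (hf' : ∀ θ, sphereLaplacian f θ = f' θ)
    (hg' : ∀ θ, sphereLaplacian g θ = g' θ) :
    inner ℂ (toL2 d f) (toL2 d g') = inner ℂ (toL2 d f') (toL2 d g) := by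
  rw [inner_toL2_toL2, inner_toL2_toL2]
  simp_rw [← hg', ← hf']
  rw [integral_mul_sphereLaplacian_comm hd hf.conj hg]
  simp_rw [sphereLaplacian_conj]

/-- Write Δf = z - λf with z of lower degree. As f is orthogonal to lower degrees and Δz has lower
degree again, symmetry gives ‖z‖² = ⟨z, Δf⟩ = ⟨Δz, f⟩ = 0. -/
theorem exists_eigenfunction_of_mem_harmonicSpace (hd : 1 ≤ d) {n : ℕ} {y : L2S d}
    (hy : y ∈ harmonicSpace d n) : ∃ f : C(S d, ℂ), toL2 d f = y ∧ SmoothOnSphere f ∧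
      ∀ θ, sphereLaplacian f θ = -harmonicEigenvalue d n * f θ := by
  obtain ⟨f, g, rfl, hs, hg, z, hz, rfl⟩ := exists_smooth_of_mem_polyL2 hy.1
  refine ⟨f, rfl, hs, ?_⟩
  -- Viewed at level n + 1, the triangular formula applies to z with the same scalar, and both terms
  -- of Δz stay at level n.
  have hz' : toL2 d z ∈ polyL2 d (n + 1) := ⟨z, polySpace_mono n.le_succ hz, rfl⟩
  obtain ⟨f₂, g₂, e₂, hs₂, hg₂, z₂, hz₂, rfl⟩ := exists_smooth_of_mem_polyL2 hz'
  obtain rfl := toL2_injective e₂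
  have horth : ∀ w ∈ polySpace d n, inner ℂ (toL2 d w) (toL2 d f) = 0 := fun w hw =>
    (Submodule.mem_orthogonal _ _).mp hy.2 _ ⟨w, hw, rfl⟩
  have h1 := inner_sphereLaplacian_symm hd hs₂ hs hg₂ hg
  have h2 : inner ℂ (toL2 d (z₂ - (harmonicEigenvalue d n : ℂ) • f₂)) (toL2 d f) = 0 :=
    horth _ (Submodule.sub_mem _ hz₂ (Submodule.smul_mem _ _ hz))
  rw [h2, map_sub, map_smul, inner_sub_right, inner_smul_right, horth _ hz, mul_zero, sub_zero,
    inner_self_eq_zero] at h1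
  have h3 : f₂ = 0 := toL2_injective (h1.trans (map_zero _).symm)
  intro θ
  rw [hg, h3]
  simp

theorem sphere_exists_coord (hd : 2 ≤ d) (t : ℝ) :
    ∃ θ : S d, (θ : E d) ⟨0, by omega⟩ = Real.cos t := by
  let i : Fin d := ⟨0, by omega⟩
  let j : Fin d := ⟨1, by omega⟩
  have hij : i ≠ j := by simp [i, j]
  let x : E d := Real.cos t • EuclideanSpace.single i 1 + Real.sin t • EuclideanSpace.single j 1
  have hx : ‖x‖ = 1 := by
    have : ‖x‖ ^ 2 = 1 := by
      simp only [x]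
      rw [norm_add_sq_real, norm_smul, norm_smul, inner_smul_left, inner_smul_right,
        EuclideanSpace.inner_single_left]
      simp [hij]
    nlinarith [norm_nonneg x]
  refine ⟨⟨x, by simpa using hx⟩, ?_⟩
  simp [x, i, j]

/-- A coordinate takes infinitely many values on the sphere as d ≥ 2, so no nonzero polynomial in it
vanishes. This makes every Hilbert basis infinite, as indexing by ℕ requires. -/
theorem not_finiteDimensional_L2S (hd : 2 ≤ d) : ¬ FiniteDimensional ℂ (L2S d) := by
  intro hfin
  let c : C(S d, ℂ) := linPow (coordForm ⟨0, by omega⟩) 1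
  let L : Polynomial ℂ →ₗ[ℂ] L2S d := (toL2 d).toLinearMap ∘ₗ (Polynomial.aeval c).toLinearMap
  have hinj : Function.Injective L := by
    refine toL2_injective.comp ?_
    change Function.Injective (Polynomial.aeval c)
    rw [injective_iff_map_eq_zero]
    intro p hp
    refine Polynomial.eq_zero_of_infinite_isRoot p ?_
    have hsub : (fun t : ℝ => (Real.cos t : ℂ)) '' Icc 0 Real.pi ⊆ {x | p.IsRoot x} := by
      rintro _ ⟨t, _, rfl⟩
      obtain ⟨θ, hθ⟩ := sphere_exists_coord hd t
      have h1 := congrArg (fun f : C(S d, ℂ) => f θ) hp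
      have h2 : (Polynomial.aeval c p) θ = p.eval (c θ) := by
        have := Polynomial.aeval_algHom_apply (ContinuousMap.evalAlgHom ℂ ℂ θ) c p
        rw [Polynomial.coe_aeval_eq_eval] at this
        exact this.symm
      have h3 : c θ = (Real.cos t : ℂ) := by
        change coordForm _ (θ : E d) ^ 1 = _
        rw [pow_one, coordForm_apply, hθ]
      simp only [h2, h3] at h1
      simpa using h1
    refine Infinite.mono hsub (Infinite.image ?_ ?_)
    · intro s hs t ht hst
      exact Real.injOn_cos hs ht (Complex.ofReal_injective hst)
    · exact Icc_infinite Real.pi_pos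
  have : FiniteDimensional ℂ (Polynomial ℂ) := FiniteDimensional.of_injective L hinj
  exact Polynomial.not_finite this

theorem infinite_index_of_hilbertBasis (hd : 2 ≤ d) {J : Type*} (b : HilbertBasis J ℂ (L2S d)) :
    Infinite J := by
  by_contra h
  rw [not_infinite_iff_finite] at h
  have := Fintype.ofFinite J
  exact not_finiteDimensional_L2S hd b.toOrthonormalBasis.toBasis.finiteDimensional_of_finite

/-- A Hilbert basis of spherical harmonics. -/
structure HarmonicBasis (d : ℕ) where
  /-- the index set -/
  J : Type
  /-- the degree -/
  deg : J → ℕ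
  /-- the spherical harmonics -/
  Y : J → C(S d, ℂ)
  /-- the basis -/
  basis : HilbertBasis J ℂ (L2S d)
  basis_apply : ∀ j, basis j = toL2 d (Y j)
  smooth : ∀ j, SmoothOnSphere (Y j)
  laplacian : ∀ j θ, sphereLaplacian (Y j) θ = -harmonicEigenvalue d (deg j) * Y j θ
  finite : ∀ N, {j | deg j ≤ N}.Finite

theorem nonempty_harmonicBasis (hd : 1 ≤ d) : Nonempty (HarmonicBasis d) := by
  obtain ⟨b, hb⟩ := exists_hilbertBasis_of_orthogonalFamily (harmonicSpace d)
    orthogonalFamily_harmonicSpace iSup_harmonicSpace_orthogonal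
  choose f h1 h2 h3 using fun p => exists_eigenfunction_of_mem_harmonicSpace hd (hb p)
  refine ⟨⟨_, fun p => p.1, f, b, fun p => (h1 p).symm, h2, h3, fun N => ?_⟩⟩
  have : {j : Σ n, Fin (Module.finrank ℂ (harmonicSpace d n)) | j.1 ≤ N} =
      ⋃ n ∈ Iic N, range (fun k => (⟨n, k⟩ : Σ n, Fin (Module.finrank ℂ (harmonicSpace d n)))) := by
    ext ⟨n, k⟩
    simp only [mem_ofPred_eq, mem_iUnion, mem_range, mem_Iic]
    constructor
    · intro h; exact ⟨n, h, k, rfl⟩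
    · rintro ⟨m, hm, l, hl⟩
      obtain ⟨rfl, _⟩ := Sigma.mk.inj_iff.mp hl
      exact hm
  rw [this]
  exact (finite_Iic N).biUnion fun n _ => finite_range _

end

/-! ### Diagonal operators, compact resolvents and bounded perturbations -/

section Abstract

variable {H : Type*} [NormedAddCommGroup H] [InnerProductSpace ℂ H]

theorem hasSum_norm_inner_sq {J : Type*} (b : HilbertBasis J ℂ H) (x : H) :
    HasSum (fun j => ‖inner ℂ (b j) x‖ ^ 2) (‖x‖ ^ 2) := by
  have h := (b.hasSum_inner_mul_inner x x).mapL Complex.reCLM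
  have h1 : ∀ j, inner ℂ x (b j) * inner ℂ (b j) x = ((‖inner ℂ (b j) x‖ ^ 2 : ℝ) : ℂ) := by
    intro j
    rw [← inner_conj_symm x (b j), mul_comm, Complex.mul_conj, Complex.normSq_eq_norm_sq]
  simp_rw [h1] at h
  rw [inner_self_eq_norm_sq_to_K] at h
  simpa [← Complex.ofReal_pow] using h

/-- If `g` has the coefficients `lam j * ⟪b j, x⟫`, then `⟪x, g⟫ = ∑ lam j |⟪b j, x⟫|²`. -/
theorem hasSum_weighted_inner_sq {J : Type*} (b : HilbertBasis J ℂ H) {lam : J → ℝ} {x g : H}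
    (hg : ∀ j, inner ℂ (b j) g = lam j * inner ℂ (b j) x) :
    HasSum (fun j => lam j * ‖inner ℂ (b j) x‖ ^ 2) (inner ℂ x g).re := by
  have h := (b.hasSum_inner_mul_inner x g).mapL Complex.reCLM
  have h1 : ∀ j, inner ℂ x (b j) * inner ℂ (b j) g =
      ((lam j * ‖inner ℂ (b j) x‖ ^ 2 : ℝ) : ℂ) := by
    intro j
    rw [hg, ← inner_conj_symm x (b j), mul_left_comm, mul_comm ((starRingEnd ℂ) _),
      Complex.mul_conj, Complex.normSq_eq_norm_sq]
    push_cast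
    rfl
  simp_rw [h1] at h
  simpa only [Function.comp_def, Complex.reCLM_apply, Complex.ofReal_re] using h

theorem HilbertBasis.ext_inner {J : Type*} (b : HilbertBasis J ℂ H) {x y : H}
    (h : ∀ j, inner ℂ (b j) x = inner ℂ (b j) y) : x = y := by
  apply b.repr.injective
  ext j
  rw [b.repr_apply_apply, b.repr_apply_apply, h]

/-- The diagonal operator with bounded diagonal entries. -/
theorem exists_diagonal {J : Type*} (b : HilbertBasis J ℂ H) (c : J → ℝ) {C : ℝ}
    (hC : 0 ≤ C) (hc : ∀ j, |c j| ≤ C) :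
    ∃ R : H →L[ℂ] H, ‖R‖ ≤ C ∧ ∀ j x, inner ℂ (b j) (R x) = c j * inner ℂ (b j) x := by
  have hle : ∀ x j, ‖(c j : ℂ) * inner ℂ (b j) x‖ ^ 2 ≤ C ^ 2 * ‖inner ℂ (b j) x‖ ^ 2 := by
    intro x j
    rw [norm_mul, mul_pow, Complex.norm_real, Real.norm_eq_abs]
    gcongr
    exact hc j
  have hsum : ∀ x, Summable fun j => ‖(c j : ℂ) * inner ℂ (b j) x‖ ^ 2 := fun x =>
    Summable.of_nonneg_of_le (fun j => by positivity) (hle x)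
      ((hasSum_norm_inner_sq b x).summable.mul_left _)
  have hmem : ∀ x, Memℓp (fun j => (c j : ℂ) * inner ℂ (b j) x) 2 := fun x =>
    memℓp_gen (by simpa using hsum x)
  let R₀ : H → H := fun x => b.repr.symm ⟨fun j => (c j : ℂ) * inner ℂ (b j) x, hmem x⟩
  have hR₀ : ∀ j x, inner ℂ (b j) (R₀ x) = c j * inner ℂ (b j) x := by
    intro j x
    rw [← b.repr_apply_apply]
    simp [R₀]
  let R₁ : H →ₗ[ℂ] H :=
    { toFun := R₀
      map_add' := fun x y => HilbertBasis.ext_inner b fun j => by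
        simp only [hR₀, inner_add_right]; ring
      map_smul' := fun a x => HilbertBasis.ext_inner b fun j => by
        simp only [hR₀, inner_smul_right, RingHom.id_apply]; ring }
  have hb : ∀ x, ‖R₁ x‖ ≤ C * ‖x‖ := by
    intro x
    refine abs_le_of_sq_le_sq' ?_ (by positivity) |>.2
    rw [mul_pow]
    refine hasSum_le (fun j => ?_) (hasSum_norm_inner_sq b (R₁ x))
      ((hasSum_norm_inner_sq b x).mul_left (C ^ 2))
    rw [show inner ℂ (b j) (R₁ x) = c j * inner ℂ (b j) x from hR₀ j x]
    exact hle x j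
  exact ⟨R₁.mkContinuous C hb, R₁.mkContinuous_norm_le hC hb, fun j x => hR₀ j x⟩

theorem isCompactOperator_rankOne (v w : H) :
    IsCompactOperator ((innerSL ℂ v).smulRight w : H →L[ℂ] H) := by
  have h1 : IsCompactOperator (ContinuousLinearMap.toSpanSingleton ℂ w) :=
    isCompactOperator_of_locallyCompactSpace_rng _
  exact h1.comp_clm (innerSL ℂ v : H →L[ℂ] ℂ)

/-- Keeping only the entries with |c_j| ≥ 1/(n + 1) gives a finite-rank operator at norm distance at
most 1/(n + 1). -/
theorem isCompactOperator_diagonal [CompleteSpace H] {J : Type*} (b : HilbertBasis J ℂ H)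
    {c : J → ℝ} (hfin : ∀ ε > 0, {j | ε ≤ |c j|}.Finite) {R : H →L[ℂ] H}
    (hR : ∀ j x, inner ℂ (b j) (R x) = c j * inner ℂ (b j) x) : IsCompactOperator R := by
  classical
  have hpos : ∀ n : ℕ, (0 : ℝ) < 1 / ((n : ℝ) + 1) := fun n => by positivity
  let F : ℕ → H →L[ℂ] H := fun n =>
    ∑ j ∈ (hfin _ (hpos n)).toFinset, (c j : ℂ) • (innerSL ℂ (b j)).smulRight (b j)
  have hF : ∀ n, IsCompactOperator (F n) := fun n => by
    have : F n ∈ compactOperator (RingHom.id ℂ) H H := Submodule.sum_mem _ fun j _ =>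
      Submodule.smul_mem _ _ (isCompactOperator_rankOne (b j) (b j))
    exact this
  have hinner : ∀ n j x, inner ℂ (b j) (F n x) =
      if 1 / ((n : ℝ) + 1) ≤ |c j| then c j * inner ℂ (b j) x else 0 := by
    intro n j x
    simp only [F, sum_apply, inner_sum, smul_apply, ContinuousLinearMap.smulRight_apply,
      inner_smul_right, innerSL_apply_apply, orthonormal_iff_ite.mp b.orthonormal, mul_ite,
      mul_one, mul_zero, Finset.sum_ite_eq, Finite.mem_toFinset, mem_ofPred_eq]
  have hd : ∀ n, ‖F n - R‖ ≤ 1 / ((n : ℝ) + 1) := by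
    intro n
    refine ContinuousLinearMap.opNorm_le_bound _ (hpos n).le fun x => ?_
    refine abs_le_of_sq_le_sq' ?_ (by positivity) |>.2
    rw [mul_pow]
    refine hasSum_le (fun j => ?_) (hasSum_norm_inner_sq b ((F n - R) x))
      ((hasSum_norm_inner_sq b x).mul_left _)
    rw [sub_apply, inner_sub_right, hinner, hR]
    split_ifs with h
    · rw [sub_self, norm_zero, zero_pow two_ne_zero]
      positivity
    · rw [zero_sub, norm_neg, norm_mul, mul_pow, Complex.norm_real, Real.norm_eq_abs]
      rw [not_le] at h
      gcongr
  refine isCompactOperator_of_tendsto (l := atTop) (F := F) ?_ (Eventually.of_forall hF)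
  rw [tendsto_iff_norm_sub_tendsto_zero]
  exact squeeze_zero (fun n => norm_nonneg _) hd tendsto_one_div_add_atTop_nhds_zero_nat

/-- A real function on an infinite type with finite sublevel sets can be enumerated in
nondecreasing order. -/
theorem exists_monotone_enumeration {ι : Type*} [Infinite ι] (m : ι → ℝ)
    (hfin : ∀ N : ℝ, {i | m i ≤ N}.Finite) :
    ∃ e : ℕ ≃ ι, Monotone (m ∘ e) ∧ Tendsto (m ∘ e) atTop atTop := by
  have hcount : Countable ι := by
    rw [← countable_univ_iff]
    refine (countable_iUnion fun N : ℕ => (hfin N).countable).mono fun i _ => ?_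
    obtain ⟨N, hN⟩ := exists_nat_ge (m i)
    exact mem_iUnion.mpr ⟨N, hN⟩
  obtain ⟨enc, henc⟩ := exists_injective_nat ι
  -- Ties of `m` are broken by an arbitrary numbering, so that `r` is an injective key. Every key
  -- has finitely many predecessors, and their number is the rank.
  let r : ι → ℝ ×ₗ ℕ := fun i => toLex (m i, enc i)
  have hr : Function.Injective r := fun i j h => henc (by
    have := congrArg (fun p => (ofLex p).2) h
    simpa [r] using this)
  have hlow : ∀ i, {j | r j < r i}.Finite := fun i => (hfin (m i)).subset fun j hj => by
    rcases (Prod.Lex.toLex_lt_toLex).mp (show toLex (m j, enc j) < toLex (m i, enc i) from hj)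
      with h | h
    · exact h.le
    · exact h.1.le
  let rank : ι → ℕ := fun i => {j | r j < r i}.ncard
  have hmono : ∀ i j, r i < r j → rank i < rank j := fun i j hij =>
    Set.ncard_lt_ncard ⟨fun k hk => lt_trans hk hij, fun h => lt_irrefl (r i) (h hij)⟩ (hlow j)
  have hrank : Function.Injective rank := fun i j h => by
    rcases lt_trichotomy (r i) (r j) with h1 | h1 | h1
    · exact absurd h (hmono i j h1).ne
    · exact hr h1
    · exact absurd h (hmono j i h1).ne'
  have : Infinite (range rank) := (infinite_range_of_injective hrank).to_subtype
  classical
  -- The ranks form an infinite subset of ℕ, which is order isomorphic to ℕ.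
  let o : ℕ ≃o range rank := Nat.Subtype.orderIsoOfNat (range rank)
  let e : ℕ ≃ ι := o.toEquiv.trans (Equiv.ofInjective rank hrank).symm
  have he : ∀ n, rank (e n) = o n := fun n => by
    have := (Equiv.ofInjective rank hrank).apply_symm_apply (o n)
    exact congrArg Subtype.val this
  have hm : Monotone (m ∘ e) := by
    intro a c hac
    by_contra hlt
    rw [not_le] at hlt
    have h1 : r (e c) < r (e a) := Prod.Lex.toLex_lt_toLex.mpr (Or.inl hlt)
    have h2 := hmono _ _ h1
    rw [he, he] at h2
    exact absurd (o.monotone hac) (not_le.mpr h2)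
  refine ⟨e, hm, tendsto_atTop_atTop_of_monotone hm fun N => ?_⟩
  by_contra! h
  refine Set.infinite_univ (α := ι) ((hfin N).subset fun i _ => ?_)
  have := (h (e.symm i)).le
  simpa using this

/-- There are only finitely many orthonormal vectors of bounded energy. -/
theorem finite_of_bounded_energy {J P : Type*} (b : HilbertBasis J ℂ H) {lam : J → ℝ}
    (hlam : ∀ j, 0 ≤ lam j) (hfin : ∀ N : ℝ, {j | lam j ≤ N}.Finite) {v : P → H}
    (hv : Orthonormal ℂ v) {N : ℝ}
    (hN : ∀ p, ∃ g, (∀ j, inner ℂ (b j) g = lam j * inner ℂ (b j) (v p)) ∧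
      (inner ℂ (v p) g).re ≤ N) : Finite P := by
  -- The maximum with 1 only makes the threshold positive.
  set N' := max N 1
  have hN' : 0 < N' := lt_of_lt_of_le one_pos (le_max_right _ _)
  set F := (hfin (2 * N')).toFinset
  -- Chebyshev: a unit vector of energy at most N' has at most half of its mass in the modes with
  -- eigenvalue above 2N'.
  have key : ∀ p, (1 : ℝ) / 2 ≤ ∑ j ∈ F, ‖inner ℂ (b j) (v p)‖ ^ 2 := by
    intro p
    obtain ⟨g, hg, hgN⟩ := hN p
    have h1 := hasSum_norm_inner_sq b (v p)
    rw [hv.1 p] at h1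
    have h2 := (hasSum_weighted_inner_sq b hg).mul_left (1 / (2 * N'))
    have h3 := h2.sub h1
    have h4 := sum_le_hasSum F (fun j hj => ?_) h3
    · have h5 : 1 / (2 * N') * (inner ℂ (v p) g).re ≤ 1 / 2 := by
        rw [one_div_mul_eq_div, div_le_iff₀ (by positivity)]
        linarith [le_max_left N 1]
      have h6 : -∑ j ∈ F, ‖inner ℂ (b j) (v p)‖ ^ 2 ≤
          ∑ j ∈ F, (1 / (2 * N') * (lam j * ‖inner ℂ (b j) (v p)‖ ^ 2)
            - ‖inner ℂ (b j) (v p)‖ ^ 2) := by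
        rw [← Finset.sum_neg_distrib]
        refine Finset.sum_le_sum fun j _ => ?_
        have : 0 ≤ 1 / (2 * N') * (lam j * ‖inner ℂ (b j) (v p)‖ ^ 2) :=
          mul_nonneg (by positivity) (mul_nonneg (hlam j) (by positivity))
        linarith
      norm_num at h4 h5 h6 ⊢
      linarith
    · have hj' : 2 * N' < lam j := by
        by_contra h
        exact hj ((hfin _).mem_toFinset.mpr (not_lt.mp h))
      rw [← mul_assoc, ← sub_one_mul]
      refine mul_nonneg ?_ (by positivity)
      rw [sub_nonneg, one_div_mul_eq_div, le_div_iff₀ (by positivity)]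
      linarith
  by_contra hinf
  rw [not_finite_iff_infinite] at hinf
  obtain ⟨s, hs⟩ := Infinite.exists_subset_card_eq P (2 * F.card + 1)
  have h1 : (s.card : ℝ) * (1 / 2) ≤ ∑ p ∈ s, ∑ j ∈ F, ‖inner ℂ (b j) (v p)‖ ^ 2 := by
    rw [← nsmul_eq_mul]
    exact Finset.card_nsmul_le_sum _ _ _ fun p _ => key p
  rw [Finset.sum_comm] at h1
  -- Bessel: each mode in F receives total mass at most 1 from all the vectors, so there are at most
  -- 2|F| of them.
  have h2 : ∑ j ∈ F, ∑ p ∈ s, ‖inner ℂ (b j) (v p)‖ ^ 2 ≤ ∑ j ∈ F, (1 : ℝ) := by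
    refine Finset.sum_le_sum fun j _ => ?_
    have := hv.sum_inner_products_le (b j) (s := s)
    rw [b.orthonormal.1 j] at this
    simp_rw [norm_inner_symm (v _)] at this
    simpa using this
  rw [hs] at h1
  simp only [Finset.sum_const, nsmul_eq_mul, mul_one] at h2
  push_cast at h1
  linarith

/-- The resolvent of a nonnegative diagonal operator, perturbed by a symmetric bounded operator. -/
theorem exists_resolvent [CompleteSpace H] {J : Type*} (b : HilbertBasis J ℂ H) {lam : J → ℝ}
    (hlam : ∀ j, 0 ≤ lam j) (hfin : ∀ N : ℝ, {j | lam j ≤ N}.Finite) (A : H →L[ℂ] H)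
    (hsymm : ∀ x y, inner ℂ (A x) y = inner ℂ x (A y)) {M : ℝ} (hMA : ‖A‖ < M) :
    ∃ T : H →L[ℂ] H, IsCompactOperator T ∧ (T : H →ₗ[ℂ] H).IsSymmetric ∧
      (∀ u, T u = 0 → u = 0) ∧
      ∀ u j, ((lam j + M : ℝ) : ℂ) * inner ℂ (b j) (T u) + inner ℂ (b j) (A (T u)) =
        inner ℂ (b j) u := by
  have hM : 0 < M := (norm_nonneg A).trans_lt hMA
  obtain ⟨R, hRn, hR⟩ := exists_diagonal b (fun j => 1 / (lam j + M)) (C := 1 / M)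
    (by positivity) (fun j => by
      have := hlam j
      rw [abs_of_nonneg (by positivity)]
      gcongr
      linarith)
  have hne : ∀ j, ((lam j + M : ℝ) : ℂ) ≠ 0 := fun j => by
    have := hlam j
    exact_mod_cast (by positivity : lam j + M ≠ 0)
  have hR' : ∀ j x, ((lam j + M : ℝ) : ℂ) * inner ℂ (b j) (R x) = inner ℂ (b j) x := by
    intro j x
    rw [hR]
    push_cast
    have := hne j
    push_cast at this
    field_simp
  have hRinj : ∀ x, R x = 0 → x = 0 := fun x hx => HilbertBasis.ext_inner b fun j => by
    rw [← hR', hx]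
    simp
  have hRsymm : ∀ x y, inner ℂ (R x) y = inner ℂ x (R y) := by
    intro x y
    refine (b.hasSum_inner_mul_inner (R x) y).unique ?_
    convert b.hasSum_inner_mul_inner x (R y) using 2 with j
    rw [← inner_conj_symm (R x), hR, hR, map_mul, Complex.conj_ofReal, inner_conj_symm]
    ring
  have hRc : IsCompactOperator R := by
    refine isCompactOperator_diagonal b (fun ε hε => (hfin (1 / ε)).subset fun j hj => ?_) hR
    have h1 : ε ≤ 1 / (lam j + M) := by
      have := hlam j
      rwa [mem_ofPred_eq, abs_of_nonneg (by positivity)] at hj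
    have h2 : lam j + M ≤ 1 / ε := by
      have := hlam j
      rw [le_div_iff₀ (by positivity)] at h1
      rw [le_div_iff₀ hε]
      linarith
    exact (show lam j ≤ 1 / ε by linarith)
  -- Neumann series: since ‖A‖ < M and ‖R‖ ≤ 1/M, the operator 1 + AR has an inverse G, and the
  -- resolvent is RG.
  have hARn : ‖-(A * R)‖ < 1 := by
    rw [norm_neg]
    calc ‖A * R‖ ≤ ‖A‖ * ‖R‖ := norm_mul_le _ _
      _ ≤ ‖A‖ * (1 / M) := by gcongr
      _ < 1 := by rw [mul_one_div, div_lt_one hM]; exact hMA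
  set U := Units.oneSub (-(A * R)) hARn
  set G : H →L[ℂ] H := ((U⁻¹ : (H →L[ℂ] H)ˣ) : H →L[ℂ] H)
  have hG : ∀ u, G u + A (R (G u)) = u := by
    intro u
    have := congrArg (fun T : H →L[ℂ] H => T u) U.mul_inv
    simpa [U, G] using this
  set T : H →L[ℂ] H := R.comp G
  have hTc : IsCompactOperator T := hRc.comp_clm G
  have hTsymm : (T : H →ₗ[ℂ] H).IsSymmetric := by
    intro u w
    change inner ℂ (R (G u)) w = inner ℂ u (R (G w))
    -- After w = Gw + ARGw and u = Gu + ARGu, the two sides agree by the symmetry of R and A.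
    conv_lhs => rw [← hG w]
    conv_rhs => rw [← hG u]
    rw [inner_add_left, inner_add_right, hRsymm, hsymm]
  have hTinj : ∀ u, T u = 0 → u = 0 := by
    intro u hu
    have h1 : G u = 0 := hRinj _ hu
    have h2 := hG u
    rw [h1] at h2
    simpa using h2.symm
  have hTeq : ∀ u j, ((lam j + M : ℝ) : ℂ) * inner ℂ (b j) (T u) + inner ℂ (b j) (A (T u)) =
      inner ℂ (b j) u := by
    intro u j
    conv_rhs => rw [← hG u]
    rw [inner_add_right]
    congr 1
    exact hR' j (G u)
  exact ⟨T, hTc, hTsymm, hTinj, hTeq⟩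

/-- Spectral theorem for compact symmetric operators. Injectivity excludes the eigenvalue 0, the
only one whose eigenspace could be infinite-dimensional. -/
theorem exists_hilbertBasis_eigenvectors [CompleteSpace H] {T : H →L[ℂ] H}
    (hTc : IsCompactOperator T) (hTsymm : (T : H →ₗ[ℂ] H).IsSymmetric)
    (hTinj : ∀ u, T u = 0 → u = 0) :
    ∃ (P : Type) (v : HilbertBasis P ℂ H) (t : P → ℝ), ∀ p, t p ≠ 0 ∧ T (v p) = (t p : ℂ) • v p := by
  have hfd : ∀ t : ℂ, FiniteDimensional ℂ (Module.End.eigenspace (T : H →ₗ[ℂ] H) t) := by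
    intro t
    by_cases ht : t = 0
    · have : Module.End.eigenspace (T : H →ₗ[ℂ] H) t = ⊥ := by
        rw [eq_bot_iff]
        intro x hx
        rw [Module.End.mem_eigenspace_iff, ht, zero_smul] at hx
        exact hTinj x hx
      rw [this]
      infer_instance
    · exact ContinuousLinearMap.finite_dimensional_eigenspace hTc t ht
  obtain ⟨v, hv⟩ := exists_hilbertBasis_of_orthogonalFamily
    (fun t : ℂ => Module.End.eigenspace (T : H →ₗ[ℂ] H) t) hTsymm.orthogonalFamily_eigenspaces
    (ContinuousLinearMap.orthogonalComplement_iSup_eigenspaces_eq_bot hTc hTsymm)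
  refine ⟨_, v, fun p => p.1.re, fun p => ?_⟩
  have hTv : T (v p) = p.1 • v p := Module.End.mem_eigenspace_iff.mp (hv p)
  have hv0 : v p ≠ 0 := v.orthonormal.ne_zero p
  have ht0 : p.1 ≠ 0 := by
    intro hp
    rw [hp, zero_smul] at hTv
    exact hv0 (hTinj _ hTv)
  have hev : Module.End.HasEigenvalue (T : H →ₗ[ℂ] H) p.1 :=
    Module.End.hasEigenvalue_of_hasEigenvector ⟨hv p, hv0⟩
  have htre : ((p.1.re : ℝ) : ℂ) = p.1 :=
    Complex.conj_eq_iff_re.mp (hTsymm.conj_eigenvalue_eq_self hev)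
  refine ⟨fun h => ht0 ?_, ?_⟩
  · rw [← htre]
    exact_mod_cast h
  · rw [htre, hTv]

/-- A nonnegative diagonal operator with compact resolvent, perturbed by a nonnegative bounded
operator, is diagonalized by a Hilbert basis. -/
theorem exists_eigenbasis [CompleteSpace H] {J : Type*} (b : HilbertBasis J ℂ H) {lam : J → ℝ}
    (hlam : ∀ j, 0 ≤ lam j) (hfin : ∀ N : ℝ, {j | lam j ≤ N}.Finite)
    (hinf : ∀ (P : Type) (_ : HilbertBasis P ℂ H), Infinite P) (A : H →L[ℂ] H)
    (hsymm : ∀ x y, inner ℂ (A x) y = inner ℂ x (A y)) (hpos : ∀ x, 0 ≤ (inner ℂ x (A x)).re) :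
    ∃ (μ : ℕ → ℝ) (e : HilbertBasis ℕ ℂ H), Monotone μ ∧ Tendsto μ atTop atTop ∧
      ∀ k j, lam j * inner ℂ (b j) (e k) + inner ℂ (b j) (A (e k)) =
        μ k * inner ℂ (b j) (e k) := by
  set M : ℝ := ‖A‖ + 1
  obtain ⟨T, hTc, hTsymm, hTinj, hTeq⟩ := exists_resolvent b hlam hfin A hsymm (M := M) (by simp [M])
  obtain ⟨P, v, t, ht⟩ := exists_hilbertBasis_eigenvectors hTc hTsymm hTinj
  -- An eigenvalue t of the inverse of the operator shifted by M corresponds to 1/t - M.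
  let m : P → ℝ := fun p => 1 / t p - M
  have hm : ∀ p j, lam j * inner ℂ (b j) (v p) + inner ℂ (b j) (A (v p)) =
      m p * inner ℂ (b j) (v p) := by
    intro p j
    have h1 := hTeq (v p) j
    rw [(ht p).2, map_smul, inner_smul_right, inner_smul_right] at h1
    have h2 : ((m p : ℝ) : ℂ) = 1 / t p - M := by
      simp only [m]
      push_cast
      rfl
    have h3 : (t p : ℂ) ≠ 0 := by exact_mod_cast (ht p).1
    rw [h2]
    push_cast at h1
    field_simp
    linear_combination h1
  have hg : ∀ p j, inner ℂ (b j) ((m p : ℂ) • v p - A (v p)) = lam j * inner ℂ (b j) (v p) := by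
    intro p j
    rw [inner_sub_right, inner_smul_right, ← hm]
    ring
  -- Dropping ⟨v, Av⟩ ≥ 0 bounds the unperturbed energy of v by its eigenvalue, so sublevel sets of
  -- eigenvalues are finite.
  have hgN : ∀ p, (inner ℂ (v p) ((m p : ℂ) • v p - A (v p))).re ≤ m p := by
    intro p
    rw [inner_sub_right, inner_smul_right, inner_self_eq_norm_sq_to_K, v.orthonormal.1 p]
    have := hpos (v p)
    simpa using this
  have hmfin : ∀ N : ℝ, {p | m p ≤ N}.Finite := by
    intro N
    have := finite_of_bounded_energy b hlam hfin
      (v.orthonormal.comp (Subtype.val : {p | m p ≤ N} → P) Subtype.val_injective) (N := N)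
      (fun p => ⟨_, hg p, (hgN p).trans p.2⟩)
    exact Set.toFinite _
  have := hinf P v
  obtain ⟨e, he1, he2⟩ := exists_monotone_enumeration m hmfin
  have hon : Orthonormal ℂ (v ∘ e) := v.orthonormal.comp e e.injective
  have hsp : (⊤ : Submodule ℂ H) ≤ (Submodule.span ℂ (range (v ∘ e))).topologicalClosure := by
    rw [range_comp, e.range_eq_univ, image_univ, v.dense_span]
  refine ⟨m ∘ e, HilbertBasis.mk hon hsp, he1, he2, fun k j => ?_⟩
  rw [HilbertBasis.coe_mk]
  exact hm (e k) j

end Abstract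

/-! ### The angular operator and its eigenvalues -/

section

variable {d : ℕ}

theorem harmonicEigenvalue_nonneg (hd : 2 ≤ d) (n : ℕ) : 0 ≤ harmonicEigenvalue d n := by
  have h1 : (2 : ℝ) ≤ d := by exact_mod_cast hd
  have h2 : (0 : ℝ) ≤ n := by positivity
  exact mul_nonneg h2 (by linarith)

theorem le_harmonicEigenvalue (hd : 2 ≤ d) (n : ℕ) : (n : ℝ) ≤ harmonicEigenvalue d n := by
  have h1 : (2 : ℝ) ≤ d := by exact_mod_cast hd
  rcases Nat.eq_zero_or_pos n with rfl | hn
  · simp [harmonicEigenvalue]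
  · have h2 : (1 : ℝ) ≤ n := by exact_mod_cast hn
    have h3 : (n : ℝ) * 1 ≤ n * (n + d - 2) := by gcongr; linarith
    simpa [harmonicEigenvalue] using h3

/-- A smooth function and its spherical Laplacian, as continuous maps. -/
theorem SmoothOnSphere.exists_continuousMap {φ : S d → ℂ} (h : SmoothOnSphere φ) :
    ∃ f g : C(S d, ℂ), (∀ θ, f θ = φ θ) ∧ ∀ θ, g θ = sphereLaplacian φ θ :=
  ⟨⟨φ, h.continuous⟩, ⟨_, h.continuous_sphereLaplacian⟩, fun _ => rfl, fun _ => rfl⟩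

/-- The conjugate of a harmonic is an admissible test function. With the converse below, this
identifies the distributional Laplacian with a diagonal operator. -/
theorem HarmonicBasis.inner_of_hasSphereLaplacian (B : HarmonicBasis d) {u f : L2S d}
    (h : HasSphereLaplacian u f) (j : B.J) :
    inner ℂ (B.basis j) f = -harmonicEigenvalue d (B.deg j) * inner ℂ (B.basis j) u := by
  have h1 := h _ (B.smooth j).conj
  simp_rw [sphereLaplacian_conj, B.laplacian] at h1
  rw [B.basis_apply, inner_toL2_left, inner_toL2_left, ← integral_const_mul]
  simp_rw [mul_comm ((starRingEnd ℂ) _) (f _)]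
  rw [← h1]
  refine integral_congr_ae (Eventually.of_forall fun θ => ?_)
  simp
  ring

/-- Both pairings with a test function are expanded by Parseval in the harmonics; symmetry on smooth
functions matches them term by term. -/
theorem HarmonicBasis.hasSphereLaplacian_of_inner (B : HarmonicBasis d) (hd : 1 ≤ d) {u f : L2S d}
    (h : ∀ j, inner ℂ (B.basis j) f = -harmonicEigenvalue d (B.deg j) * inner ℂ (B.basis j) u) :
    HasSphereLaplacian u f := by
  intro φ hφ
  obtain ⟨p, q, hp, hq⟩ := hφ.conj.exists_continuousMap
  have e1 : ∫ θ, u θ * sphereLaplacian φ θ ∂(σ d) = inner ℂ (toL2 d q) u := by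
    rw [inner_toL2_left]
    simp_rw [hq, sphereLaplacian_conj, Complex.conj_conj, mul_comm]
  have e2 : ∫ θ, f θ * φ θ ∂(σ d) = inner ℂ (toL2 d p) f := by
    rw [inner_toL2_left]
    simp_rw [hp, Complex.conj_conj, mul_comm]
  have hps : SmoothOnSphere p := by
    have : (p : S d → ℂ) = _ := funext hp
    rw [this]
    exact hφ.conj
  have hpq : ∀ θ, sphereLaplacian p θ = q θ := by
    intro θ
    have : (p : S d → ℂ) = _ := funext hp
    rw [this, hq]
  rw [e1, e2]
  refine (B.basis.hasSum_inner_mul_inner (toL2 d q) u).unique ?_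
  convert B.basis.hasSum_inner_mul_inner (toL2 d p) f using 2 with j
  have h3 := inner_sphereLaplacian_symm hd hps (B.smooth j) hpq
    (g' := (-(harmonicEigenvalue d (B.deg j) : ℂ)) • B.Y j) (fun θ => by simp [B.laplacian])
  rw [h, B.basis_apply, ← h3, map_smul, inner_smul_right]
  ring

theorem exists_ae_norm_le {a : S d → ℝ} (ha : MemLp a ∞ (σ d)) :
    ∃ M : ℝ, 0 ≤ M ∧ ∀ᵐ θ ∂(σ d), ‖a θ‖ ≤ M := by
  refine ⟨(eLpNormEssSup a (σ d)).toReal, ENNReal.toReal_nonneg, ?_⟩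
  have hfin : eLpNormEssSup a (σ d) ≠ (∞ : ℝ≥0∞) := by
    have := ha.2.ne
    rwa [eLpNorm_exponent_top] at this
  filter_upwards [ae_le_eLpNormEssSup (f := a) (μ := σ d)] with θ hθ
  rw [← ENNReal.ofReal_le_iff_le_toReal hfin, ofReal_norm]
  exact hθ

/-- Multiplication by a bounded function, as an operator in `L²`. -/
theorem exists_mulOp {a : S d → ℝ} (ha : MemLp a ∞ (σ d)) :
    ∃ A : L2S d →L[ℂ] L2S d, ∀ u, A u =ᵐ[σ d] fun θ => (a θ : ℂ) * u θ := by
  obtain ⟨M, hM0, hM⟩ := exists_ae_norm_le ha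
  have hac : AEStronglyMeasurable (fun θ => (a θ : ℂ)) (σ d) :=
    Complex.continuous_ofReal.comp_aestronglyMeasurable ha.1
  have hbd : ∀ u : L2S d, ∀ᵐ θ ∂(σ d), ‖(a θ : ℂ) * u θ‖ ≤ M * ‖u θ‖ := by
    intro u
    filter_upwards [hM] with θ hθ
    rw [norm_mul, Complex.norm_real]
    gcongr
  have hmem : ∀ u : L2S d, MemLp (fun θ => (a θ : ℂ) * u θ) 2 (σ d) := fun u =>
    (Lp.memLp u).of_le_mul (hac.mul (Lp.aestronglyMeasurable u)) (hbd u)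
  let A₀ : L2S d →ₗ[ℂ] L2S d :=
    { toFun := fun u => (hmem u).toLp _
      map_add' := fun u v => by
        rw [← MemLp.toLp_add]
        apply MemLp.toLp_congr
        filter_upwards [Lp.coeFn_add u v] with θ h
        change (a θ : ℂ) * (u + v : L2S d) θ = _
        rw [h, Pi.add_apply, mul_add]
        rfl
      map_smul' := fun c u => by
        rw [RingHom.id_apply, ← MemLp.toLp_const_smul]
        apply MemLp.toLp_congr
        filter_upwards [Lp.coeFn_smul c u] with θ h
        simp [h]
        ring }
  refine ⟨A₀.mkContinuous M fun u => ?_, fun u => (hmem u).coeFn_toLp⟩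
  refine Lp.norm_le_mul_norm_of_ae_le_mul ?_
  filter_upwards [hbd u, (hmem u).coeFn_toLp] with θ h1 h2
  change ‖((hmem u).toLp _ : L2S d) θ‖ ≤ _
  rw [h2]
  exact h1

theorem inner_mulOp {a : S d → ℝ} {A : L2S d →L[ℂ] L2S d}
    (hA : ∀ u, A u =ᵐ[σ d] fun θ => (a θ : ℂ) * u θ) (u v : L2S d) :
    inner ℂ (A u) v = inner ℂ u (A v) := by
  rw [L2.inner_def, L2.inner_def]
  refine integral_congr_ae ?_
  filter_upwards [hA u, hA v] with θ h1 h2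
  rw [h1, h2]
  simp
  ring

theorem le_re_inner_mulOp {a : S d → ℝ} {A : L2S d →L[ℂ] L2S d}
    (hA : ∀ u, A u =ᵐ[σ d] fun θ => (a θ : ℂ) * u θ) {c : ℝ} (hc : ∀ᵐ θ ∂(σ d), c ≤ a θ)
    (u : L2S d) : c * ‖u‖ ^ 2 ≤ (inner ℂ u (A u)).re := by
  have h1 : c * ‖u‖ ^ 2 = (inner ℂ u ((c : ℂ) • u)).re := by
    rw [inner_smul_right, inner_self_eq_norm_sq_to_K, Complex.re_ofReal_mul]
    norm_cast
  rw [h1, L2.inner_def, L2.inner_def]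
  have i1 := L2.integrable_inner (𝕜 := ℂ) u ((c : ℂ) • u)
  have i2 := L2.integrable_inner (𝕜 := ℂ) u (A u)
  rw [← RCLike.re_eq_complex_re, ← integral_re i1, ← integral_re i2]
  refine integral_mono_ae i1.re i2.re ?_
  filter_upwards [hA u, Lp.coeFn_smul (c : ℂ) u, hc] with θ h1 h2 h3
  rw [h1, h2]
  have key : ∀ r : ℝ, RCLike.re (inner ℂ (u θ) ((r : ℂ) * u θ)) = r * ‖u θ‖ ^ 2 := by
    intro r
    rw [RCLike.inner_apply, mul_assoc, Complex.mul_conj, Complex.normSq_eq_norm_sq,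
      ← Complex.ofReal_mul, RCLike.re_eq_complex_re, Complex.ofReal_re]
  change RCLike.re (inner ℂ (u θ) ((c : ℂ) * u θ)) ≤ _
  rw [key, key]
  gcongr

theorem exists_angularEigenvalueSeq (hd : 2 ≤ d) {a : S d → ℝ} (ha : MemLp a ∞ (σ d))
    (ha0 : ∀ᵐ θ ∂(σ d), 0 ≤ a θ) : ∃ μ : ℕ → ℝ, IsAngularEigenvalueSeq a μ := by
  obtain ⟨B⟩ := nonempty_harmonicBasis (d := d) (by omega)
  obtain ⟨A, hA⟩ := exists_mulOp ha
  obtain ⟨μ, e, hm, ht, he⟩ := exists_eigenbasis B.basis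
    (lam := fun j => harmonicEigenvalue d (B.deg j))
    (fun j => harmonicEigenvalue_nonneg hd _)
    (fun N => (B.finite ⌈N⌉₊).subset fun j hj => by
      have : (B.deg j : ℝ) ≤ N := (le_harmonicEigenvalue hd _).trans hj
      exact_mod_cast this.trans (Nat.le_ceil N))
    (fun P b => infinite_index_of_hilbertBasis hd b) A (inner_mulOp hA)
    (fun u => by simpa using le_re_inner_mulOp hA ha0 u)
  refine ⟨μ, hm, ht, e, fun k => ⟨e.orthonormal.ne_zero k, A (e k) - (μ k : ℂ) • e k, ?_, ?_⟩⟩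
  · refine B.hasSphereLaplacian_of_inner (by omega) fun j => ?_
    rw [inner_sub_right, inner_smul_right, ← he]
    ring
  · filter_upwards [Lp.coeFn_sub (A (e k)) ((μ k : ℂ) • e k), hA (e k),
      Lp.coeFn_smul (μ k : ℂ) (e k)] with θ h1 h2 h3
    rw [h1, Pi.sub_apply, h2, h3]
    simp

/-- μ‖u‖² = ⟨u, -Δu⟩ + ⟨u, au⟩. The first term is a sum of nonnegative multiples of squared harmonic
coefficients, the second is at least c‖u‖². -/
theorem le_of_isAngularEigenfunction (hd : 2 ≤ d) {a : S d → ℝ} (ha : MemLp a ∞ (σ d)) {c : ℝ}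
    (hc : ∀ᵐ θ ∂(σ d), c ≤ a θ) {μ : ℝ} {u : L2S d} (h : IsAngularEigenfunction a μ u) :
    c ≤ μ := by
  obtain ⟨B⟩ := nonempty_harmonicBasis (d := d) (by omega)
  obtain ⟨A, hA⟩ := exists_mulOp ha
  obtain ⟨hu, f, hf, hae⟩ := h
  have h1 : (μ : ℂ) • u = A u - f := by
    apply Lp.ext
    filter_upwards [hae, hA u, Lp.coeFn_smul (μ : ℂ) u, Lp.coeFn_sub (A u) f] with θ a1 a2 a3 a4
    rw [a3, a4, Pi.smul_apply, Pi.sub_apply, a2, smul_eq_mul, ← a1]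
    ring
  have h2 : 0 ≤ (inner ℂ u (-f)).re := by
    refine (hasSum_weighted_inner_sq B.basis (lam := fun j => harmonicEigenvalue d (B.deg j))
      (fun j => ?_)).nonneg fun j => mul_nonneg (harmonicEigenvalue_nonneg hd _) (by positivity)
    rw [inner_neg_right, B.inner_of_hasSphereLaplacian hf]
    ring
  have h3 := le_re_inner_mulOp hA hc u
  have h4 : (inner ℂ u ((μ : ℂ) • u)).re = μ * ‖u‖ ^ 2 := by
    rw [inner_smul_right, inner_self_eq_norm_sq_to_K, Complex.re_ofReal_mul]
    norm_cast
  rw [h1, inner_sub_right, Complex.sub_re] at h4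
  rw [inner_neg_right, Complex.neg_re] at h2
  have h5 : 0 < ‖u‖ ^ 2 := by positivity
  refine le_of_mul_le_mul_right ?_ h5
  linarith

theorem essInf_le_of_isAngularEigenfunction (hd : 2 ≤ d) {a : S d → ℝ} (ha : MemLp a ∞ (σ d))
    (ha0 : ∀ᵐ θ ∂(σ d), 0 ≤ a θ) {μ : ℝ} {u : L2S d} (h : IsAngularEigenfunction a μ u) :
    essInf a (σ d) ≤ μ := by
  refine le_of_isAngularEigenfunction hd ha (ae_essInf_le ?_) h
  exact isBoundedUnder_of_eventually_ge ha0

/-! ### Attainment of the minima -/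

/-- Beyond some index the values exceed a given one, so only finitely many compete for the minimum.
-/
theorem exists_isLeast_range_of_tendsto {f : ℕ → ℝ} (h : Tendsto f atTop atTop) {s : Set ℕ}
    (hs : s.Nonempty) : IsLeast (f '' s) (sInf (f '' s)) := by
  obtain ⟨k₀, hk₀⟩ := hs
  obtain ⟨N, hN⟩ := eventually_atTop.mp (h.eventually_ge_atTop (f k₀))
  have hfin : ((Finset.range N : Set ℕ) ∩ s ∪ {k₀}).Finite :=
    ((Finset.finite_toSet _).inter_of_left s).union (finite_singleton k₀)
  obtain ⟨k, hk, hmin⟩ := hfin.exists_minimalFor f _ ⟨k₀, Or.inr rfl⟩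
  have hks : k ∈ s := by
    rcases hk with hk | hk
    · exact hk.2
    · rw [hk]; exact hk₀
  have hle : ∀ m ∈ (Finset.range N : Set ℕ) ∩ s ∪ {k₀}, f k ≤ f m := fun m hm => by
    rcases le_total (f k) (f m) with h1 | h1
    · exact h1
    · exact hmin hm h1
  have hleast : IsLeast (f '' s) (f k) := by
    refine ⟨mem_image_of_mem f hks, ?_⟩
    rintro _ ⟨m, hm, rfl⟩
    by_cases hmN : m < N
    · exact hle m (Or.inl ⟨by simpa using hmN, hm⟩)
    · exact (hle k₀ (Or.inr rfl)).trans (hN m (not_lt.mp hmN))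
  rwa [hleast.csInf_eq]

/-- The numerator is quadratic and the denominator linear in the eigenvalue; an explicit bound of
slope 1/4 from below suffices. -/
theorem tendsto_quotient (d : ℕ) (α : ℝ) : Tendsto (quotient d α) atTop atTop := by
  set δ : ℝ := d - α - 4
  set p : ℝ := (d + α) * δ
  have h1 : Tendsto (fun l : ℝ => l / 4 + (-|2 * p| - δ ^ 2)) atTop atTop :=
    tendsto_atTop_add_const_right _ _ (tendsto_id.atTop_div_const (by norm_num))
  refine tendsto_atTop_mono' _ ?_ h1
  filter_upwards [eventually_ge_atTop (1 : ℝ)] with l hl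
  have hB : 0 < 4 * (4 * l + δ ^ 2) := by positivity
  change _ ≤ (4 * l + p) ^ 2 / (4 * (4 * l + δ ^ 2))
  rw [le_div_iff₀ hB]
  have h2 : -|2 * p| ≤ 2 * p := neg_abs_le _
  have h3 : 0 ≤ |2 * p| := abs_nonneg _
  nlinarith [sq_nonneg δ, sq_nonneg p, mul_nonneg h3 (sq_nonneg δ), mul_nonneg (sq_nonneg δ) (sq_nonneg δ),
    mul_nonneg (show (0 : ℝ) ≤ l by linarith) (sq_nonneg δ), mul_nonneg (show (0 : ℝ) ≤ l by linarith) h3,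
    mul_nonneg (show (0 : ℝ) ≤ l by linarith) (show 0 ≤ 2 * p + |2 * p| by linarith)]

theorem isLeast_quotient {d : ℕ} {α : ℝ} {μ : ℕ → ℝ} (hμ : Tendsto μ atTop atTop)
    (hδ : (d : ℝ) - α - 4 ≠ 0) :
    IsLeast (range fun k => quotient d α (μ k)) (hrConst d α μ) := by
  rw [hrConst, if_pos hδ, ← image_univ]
  exact exists_isLeast_range_of_tendsto ((tendsto_quotient d α).comp hμ) univ_nonempty

theorem isLeast_nonzero {μ : ℕ → ℝ} (hμ : Tendsto μ atTop atTop) :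
    IsLeast (range μ \ {0}) (sInf (range μ \ {0})) := by
  have : range μ \ {0} = μ '' {k | μ k ≠ 0} := by
    ext x
    constructor
    · rintro ⟨⟨k, rfl⟩, hk⟩
      exact ⟨k, hk, rfl⟩
    · rintro ⟨k, hk, rfl⟩
      exact ⟨⟨k, rfl⟩, hk⟩
  rw [this]
  refine exists_isLeast_range_of_tendsto hμ ?_
  obtain ⟨k, hk⟩ := (hμ.eventually_gt_atTop 0).exists
  exact ⟨k, hk.ne'⟩

end

/-! ### The one-dimensional inequality -/

section OneDimensional

/-- Tonelli in `ℝ≥0∞`: nonnegativity of the modes justifies exchanging sum and integral, after which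
the comparison is termwise. -/
theorem integral_le_integral_of_hasSum {f g : ℝ → ℝ} {F G : ℕ → ℝ → ℝ}
    (hf : Integrable f) (hg : Integrable g) (hF0 : ∀ k t, 0 ≤ F k t) (hG0 : ∀ k t, 0 ≤ G k t)
    (hF : ∀ k, Integrable (F k)) (hG : ∀ k, Integrable (G k))
    (hFf : ∀ t, HasSum (fun k => F k t) (f t)) (hGg : ∀ t, HasSum (fun k => G k t) (g t))
    (h : ∀ k, ∫ t, F k t ≤ ∫ t, G k t) : ∫ t, f t ≤ ∫ t, g t := by
  have key : ∀ {f : ℝ → ℝ} {F : ℕ → ℝ → ℝ}, Integrable f → (∀ k t, 0 ≤ F k t) →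
      (∀ k, Integrable (F k)) → (∀ t, HasSum (fun k => F k t) (f t)) →
      ENNReal.ofReal (∫ t, f t) = ∑' k, ENNReal.ofReal (∫ t, F k t) := by
    intro f F hf hF0 hF hFf
    rw [ofReal_integral_eq_lintegral_ofReal hf
      (Eventually.of_forall fun t => (hFf t).nonneg fun k => hF0 k t)]
    simp_rw [fun k => ofReal_integral_eq_lintegral_ofReal (hF k) (Eventually.of_forall (hF0 k))]
    rw [← lintegral_tsum fun k => (hF k).1.aemeasurable.ennreal_ofReal]
    refine lintegral_congr fun t => ?_
    rw [← (hFf t).tsum_eq, ENNReal.ofReal_tsum_of_nonneg (fun k => hF0 k t) (hFf t).summable]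
  have h2 : 0 ≤ ∫ t, g t := integral_nonneg fun t => (hGg t).nonneg fun k => hG0 k t
  rw [← ENNReal.ofReal_le_ofReal_iff h2, key hf hF0 hF hFf, key hg hG0 hG hGg]
  exact ENNReal.tsum_le_tsum fun k => ENNReal.ofReal_le_ofReal (h k)

theorem integrable_of_continuous_of_support {w w' w'' : ℝ → ℂ} (hs : HasCompactSupport w)
    (hs' : HasCompactSupport w') (hs'' : HasCompactSupport w'') {f : ℝ → ℝ} (hf : Continuous f)
    (h0 : ∀ t, w t = 0 → w' t = 0 → w'' t = 0 → f t = 0) : Integrable f := by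
  refine hf.integrable_of_hasCompactSupport ?_
  refine HasCompactSupport.intro ((hs.isCompact.union hs'.isCompact).union hs''.isCompact)
    fun t ht => ?_
  simp only [mem_union, not_or] at ht
  exact h0 t (image_eq_zero_of_notMem_tsupport ht.1.1)
    (image_eq_zero_of_notMem_tsupport ht.1.2) (image_eq_zero_of_notMem_tsupport ht.2)

/-- The one-dimensional inequality for each angular mode, in logarithmic coordinates. -/
theorem mode_inequality {w w' w'' : ℝ → ℂ} (h1 : ∀ t, HasDerivAt w (w' t) t)
    (h2 : ∀ t, HasDerivAt w' (w'' t) t) (hc : Continuous w'') (hs : HasCompactSupport w)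
    (hs' : HasCompactSupport w') (hs'' : HasCompactSupport w'') {A b s m C : ℝ}
    (hC1 : C ≤ b ^ 2 + 2 * A) (hC2 : C * (s ^ 2 + m) ≤ A ^ 2) :
    C * ∫ t, (‖w' t + s * w t‖ ^ 2 + m * ‖w t‖ ^ 2) ≤
      ∫ t, ‖w'' t + b * w' t - A * w t‖ ^ 2 := by
  have cw : Continuous w := continuous_iff_continuousAt.mpr fun t => (h1 t).continuousAt
  have cw' : Continuous w' := continuous_iff_continuousAt.mpr fun t => (h2 t).continuousAt
  have hI := fun f hf h0 => integrable_of_continuous_of_support hs hs' hs'' (f := f) hf h0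
  have hre : ∀ {v v' : ℝ → ℂ} {t : ℝ}, HasDerivAt v (v' t) t →
      HasDerivAt (fun t => (v t).re) ((v' t).re) t := fun hv => by
    have := Complex.reCLM.hasFDerivAt.comp_hasDerivAt _ hv
    simpa [Function.comp_def] using this
  have him : ∀ {v v' : ℝ → ℂ} {t : ℝ}, HasDerivAt v (v' t) t →
      HasDerivAt (fun t => (v t).im) ((v' t).im) t := fun hv => by
    have := Complex.imCLM.hasFDerivAt.comp_hasDerivAt _ hv
    simpa [Function.comp_def] using this
  -- Q = b|w'|² - 2A Re(w' w̄) - (Ab + Cs)|w|². Its derivative collects all cross terms of both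
  -- squares, and its integral vanishes by compact support.
  let Q : ℝ → ℝ := fun t => b * ((w' t).re * (w' t).re + (w' t).im * (w' t).im)
    - 2 * A * ((w' t).re * (w t).re + (w' t).im * (w t).im)
    - (A * b + C * s) * ((w t).re * (w t).re + (w t).im * (w t).im)
  let Q' : ℝ → ℝ := fun t => b * (((w'' t).re * (w' t).re + (w' t).re * (w'' t).re)
      + ((w'' t).im * (w' t).im + (w' t).im * (w'' t).im))
    - 2 * A * (((w'' t).re * (w t).re + (w' t).re * (w' t).re)
      + ((w'' t).im * (w t).im + (w' t).im * (w' t).im))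
    - (A * b + C * s) * (((w' t).re * (w t).re + (w t).re * (w' t).re)
      + ((w' t).im * (w t).im + (w t).im * (w' t).im))
  have hQ : ∀ t, HasDerivAt Q (Q' t) t := fun t =>
    (((((hre (h2 t)).mul (hre (h2 t))).add ((him (h2 t)).mul (him (h2 t)))).const_mul b).sub
      ((((hre (h2 t)).mul (hre (h1 t))).add ((him (h2 t)).mul (him (h1 t)))).const_mul (2 * A))).sub
      ((((hre (h1 t)).mul (hre (h1 t))).add ((him (h1 t)).mul (him (h1 t)))).const_mul
        (A * b + C * s))
  have hQ'i : Integrable Q' := hI _ (by fun_prop) fun t e0 e1 e2 => by simp [Q', e0, e1, e2]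
  have hQ0 : ∫ t, Q' t = 0 := integral_eq_zero_of_hasDerivAt_of_integrable hQ hQ'i
    (hI _ (by fun_prop) fun t e0 e1 e2 => by simp [Q, e0, e1])
  have hR : Integrable fun t => ‖w' t + s * w t‖ ^ 2 + m * ‖w t‖ ^ 2 :=
    hI _ (by fun_prop) fun t e0 e1 e2 => by simp [e0, e1]
  have hL : Integrable fun t => ‖w'' t + b * w' t - A * w t‖ ^ 2 :=
    hI _ (by fun_prop) fun t e0 e1 e2 => by simp [e0, e1, e2]
  have key : ∫ t, (C * (‖w' t + s * w t‖ ^ 2 + m * ‖w t‖ ^ 2) + Q' t) ≤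
      ∫ t, ‖w'' t + b * w' t - A * w t‖ ^ 2 := by
    refine integral_mono ((hR.const_mul C).add hQ'i) hL fun t => ?_
    -- After removing Q', the difference of the two integrands is |w''|² plus these two nonnegative
    -- terms.
    have e1 : 0 ≤ (b ^ 2 + 2 * A - C) * ((w' t).re ^ 2 + (w' t).im ^ 2) :=
      mul_nonneg (by linarith) (by positivity)
    have e2 : 0 ≤ (A ^ 2 - C * (s ^ 2 + m)) * ((w t).re ^ 2 + (w t).im ^ 2) :=
      mul_nonneg (by linarith) (by positivity)
    simp only [← Complex.normSq_eq_norm_sq, Complex.normSq_apply, Q', Complex.add_re,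
      Complex.add_im, Complex.sub_re, Complex.sub_im, Complex.re_ofReal_mul, Complex.im_ofReal_mul]
    nlinarith [sq_nonneg (w'' t).re, sq_nonneg (w'' t).im]
  rw [integral_add (hR.const_mul C) hQ'i, hQ0, add_zero, integral_const_mul] at key
  exact key

end OneDimensional

/-! ### Test functions in logarithmic coordinates -/

variable {d : ℕ}

/-- The function `ψ` in logarithmic polar coordinates, with the weight `e^{-st}`. -/
def emden (s : ℝ) (ψ : E d → ℂ) (t : ℝ) (x : E d) : ℂ :=
  (Real.exp (-(s * t)) : ℂ) * ψ (Real.exp t • x)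

/-- The Euler operator `x · ∇ - s`. -/
def eulerOp (s : ℝ) (ψ : E d → ℂ) (x : E d) : ℂ := fderiv ℝ ψ x x - s * ψ x

theorem tsupport_eulerOp_subset (s : ℝ) (ψ : E d → ℂ) : tsupport (eulerOp s ψ) ⊆ tsupport ψ := by
  refine closure_minimal (fun x hx => ?_) (isClosed_tsupport ψ)
  by_contra h
  apply hx
  have h1 : ψ x = 0 := image_eq_zero_of_notMem_tsupport h
  have h2 : fderiv ℝ ψ x = 0 :=
    image_eq_zero_of_notMem_tsupport fun h' => h (tsupport_fderiv_subset ℝ h')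
  simp [eulerOp, h1, h2]

theorem IsTestFunction.eulerOp {ψ : E d → ℂ} (h : IsTestFunction ψ) (s : ℝ) :
    IsTestFunction (eulerOp s ψ) := by
  refine ⟨?_, ?_, fun h0 => h.2.2 (tsupport_eulerOp_subset s ψ h0)⟩
  · have h1 : ContDiff ℝ ∞ (fderiv ℝ ψ) := h.1.fderiv_right (by norm_cast)
    exact (h1.clm_apply contDiff_id).sub (contDiff_const.mul h.1)
  · exact h.2.1.mono' ((subset_tsupport _).trans (tsupport_eulerOp_subset s ψ))

/-- With N = x · ∇ one has D²ψ(x, x) = N²ψ - Nψ; substitute N = `eulerOp s` + s. -/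
theorem eulerOp_eulerOp {ψ : E d → ℂ} (h : IsTestFunction ψ) (s : ℝ) (x : E d) :
    fderiv ℝ (fderiv ℝ ψ) x x x =
      eulerOp s (eulerOp s ψ) x + (2 * s - 1) * eulerOp s ψ x + (s ^ 2 - s) * ψ x := by
  have h1 : ContDiff ℝ ∞ (fderiv ℝ ψ) := h.1.fderiv_right (by norm_cast)
  have h2 : fderiv ℝ (eulerOp s ψ) x = (fderiv ℝ ψ x).comp (ContinuousLinearMap.id ℝ (E d)) +
      (fderiv ℝ (fderiv ℝ ψ) x).flip x - (s : ℂ) • fderiv ℝ ψ x := by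
    have a1 := (h1.differentiable (by simp) x).hasFDerivAt.clm_apply (hasFDerivAt_id x)
    have a2 := ((h.1.differentiable (by simp) x).hasFDerivAt).const_mul (s : ℂ)
    have a3 := a1.sub a2
    have a4 : fderiv ℝ (eulerOp s ψ) x = _ := a3.fderiv
    rw [a4]
    rfl
  rw [eulerOp, h2]
  simp [eulerOp]
  ring

/-- The shift by s in `eulerOp` is the derivative of the factor e^{-st}. Since the operator
preserves test functions, higher t-derivatives are obtained by iteration. -/
theorem hasDerivAt_emden {ψ : E d → ℂ} (h : IsTestFunction ψ) (s t : ℝ) (x : E d) :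
    HasDerivAt (fun t => emden s ψ t x) (emden s (eulerOp s ψ) t x) t := by
  have h1 : HasDerivAt (fun t : ℝ => (Real.exp (-(s * t)) : ℂ)) (-s * Real.exp (-(s * t)) : ℂ) t := by
    have : HasDerivAt (fun t : ℝ => Real.exp (-(s * t))) (Real.exp (-(s * t)) * (-s)) t := by
      have := (((hasDerivAt_id t).const_mul s).neg).exp
      simpa using this
    convert this.ofReal_comp using 1
    push_cast
    ring
  have h2 : HasDerivAt (fun t : ℝ => Real.exp t • x) (Real.exp t • x) t :=
    (Real.hasDerivAt_exp t).smul_const x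
  have h3 : HasDerivAt (fun t : ℝ => ψ (Real.exp t • x))
      (fderiv ℝ ψ (Real.exp t • x) (Real.exp t • x)) t :=
    ((h.1.differentiable (by simp) _).hasFDerivAt).comp_hasDerivAt t h2
  refine (h1.mul h3).congr_deriv ?_
  simp only [emden, eulerOp]
  ring

theorem continuous_emden {ψ : E d → ℂ} (h : Continuous ψ) (s : ℝ) :
    Continuous fun p : ℝ × E d => emden s ψ p.1 p.2 := by
  unfold emden; fun_prop

theorem contDiff_emden {ψ : E d → ℂ} (h : IsTestFunction ψ) (s t : ℝ) :
    ContDiff ℝ ∞ (emden s ψ t) :=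
  contDiff_const.mul (h.1.comp (contDiff_const_smul _))

/-- A test function vanishes outside of an annulus. -/
theorem IsTestFunction.exists_annulus {ψ : E d → ℂ} (h : IsTestFunction ψ) :
    ∃ T : ℝ, 0 < T ∧ ∀ t, t ∉ Icc (-T) T → ∀ θ : S d, Real.exp t • (θ : E d) ∉ tsupport ψ := by
  obtain ⟨R, hR⟩ := h.2.1.isCompact.isBounded.subset_closedBall (0 : E d)
  obtain ⟨r, hr, hr'⟩ := Metric.isOpen_iff.mp (isClosed_tsupport ψ).isOpen_compl 0 h.2.2
  have hn : ∀ (t : ℝ) (θ : S d), ‖Real.exp t • (θ : E d)‖ = Real.exp t := fun t θ => by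
    rw [norm_smul, norm_coe_sphere, mul_one, Real.norm_of_nonneg (Real.exp_pos t).le]
  refine ⟨max (|R| + 1) (|Real.log r| + 1), by positivity, fun t ht θ hmem => ht ⟨?_, ?_⟩⟩
  · by_contra hlt
    rw [not_le] at hlt
    have h1 : t < Real.log r := by
      have := neg_abs_le (Real.log r)
      have := le_max_right (|R| + 1) (|Real.log r| + 1)
      linarith
    refine hr' ?_ hmem
    rw [mem_ball_zero_iff, hn]
    exact (Real.lt_log_iff_exp_lt hr).mp h1
  · have h1 := hR hmem
    rw [mem_closedBall_zero_iff, hn] at h1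
    have h2 := Real.add_one_le_exp t
    have := le_abs_self R
    have := le_max_left (|R| + 1) (|Real.log r| + 1)
    linarith

theorem emden_eq_zero {ψ : E d → ℂ} {s t : ℝ} {x : E d} (h : Real.exp t • x ∉ tsupport ψ) :
    emden s ψ t x = 0 := by
  rw [emden, image_eq_zero_of_notMem_tsupport h, mul_zero]

theorem exists_bound_emden {ψ : E d → ℂ} (h : IsTestFunction ψ) (s : ℝ) :
    ∃ C, ∀ (t : ℝ) (θ : S d), ‖emden s ψ t θ‖ ≤ C := by
  obtain ⟨T, hT, hT'⟩ := h.exists_annulus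
  have hc : Continuous fun p : ℝ × S d => emden s ψ p.1 p.2 :=
    (continuous_emden h.1.continuous s).comp
      (continuous_fst.prodMk (continuous_subtype_val.comp continuous_snd))
  obtain ⟨C, hC⟩ := ((isCompact_Icc (a := -T) (b := T)).prod
    (isCompact_univ (X := S d))).exists_bound_of_continuousOn hc.continuousOn
  refine ⟨max C 0, fun t θ => ?_⟩
  by_cases ht : t ∈ Icc (-T) T
  · exact (hC (t, θ) ⟨ht, mem_univ _⟩).trans (le_max_left _ _)
  · rw [emden_eq_zero (hT' t ht θ), norm_zero]
    exact le_max_right _ _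

/-- The coefficient of `ψ` with respect to `u`, in logarithmic coordinates. -/
def coeff (u : L2S d) (s : ℝ) (ψ : E d → ℂ) (t : ℝ) : ℂ :=
  ∫ θ, (starRingEnd ℂ) (u θ) * emden s ψ t θ ∂(σ d)

theorem hasDerivAt_coeff {ψ : E d → ℂ} (h : IsTestFunction ψ) (u : L2S d) (s t : ℝ) :
    HasDerivAt (coeff u s ψ) (coeff u s (eulerOp s ψ) t) t := by
  obtain ⟨C, hC⟩ := exists_bound_emden (h.eulerOp s) s
  have hu : Integrable u (σ d) := (Lp.memLp u).integrable (by norm_num)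
  have hcont : ∀ {χ : E d → ℂ}, IsTestFunction χ → ∀ t,
      Continuous fun θ : S d => emden s χ t θ := fun hχ t =>
    (contDiff_emden hχ s t).continuous.comp continuous_subtype_val
  have hmeas : ∀ {χ : E d → ℂ}, IsTestFunction χ → ∀ t,
      AEStronglyMeasurable (fun θ => (starRingEnd ℂ) (u θ) * emden s χ t θ) (σ d) := fun hχ t =>
    (Complex.continuous_conj.comp_aestronglyMeasurable hu.1).mul
      (hcont hχ t).aestronglyMeasurable
  obtain ⟨C', hC'⟩ := exists_bound_emden h s
  refine (hasDerivAt_integral_of_dominated_loc_of_deriv_le (μ := σ d)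
    (F := fun t θ => (starRingEnd ℂ) (u θ) * emden s ψ t θ)
    (F' := fun t θ => (starRingEnd ℂ) (u θ) * emden s (eulerOp s ψ) t θ)
    (bound := fun θ => ‖u θ‖ * C) (s := univ) univ_mem (Eventually.of_forall (hmeas h)) ?_
    (hmeas (h.eulerOp s) t) ?_ (hu.norm.mul_const C) ?_).2
  · refine Integrable.mono' (hu.norm.mul_const C') (hmeas h t) (Eventually.of_forall fun θ => ?_)
    rw [norm_mul, RCLike.norm_conj]
    gcongr
    exact hC' t θ
  · refine Eventually.of_forall fun θ t _ => ?_
    rw [norm_mul, RCLike.norm_conj]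
    gcongr
    exact hC t θ
  · exact Eventually.of_forall fun θ t _ => (hasDerivAt_emden h s t θ).const_mul _

theorem continuous_coeff {ψ : E d → ℂ} (h : IsTestFunction ψ) (u : L2S d) (s : ℝ) :
    Continuous (coeff u s ψ) :=
  continuous_iff_continuousAt.mpr fun t => (hasDerivAt_coeff h u s t).continuousAt

theorem hasCompactSupport_coeff {ψ : E d → ℂ} (h : IsTestFunction ψ) (u : L2S d) (s : ℝ) :
    HasCompactSupport (coeff u s ψ) := by
  obtain ⟨T, hT, hT'⟩ := h.exists_annulus
  refine HasCompactSupport.intro (isCompact_Icc (a := -T) (b := T)) fun t ht => ?_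
  simp [coeff, emden_eq_zero (hT' t ht _)]

/-! ### Transformation of the integrands and integrability -/

section

variable {d : ℕ}

theorem emden_eq_smul (s : ℝ) (ψ : E d → ℂ) (t : ℝ) :
    emden s ψ t = Real.exp (-(s * t)) • fun x => ψ (Real.exp t • x) := by
  funext x
  simp [emden]

theorem fderiv_emden {ψ : E d → ℂ} (s t : ℝ) (x : E d) :
    fderiv ℝ (emden s ψ t) x =
      (Real.exp (-(s * t)) * Real.exp t) • fderiv ℝ ψ (Real.exp t • x) := by
  rw [emden_eq_smul, fderiv_const_smul_field, Pi.smul_apply, fderiv_comp_const_smul, mul_smul]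

theorem fderiv_fderiv_emden {ψ : E d → ℂ} (s t : ℝ) (x : E d) :
    fderiv ℝ (fderiv ℝ (emden s ψ t)) x =
      (Real.exp (-(s * t)) * Real.exp t ^ 2) • fderiv ℝ (fderiv ℝ ψ) (Real.exp t • x) := by
  have e := congrFun (fderiv_const_smul_field (𝕜 := ℝ) (f := fderiv ℝ fun x => ψ (Real.exp t • x))
    (Real.exp (-(s * t)))) x
  rw [emden_eq_smul, fderiv_const_smul_field, e, Pi.smul_apply, fderiv_fderiv_comp_const_smul,
    mul_smul]

theorem fderiv_emden_self {ψ : E d → ℂ} (s t : ℝ) (x : E d) :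
    fderiv ℝ (emden s ψ t) x x = emden s (eulerOp s ψ) t x + s * emden s ψ t x := by
  rw [fderiv_emden]
  simp only [emden, eulerOp, map_smul, smul_apply, Complex.real_smul]
  push_cast
  ring

theorem fderiv_fderiv_emden_self {ψ : E d → ℂ} (h : IsTestFunction ψ) (s t : ℝ) (x : E d) :
    fderiv ℝ (fderiv ℝ (emden s ψ t)) x x x = emden s (eulerOp s (eulerOp s ψ)) t x
      + (2 * s - 1) * emden s (eulerOp s ψ) t x + (s ^ 2 - s) * emden s ψ t x := by
  have e := eulerOp_eulerOp h s (Real.exp t • x)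
  rw [fderiv_fderiv_emden]
  simp only [map_smul, smul_apply, Complex.real_smul] at e ⊢
  simp only [emden]
  push_cast at e ⊢
  linear_combination Complex.exp (-(s * t)) * e

theorem laplacian_emden {ψ : E d → ℂ} (s t : ℝ) (x : E d) :
    Laplacian.laplacian (emden s ψ t) x =
      (Real.exp (-(s * t)) : ℂ) * Real.exp t ^ 2 * Laplacian.laplacian ψ (Real.exp t • x) := by
  simp only [laplacian_apply_single, Finset.mul_sum, fderiv_fderiv_emden]
  refine Finset.sum_congr rfl fun j _ => ?_
  simp only [smul_apply, Complex.real_smul]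
  push_cast
  ring

theorem gradSq_emden {ψ : E d → ℂ} (s t : ℝ) (x : E d) :
    gradSq (emden s ψ t) x =
      (Real.exp (-(s * t)) * Real.exp t) ^ 2 * gradSq ψ (Real.exp t • x) := by
  simp only [gradSq, Finset.mul_sum, fderiv_emden]
  refine Finset.sum_congr rfl fun j _ => ?_
  rw [smul_apply, norm_smul, mul_pow, Real.norm_of_nonneg (by positivity)]

/-- The electric Laplacian in logarithmic coordinates, restricted to the sphere. -/
def emdenOp (a : S d → ℝ) (s : ℝ) (ψ : E d → ℂ) (t : ℝ) (θ : S d) : ℂ :=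
  -Laplacian.laplacian (emden s ψ t) (θ : E d) + (a θ : ℂ) * emden s ψ t θ

theorem norm_exp_smul (t : ℝ) (θ : S d) : ‖Real.exp t • (θ : E d)‖ = Real.exp t := by
  rw [norm_smul, norm_coe_sphere, mul_one, Real.norm_of_nonneg (Real.exp_pos t).le]

/-- Two derivatives and the factor e^{-st} produce e^{2(2 - s)t} in the square, and 2(2 - s) = d - α
is exactly the weight left by the volume element. The same s serves the two lemmas that follow. -/
theorem electricOp_exp_smul (a : S d → ℝ) {α s : ℝ} (hs : s = (4 + α - d) / 2) (ψ : E d → ℂ)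
    (t : ℝ) (θ : S d) :
    Real.exp (d * t) * (‖electricOp a ψ (Real.exp t • (θ : E d))‖ ^ 2 /
      ‖Real.exp t • (θ : E d)‖ ^ α) = ‖emdenOp a s ψ t θ‖ ^ 2 := by
  have e : emdenOp a s ψ t θ = ((Real.exp (-(s * t)) * Real.exp t ^ 2 : ℝ) : ℂ) *
      electricOp a ψ (Real.exp t • (θ : E d)) := by
    rw [emdenOp, laplacian_emden, electricOp, emden, homExt_smul a (Real.exp_pos t), homExt_coe,
      norm_exp_smul]
    have : (Real.exp t : ℂ) ≠ 0 := by exact_mod_cast (Real.exp_pos t).ne'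
    push_cast at this ⊢
    field_simp
  rw [e, norm_mul, Complex.norm_real, Real.norm_of_nonneg (by positivity), norm_exp_smul,
    ← Real.exp_mul, mul_pow, ← Real.exp_nat_mul, ← Real.exp_add, ← Real.exp_nat_mul,
    div_eq_mul_inv, ← Real.exp_neg, mul_left_comm, ← Real.exp_add, mul_comm]
  congr 2
  rw [hs]; push_cast; ring

theorem gradSq_exp_smul {α s : ℝ} (hs : s = (4 + α - d) / 2) (ψ : E d → ℂ) (t : ℝ) (θ : S d) :
    Real.exp (d * t) * (gradSq ψ (Real.exp t • (θ : E d)) /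
      ‖Real.exp t • (θ : E d)‖ ^ (α + 2)) = gradSq (emden s ψ t) θ := by
  rw [gradSq_emden, norm_exp_smul, ← Real.exp_mul, ← Real.exp_add, ← Real.exp_nat_mul,
    div_eq_mul_inv, ← Real.exp_neg, mul_left_comm, ← Real.exp_add, mul_comm]
  congr 2
  rw [hs]; push_cast; ring

theorem potential_exp_smul (a : S d → ℝ) {α s : ℝ} (hs : s = (4 + α - d) / 2) (ψ : E d → ℂ)
    (t : ℝ) (θ : S d) :
    Real.exp (d * t) * (homExt a (Real.exp t • (θ : E d)) * ‖ψ (Real.exp t • (θ : E d))‖ ^ 2 /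
      ‖Real.exp t • (θ : E d)‖ ^ (α + 4)) = a θ * ‖emden s ψ t θ‖ ^ 2 := by
  rw [emden, norm_mul, Complex.norm_real, Real.norm_of_nonneg (by positivity), norm_exp_smul,
    homExt_smul a (Real.exp_pos t), homExt_coe, ← Real.exp_mul, mul_pow, ← Real.exp_nat_mul,
    div_eq_mul_inv, ← Real.exp_neg, mul_left_comm, ← Real.exp_add]
  rw [show (d : ℝ) * t + -(t * (α + 4)) = ((2 : ℕ) : ℝ) * -(s * t) by rw [hs]; push_cast; ring]
  ring

/-- In polar coordinates the extension of a depends on θ alone, hence is an essentially bounded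
multiplier. -/
theorem integrable_homExt_mul (hd : 1 ≤ d) {a : S d → ℝ} (ha : MemLp a ∞ (σ d)) {g : E d → ℝ}
    (hg : Integrable g) : Integrable fun x => homExt a x * g x := by
  rw [← integrable_comp_polarMap hd] at hg ⊢
  obtain ⟨M, -, hM⟩ := exists_ae_norm_le ha
  have e : ∀ p : ℝ × S d, homExt a (polarMap d p) = a p.2 := fun p => by
    rw [polarMap, homExt_smul a (Real.exp_pos _), homExt_coe]
  simp_rw [e]
  exact hg.bdd_mul ha.1.comp_snd (Measure.quasiMeasurePreserving_snd.ae hM)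

theorem integrable_polar (hd : 1 ≤ d) {f : E d → ℝ} (hf : Integrable f) :
    Integrable fun t : ℝ => Real.exp (d * t) • ∫ θ, f (Real.exp t • (θ : E d)) ∂(σ d) := by
  have h := ((integrable_comp_polarMap hd).mpr hf).integral_prod_left
  rw [expMeasure, integrable_withDensity_iff_integrable_smul' (by fun_prop) (by simp)] at h
  refine h.congr (Eventually.of_forall fun t => ?_)
  simp [ENNReal.toReal_ofReal (Real.exp_pos _).le, polarMap]

section Integrability

variable {ψ : E d → ℂ}

theorem IsTestFunction.continuous_laplacian (h : IsTestFunction ψ) :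
    Continuous (Laplacian.laplacian ψ) := by
  have h1 : ContDiff ℝ ∞ (fderiv ℝ ψ) := h.1.fderiv_right (by norm_cast)
  have h2 : Continuous (fderiv ℝ (fderiv ℝ ψ)) := h1.continuous_fderiv (by simp)
  have : Laplacian.laplacian ψ = _ := funext fun x => laplacian_apply_single ψ x
  rw [this]
  fun_prop

theorem continuousOn_norm_rpow (β : ℝ) : ContinuousOn (fun x : E d => ‖x‖ ^ β) {0}ᶜ :=
  continuous_norm.continuousOn.rpow_const fun _ hx => Or.inl (norm_ne_zero_iff.mpr hx)

theorem IsTestFunction.integrable_div (h : IsTestFunction ψ) {f : E d → ℝ} (hf : Continuous f)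
    (h0 : ∀ x ∉ tsupport ψ, f x = 0) (β : ℝ) : Integrable fun x => f x / ‖x‖ ^ β := by
  refine integrable_of_continuousOn_annulus (hf.continuousOn.div (continuousOn_norm_rpow β)
    fun _ hx => (Real.rpow_pos_of_pos (norm_pos_iff.mpr hx) β).ne') h.2.1.isCompact h.2.2
    fun _ hx => by rw [h0 _ hx, zero_div]

theorem laplacian_eq_zero_of_notMem_tsupport {x : E d} (hx : x ∉ tsupport ψ) :
    Laplacian.laplacian ψ x = 0 := by
  have : fderiv ℝ (fderiv ℝ ψ) x = 0 := image_eq_zero_of_notMem_tsupport fun h' =>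
    hx (tsupport_fderiv_subset ℝ (tsupport_fderiv_subset ℝ h'))
  rw [laplacian_apply_single, this]
  simp

theorem IsTestFunction.integrable_gradSq (h : IsTestFunction ψ) (β : ℝ) :
    Integrable fun x => gradSq ψ x / ‖x‖ ^ β := by
  have h1 : Continuous (fderiv ℝ ψ) := h.1.continuous_fderiv (by simp)
  refine h.integrable_div (by unfold gradSq; fun_prop) (fun x hx => ?_) β
  have : fderiv ℝ ψ x = 0 := image_eq_zero_of_notMem_tsupport fun h' =>
    hx (tsupport_fderiv_subset ℝ h')
  simp [gradSq, this]

theorem IsTestFunction.integrable_potential (h : IsTestFunction ψ) (hd : 1 ≤ d) {a : S d → ℝ}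
    (ha : MemLp a ∞ (σ d)) (β : ℝ) :
    Integrable fun x => homExt a x * ‖ψ x‖ ^ 2 / ‖x‖ ^ β := by
  simp_rw [mul_div_assoc]
  have h1 := h.1.continuous
  exact integrable_homExt_mul hd ha (h.integrable_div (by fun_prop)
    (fun x hx => by simp [image_eq_zero_of_notMem_tsupport hx]) β)

theorem IsTestFunction.integrable_electricOp (h : IsTestFunction ψ) (hd : 1 ≤ d) {a : S d → ℝ}
    (ha : MemLp a ∞ (σ d)) (α : ℝ) :
    Integrable fun x => ‖electricOp a ψ x‖ ^ 2 / ‖x‖ ^ α := by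
  have h1 := h.1.continuous
  have h2 := h.continuous_laplacian
  -- The square is expanded, so that a occurs only as a multiplier of integrable functions: once in
  -- the cross term, twice in the last.
  have i1 := h.integrable_div (f := fun x => ‖Laplacian.laplacian ψ x‖ ^ 2) (by fun_prop)
    (fun x hx => by simp [laplacian_eq_zero_of_notMem_tsupport hx]) α
  have i2 := integrable_homExt_mul hd ha (h.integrable_div
    (f := fun x => 2 * ((Laplacian.laplacian ψ x).re * (ψ x).re +
      (Laplacian.laplacian ψ x).im * (ψ x).im)) (by fun_prop)
    (fun x hx => by simp [laplacian_eq_zero_of_notMem_tsupport hx]) (α + 2))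
  have i3 := integrable_homExt_mul hd ha (h.integrable_potential hd ha (α + 4))
  refine ((i1.sub i2).add i3).congr (Eventually.of_forall fun x => ?_)
  by_cases hx : x = 0
  · have : x ∉ tsupport ψ := by rw [hx]; exact h.2.2
    simp [electricOp, image_eq_zero_of_notMem_tsupport this,
      laplacian_eq_zero_of_notMem_tsupport this]
  have hx' : 0 < ‖x‖ := norm_pos_iff.mpr hx
  have hp : (‖x‖ ^ α) ≠ 0 := (Real.rpow_pos_of_pos hx' α).ne'
  have r2 : ‖x‖ ^ (α + 2) = ‖x‖ ^ α * ‖x‖ ^ 2 := by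
    rw [Real.rpow_add hx']; norm_cast
  have r4 : ‖x‖ ^ (α + 4) = ‖x‖ ^ α * ‖x‖ ^ 4 := by
    rw [Real.rpow_add hx']; norm_cast
  simp only [Pi.add_apply, Pi.sub_apply, r2, r4, electricOp, ← Complex.normSq_eq_norm_sq,
    Complex.normSq_apply, Complex.add_re, Complex.add_im, Complex.neg_re, Complex.neg_im,
    Complex.re_ofReal_mul, Complex.im_ofReal_mul]
  field_simp
  ring

end Integrability

end

/-! ### Parseval on the sphere and decoupling of the modes -/

section

variable {d : ℕ}

section Parseval

theorem inner_toLp_right (u : L2S d) {F : S d → ℂ} (hF : MemLp F 2 (σ d)) :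
    inner ℂ u (hF.toLp F) = ∫ θ, (starRingEnd ℂ) (u θ) * F θ ∂(σ d) := by
  rw [L2.inner_def]
  refine integral_congr_ae ?_
  filter_upwards [hF.coeFn_toLp] with θ h
  rw [h, RCLike.inner_apply']

theorem inner_toLp_toLp {F G : S d → ℂ} (hF : MemLp F 2 (σ d)) (hG : MemLp G 2 (σ d)) :
    inner ℂ (hF.toLp F) (hG.toLp G) = ∫ θ, (starRingEnd ℂ) (F θ) * G θ ∂(σ d) := by
  rw [inner_toLp_right]
  refine integral_congr_ae ?_
  filter_upwards [hF.coeFn_toLp] with θ h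
  rw [h]

theorem hasSum_norm_integral_sq (b : HilbertBasis ℕ ℂ (L2S d)) {F : S d → ℂ}
    (hF : MemLp F 2 (σ d)) :
    HasSum (fun k => ‖∫ θ, (starRingEnd ℂ) (b k θ) * F θ ∂(σ d)‖ ^ 2)
      (∫ θ, ‖F θ‖ ^ 2 ∂(σ d)) := by
  have h := hasSum_norm_inner_sq b (hF.toLp F)
  simp_rw [inner_toLp_right] at h
  convert h using 1
  have h1 := inner_self_eq_norm_sq_to_K (𝕜 := ℂ) (hF.toLp F)
  rw [inner_toLp_toLp] at h1
  have h2 : ∀ θ, (starRingEnd ℂ) (F θ) * F θ = ((‖F θ‖ ^ 2 : ℝ) : ℂ) := fun θ => by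
    rw [mul_comm, Complex.mul_conj, Complex.normSq_eq_norm_sq]
  simp_rw [h2] at h1
  rw [integral_complex_ofReal] at h1
  apply Complex.ofReal_injective
  rw [Complex.ofReal_pow]
  exact h1

theorem Continuous.memLp_two {F : S d → ℂ} (hF : Continuous F) : MemLp F 2 (σ d) :=
  hF.memLp_of_hasCompactSupport (HasCompactSupport.of_compactSpace F)

theorem memLp_ofReal_mul {a : S d → ℝ} (ha : MemLp a ∞ (σ d)) {F : S d → ℂ}
    (hF : MemLp F 2 (σ d)) : MemLp (fun θ => (a θ : ℂ) * F θ) 2 (σ d) :=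
  hF.mul (ha.ofReal (K := ℂ))

theorem integrable_conj_mul (u : L2S d) {F : S d → ℂ} (hF : MemLp F 2 (σ d)) :
    Integrable (fun θ => (starRingEnd ℂ) (u θ) * F θ) (σ d) := by
  refine (L2.integrable_inner (𝕜 := ℂ) u (hF.toLp F)).congr ?_
  filter_upwards [hF.coeFn_toLp] with θ h
  rw [h, RCLike.inner_apply']

/-- The angular operator `-Δ_{S^{d-1}} + a` on smooth functions. -/
def angularOp (a : S d → ℝ) (φ : S d → ℂ) (θ : S d) : ℂ :=
  -sphereLaplacian φ θ + (a θ : ℂ) * φ θ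

theorem memLp_angularOp {a : S d → ℝ} (ha : MemLp a ∞ (σ d)) {φ : S d → ℂ}
    (hφ : SmoothOnSphere φ) : MemLp (angularOp a φ) 2 (σ d) :=
  (Continuous.memLp_two hφ.continuous_sphereLaplacian).neg.add
    (memLp_ofReal_mul ha (Continuous.memLp_two hφ.continuous))

/-- The operator is moved onto u by testing its weak equation, which is bilinear, with the conjugate
of φ. -/
theorem IsAngularEigenfunction.integral_angularOp {a : S d → ℝ} (ha : MemLp a ∞ (σ d)) {μ : ℝ}
    {u : L2S d} (hu : IsAngularEigenfunction a μ u) {φ : S d → ℂ} (hφ : SmoothOnSphere φ) :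
    ∫ θ, (starRingEnd ℂ) (u θ) * angularOp a φ θ ∂(σ d) =
      μ * ∫ θ, (starRingEnd ℂ) (u θ) * φ θ ∂(σ d) := by
  obtain ⟨-, f, hf, hae⟩ := hu
  have m1 := Continuous.memLp_two hφ.continuous_sphereLaplacian
  have m2 := Continuous.memLp_two hφ.continuous
  have h1 := congrArg (starRingEnd ℂ) (hf _ hφ.conj)
  simp_rw [← integral_conj, map_mul, sphereLaplacian_conj, Complex.conj_conj] at h1
  have h2 : ∫ θ, (starRingEnd ℂ) (u θ) * angularOp a φ θ ∂(σ d) =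
      -(∫ θ, (starRingEnd ℂ) (u θ) * sphereLaplacian φ θ ∂(σ d)) +
        ∫ θ, (starRingEnd ℂ) (u θ) * ((a θ : ℂ) * φ θ) ∂(σ d) := by
    rw [← integral_neg, ← integral_add (integrable_conj_mul u m1).fun_neg
      (integrable_conj_mul u (memLp_ofReal_mul ha m2))]
    refine integral_congr_ae (Eventually.of_forall fun θ => ?_)
    simp only [angularOp]
    ring
  rw [h2, h1, ← integral_neg, ← integral_add (integrable_conj_mul f m2).fun_neg
    (integrable_conj_mul u (memLp_ofReal_mul ha m2)), ← integral_const_mul]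
  refine integral_congr_ae ?_
  filter_upwards [hae] with θ h
  have h3 := congrArg (starRingEnd ℂ) h
  simp only [map_add, map_neg, map_mul, Complex.conj_ofReal] at h3
  linear_combination φ θ * h3

theorem integrable_potential_sphere {a : S d → ℝ} (ha : MemLp a ∞ (σ d)) {φ : S d → ℂ}
    (hφ : MemLp φ 2 (σ d)) : Integrable (fun θ => a θ * ‖φ θ‖ ^ 2) (σ d) := by
  have m := memLp_ofReal_mul ha hφ
  refine (L2.integrable_inner (𝕜 := ℂ) (hφ.toLp φ) (m.toLp _)).re.congr ?_
  filter_upwards [hφ.coeFn_toLp, m.coeFn_toLp] with θ h1 h2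
  rw [h1, h2, RCLike.inner_apply, mul_assoc, Complex.mul_conj, Complex.normSq_eq_norm_sq,
    ← Complex.ofReal_mul, RCLike.re_eq_complex_re, Complex.ofReal_re]

theorem SmoothOnSphere.integrable_gradSq {φ : S d → ℂ} (hφ : SmoothOnSphere φ) :
    Integrable (fun θ : S d => gradSq (homExt φ) θ) (σ d) := by
  refine integrable_of_continuous ?_
  have h1 : Continuous fun θ : S d => fderiv ℝ (homExt φ) θ :=
    hφ.continuousOn_fderiv.comp_continuous continuous_subtype_val
      fun θ => by simpa using coe_sphere_ne_zero θ
  unfold gradSq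
  fun_prop

/-- The quadratic form of the angular operator in terms of the eigenfunctions. -/
theorem hasSum_angularForm (hd : 1 ≤ d) {a : S d → ℝ} (ha : MemLp a ∞ (σ d)) {μ : ℕ → ℝ}
    {u : HilbertBasis ℕ ℂ (L2S d)} (hu : ∀ k, IsAngularEigenfunction a (μ k) (u k))
    {φ : S d → ℂ} (hφ : SmoothOnSphere φ) :
    HasSum (fun k => μ k * ‖∫ θ, (starRingEnd ℂ) (u k θ) * φ θ ∂(σ d)‖ ^ 2)
      (∫ θ : S d, gradSq (homExt φ) θ ∂(σ d) + ∫ θ, a θ * ‖φ θ‖ ^ 2 ∂(σ d)) := by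
  have m2 := Continuous.memLp_two hφ.continuous
  have h := hasSum_weighted_inner_sq u (lam := μ) (x := m2.toLp φ)
    (g := (memLp_angularOp ha hφ).toLp _) fun k => by
      rw [inner_toLp_right, inner_toLp_right, (hu k).integral_angularOp ha hφ]
  simp_rw [inner_toLp_toLp, inner_toLp_right] at h
  convert h using 1
  have i1 : Integrable (fun θ => (starRingEnd ℂ) (φ θ) * sphereLaplacian φ θ) (σ d) :=
    integrable_of_continuous ((Complex.continuous_conj.comp hφ.continuous).mul hφ.continuous_sphereLaplacian)
  have i2 : Integrable (fun θ => ((a θ * ‖φ θ‖ ^ 2 : ℝ) : ℂ)) (σ d) :=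
    (integrable_potential_sphere ha m2).ofReal
  have e : ∫ θ, (starRingEnd ℂ) (φ θ) * angularOp a φ θ ∂(σ d) =
      ((∫ θ : S d, gradSq (homExt φ) θ ∂(σ d) : ℝ) : ℂ) +
        ((∫ θ : S d, a θ * ‖φ θ‖ ^ 2 ∂(σ d) : ℝ) : ℂ) := by
    have e1 := integral_conj_mul_sphereLaplacian hd hφ
    rw [← neg_eq_iff_eq_neg] at e1
    rw [← e1, ← integral_complex_ofReal (f := fun θ => a θ * ‖φ θ‖ ^ 2), ← integral_neg,
      ← integral_add i1.fun_neg i2]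
    refine integral_congr_ae (Eventually.of_forall fun θ => ?_)
    have : (starRingEnd ℂ) (φ θ) * φ θ = ((‖φ θ‖ ^ 2 : ℝ) : ℂ) := by
      rw [mul_comm, Complex.mul_conj, Complex.normSq_eq_norm_sq]
    simp only [angularOp, Complex.ofReal_mul, ← this]
    ring
  rw [e, Complex.add_re, Complex.ofReal_re, Complex.ofReal_re]

end Parseval

section Emden

variable {ψ : E d → ℂ}

theorem IsTestFunction.smoothOnSphere_emden (h : IsTestFunction ψ) (s t : ℝ) :
    SmoothOnSphere fun θ : S d => emden s ψ t θ :=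
  smoothOnSphere_restrict (contDiff_emden h s t).contDiffOn

/-- The d - 1 radial first derivatives combine with D²(θ, θ): the coefficients are 2s - 1 + d - 1
and s² - s + (d - 1)s. -/
theorem emdenOp_eq (h : IsTestFunction ψ) (a : S d → ℝ) (s t : ℝ) (θ : S d) :
    emdenOp a s ψ t θ = angularOp a (fun θ : S d => emden s ψ t θ) θ
      - emden s (eulerOp s (eulerOp s ψ)) t θ - (2 * s + d - 2) * emden s (eulerOp s ψ) t θ
      - s * (s + d - 2) * emden s ψ t θ := by
  have e := sphereLaplacian_restrict (contDiff_emden h s t).contDiffOn θ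
  rw [fderiv_fderiv_emden_self h, fderiv_emden_self] at e
  rw [emdenOp, angularOp, e]
  ring

theorem gradSq_emden_coe (h : IsTestFunction ψ) (s t : ℝ) (θ : S d) :
    gradSq (emden s ψ t) θ = gradSq (homExt fun θ : S d => emden s ψ t θ) θ +
      ‖emden s (eulerOp s ψ) t θ + s * emden s ψ t θ‖ ^ 2 := by
  rw [gradSq_homExt_restrict (contDiff_emden h s t).contDiffOn, fderiv_emden_self]
  ring

theorem IsTestFunction.memLp_emden (h : IsTestFunction ψ) (s t : ℝ) :
    MemLp (fun θ : S d => emden s ψ t θ) 2 (σ d) :=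
  Continuous.memLp_two (h.smoothOnSphere_emden s t).continuous

variable {a : S d → ℝ} {μ : ℕ → ℝ} {u : HilbertBasis ℕ ℂ (L2S d)}

theorem hasSum_emdenOp (h : IsTestFunction ψ) (ha : MemLp a ∞ (σ d))
    (hu : ∀ k, IsAngularEigenfunction a (μ k) (u k)) (s t : ℝ) :
    HasSum (fun k => ‖coeff (u k) s (eulerOp s (eulerOp s ψ)) t
        + ((2 * s + d - 2 : ℝ) : ℂ) * coeff (u k) s (eulerOp s ψ) t
        - ((μ k - s * (s + d - 2) : ℝ) : ℂ) * coeff (u k) s ψ t‖ ^ 2)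
      (∫ θ, ‖emdenOp a s ψ t θ‖ ^ 2 ∂(σ d)) := by
  have m0 := memLp_angularOp ha (h.smoothOnSphere_emden s t)
  have m1 := ((h.eulerOp s).eulerOp s).memLp_emden s t
  have m2 := (h.eulerOp s).memLp_emden s t
  have m3 := h.memLp_emden s t
  have m : MemLp (emdenOp a s ψ t) 2 (σ d) := by
    rw [show emdenOp a s ψ t = _ from funext fun θ => emdenOp_eq h a s t θ]
    exact ((m0.sub m1).sub (m2.const_mul _)).sub (m3.const_mul _)
  convert hasSum_norm_integral_sq u m using 3 with k
  have i0 := integrable_conj_mul (u k) m0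
  have i1 := integrable_conj_mul (u k) m1
  have i2 := integrable_conj_mul (u k) m2
  have i3 := integrable_conj_mul (u k) m3
  have e : ∫ θ, (starRingEnd ℂ) (u k θ) * emdenOp a s ψ t θ ∂(σ d) =
      μ k * coeff (u k) s ψ t - coeff (u k) s (eulerOp s (eulerOp s ψ)) t
        - (2 * s + d - 2) * coeff (u k) s (eulerOp s ψ) t
        - s * (s + d - 2) * coeff (u k) s ψ t := by
    simp only [coeff]
    rw [← (hu k).integral_angularOp ha (h.smoothOnSphere_emden s t)]
    have k1 := integral_sub i0 i1
    have k2 := integral_sub (i0.sub i1) (i2.const_mul (2 * s + d - 2 : ℂ))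
    have k3 := integral_sub ((i0.sub i1).sub (i2.const_mul (2 * s + d - 2 : ℂ)))
      (i3.const_mul (s * (s + d - 2) : ℂ))
    simp only [Pi.sub_apply] at k2 k3
    rw [k2, k1, integral_const_mul, integral_const_mul] at k3
    rw [← k3]
    refine integral_congr_ae (Eventually.of_forall fun θ => ?_)
    simp only [emdenOp_eq h]
    ring
  rw [e, ← norm_neg]
  congr 1
  push_cast
  ring

/-- The gradient splits into a radial part, treated by Parseval, and a tangential part, which
together with the potential is the angular quadratic form. -/
theorem hasSum_emdenForm (hd : 1 ≤ d) (h : IsTestFunction ψ) (ha : MemLp a ∞ (σ d))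
    (hu : ∀ k, IsAngularEigenfunction a (μ k) (u k)) (s t : ℝ) :
    HasSum (fun k => ‖coeff (u k) s (eulerOp s ψ) t + s * coeff (u k) s ψ t‖ ^ 2
        + μ k * ‖coeff (u k) s ψ t‖ ^ 2)
      (∫ θ : S d, gradSq (emden s ψ t) θ ∂(σ d) + ∫ θ : S d, a θ * ‖emden s ψ t θ‖ ^ 2 ∂(σ d)) := by
  have m2 := (h.eulerOp s).memLp_emden s t
  have m3 := h.memLp_emden s t
  have m4 : MemLp (fun θ : S d => emden s (eulerOp s ψ) t θ + s * emden s ψ t θ) 2 (σ d) :=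
    m2.add (m3.const_mul _)
  have h1 := hasSum_norm_integral_sq u m4
  have h2 := hasSum_angularForm hd ha hu (h.smoothOnSphere_emden s t)
  have e : ∀ k, ∫ θ, (starRingEnd ℂ) (u k θ) *
      (emden s (eulerOp s ψ) t θ + s * emden s ψ t θ) ∂(σ d) =
      coeff (u k) s (eulerOp s ψ) t + s * coeff (u k) s ψ t := by
    intro k
    rw [coeff, coeff, ← integral_const_mul, ← integral_add (integrable_conj_mul (u k) m2)
      ((integrable_conj_mul (u k) m3).const_mul _)]
    refine integral_congr_ae (Eventually.of_forall fun θ => ?_)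
    ring
  simp_rw [e] at h1
  have e2 : ∫ θ : S d, gradSq (emden s ψ t) θ ∂(σ d) =
      ∫ θ : S d, ‖emden s (eulerOp s ψ) t θ + s * emden s ψ t θ‖ ^ 2 ∂(σ d) +
      ∫ θ : S d, gradSq (homExt fun θ : S d => emden s ψ t θ) θ ∂(σ d) := by
    have i1 : Integrable (fun θ : S d =>
        ‖emden s (eulerOp s ψ) t θ + s * emden s ψ t θ‖ ^ 2) (σ d) := m4.norm.integrable_sq
    rw [← integral_add i1 (h.smoothOnSphere_emden s t).integrable_gradSq]
    refine integral_congr_ae (Eventually.of_forall fun θ => ?_)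
    simp only [gradSq_emden_coe h, add_comm]
  rw [e2, add_assoc]
  exact h1.add h2

end Emden

end

/-! ### The constant and the inequality -/

section

variable {d : ℕ}

/-- The two algebraic conditions under which the inequality holds for every angular mode. -/
theorem hrConst_bounds {α s : ℝ} (hs : s = (4 + α - d) / 2) {μ : ℕ → ℝ} (hμ0 : ∀ k, 0 ≤ μ k)
    (h1 : (d : ℝ) - α - 4 ≠ 0 → IsLeast (range fun k => quotient d α (μ k)) (hrConst d α μ))
    (h2 : IsLeast (range μ \ {0}) (sInf (range μ \ {0}))) (k : ℕ) :
    hrConst d α μ ≤ (2 * s + d - 2) ^ 2 + 2 * (μ k - s * (s + d - 2)) ∧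
      hrConst d α μ * (s ^ 2 + μ k) ≤ (μ k - s * (s + d - 2)) ^ 2 := by
  have hk := hμ0 k
  by_cases hδ : (d : ℝ) - α - 4 = 0
  · have hs0 : s = 0 := by rw [hs]; linarith
    have hC : hrConst d α μ = min (((d : ℝ) - 2) ^ 2) (sInf (range μ \ {0})) :=
      if_neg (not_not.mpr hδ)
    have hC1 : hrConst d α μ ≤ ((d : ℝ) - 2) ^ 2 := hC.le.trans (min_le_left _ _)
    have hC2 : hrConst d α μ ≤ sInf (range μ \ {0}) := hC.le.trans (min_le_right _ _)
    rw [hs0]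
    refine ⟨by ring_nf at hC1 ⊢; linarith, ?_⟩
    -- A zero eigenvalue makes the second condition trivial, which is why 0 is removed from the
    -- minimum.
    rcases eq_or_ne (μ k) 0 with h0 | h0
    · simp [h0]
    · have h3 : hrConst d α μ * μ k ≤ μ k * μ k := by
        gcongr
        exact hC2.trans (h2.2 ⟨mem_range_self k, h0⟩)
      simpa [sq] using h3
  · have hs0 : s ≠ 0 := fun h0 => hδ (by rw [h0] at hs; linarith)
    have hC := (h1 hδ).2 (mem_range_self k)
    have hB : 0 < s ^ 2 + μ k := by positivity
    -- The quotient is A²/(s² + μ) after cancelling 16, since d - α - 4 = -2s and d + α = 2(s + d -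
    -- 2).
    have e : quotient d α (μ k) = (μ k - s * (s + d - 2)) ^ 2 / (s ^ 2 + μ k) := by
      have hα : α = 2 * s + d - 4 := by rw [hs]; ring
      have e1 : 4 * μ k + (d + α) * (d - α - 4) = 4 * (μ k - s * (s + d - 2)) := by
        rw [hα]; ring
      have e2 : 4 * (4 * μ k + (d - α - 4) ^ 2) = 16 * (s ^ 2 + μ k) := by
        rw [hα]; ring
      rw [quotient, e1, e2, mul_pow]
      norm_num
      rw [mul_div_mul_left _ _ (by norm_num)]
    rw [e, le_div_iff₀ hB] at hC
    refine ⟨?_, hC⟩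
    refine le_of_mul_le_mul_right (hC.trans ?_) hB
    -- With B = s² + μ, A = B - sb and b = 2s + d - 2, one has B(b² + 2A) - A² = B² + μ b².
    nlinarith [mul_nonneg (sq_nonneg (2 * s + d - 2)) hk, sq_nonneg (s ^ 2 + μ k)]

theorem hrConst_nonneg {α : ℝ} {μ : ℕ → ℝ} (hμ0 : ∀ k, 0 ≤ μ k)
    (h1 : (d : ℝ) - α - 4 ≠ 0 → IsLeast (range fun k => quotient d α (μ k)) (hrConst d α μ))
    (h2 : IsLeast (range μ \ {0}) (sInf (range μ \ {0}))) : 0 ≤ hrConst d α μ := by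
  by_cases hδ : (d : ℝ) - α - 4 = 0
  · have hC : hrConst d α μ = min (((d : ℝ) - 2) ^ 2) (sInf (range μ \ {0})) :=
      if_neg (not_not.mpr hδ)
    obtain ⟨⟨k, hk⟩, -⟩ := h2.1
    rw [hC, ← hk]
    exact le_min (sq_nonneg _) (hμ0 k)
  · obtain ⟨k, hk⟩ := (h1 hδ).1
    rw [← hk]
    have := hμ0 k
    simp only [quotient]
    positivity

/-- The Hardy–Rellich inequality for a constant that is admissible for every angular mode. -/
theorem hardyRellich_inequality (hd : 1 ≤ d) {a : S d → ℝ} (ha : MemLp a ∞ (σ d)) {μ : ℕ → ℝ}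
    {u : HilbertBasis ℕ ℂ (L2S d)} (hu : ∀ k, IsAngularEigenfunction a (μ k) (u k))
    (hμ0 : ∀ k, 0 ≤ μ k) {α s C : ℝ} (hs : s = (4 + α - d) / 2) (hC0 : 0 ≤ C)
    (hC : ∀ k, C ≤ (2 * s + d - 2) ^ 2 + 2 * (μ k - s * (s + d - 2)) ∧
      C * (s ^ 2 + μ k) ≤ (μ k - s * (s + d - 2)) ^ 2)
    {ψ : E d → ℂ} (h : IsTestFunction ψ) :
    C * ((∫ x, gradSq ψ x / ‖x‖ ^ (α + 2)) + ∫ x, homExt a x * ‖ψ x‖ ^ 2 / ‖x‖ ^ (α + 4)) ≤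
      ∫ x, ‖electricOp a ψ x‖ ^ 2 / ‖x‖ ^ α := by
  have p1 := h.integrable_gradSq (α + 2)
  have p2 := h.integrable_potential hd ha (α + 4)
  have p3 := h.integrable_electricOp hd ha α
  have q1 := integrable_polar hd p1
  have q2 := integrable_polar hd p2
  have q3 := integrable_polar hd p3
  rw [integral_polar hd p1, integral_polar hd p2, integral_polar hd p3]
  simp only [smul_eq_mul, ← integral_const_mul, gradSq_exp_smul hs, potential_exp_smul a hs,
    electricOp_exp_smul a hs] at q1 q2 q3 ⊢
  rw [← integral_add q1 q2, ← integral_const_mul]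
  have d0 := fun k => hasDerivAt_coeff h (u k) s
  have d1 := fun k => hasDerivAt_coeff (h.eulerOp s) (u k) s
  have c0 := fun k => continuous_coeff h (u k) s
  have c1 := fun k => continuous_coeff (h.eulerOp s) (u k) s
  have c2 := fun k => continuous_coeff ((h.eulerOp s).eulerOp s) (u k) s
  have s0 := fun k => hasCompactSupport_coeff h (u k) s
  have s1 := fun k => hasCompactSupport_coeff (h.eulerOp s) (u k) s
  have s2 := fun k => hasCompactSupport_coeff ((h.eulerOp s).eulerOp s) (u k) s
  -- Nonnegativity of C and of all μ_k makes every summand nonnegative, as the exchange of sum and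
  -- integral requires.
  refine integral_le_integral_of_hasSum ((q1.add q2).const_mul C) q3 (fun k t => ?_)
    (fun k t => ?_) (fun k => ?_) (fun k => ?_)
    (fun t => (hasSum_emdenForm hd h ha hu s t).mul_left C) (hasSum_emdenOp h ha hu s) fun k => ?_
  · have := hμ0 k
    positivity
  · positivity
  · have e0 := c0 k
    have e1 := c1 k
    exact integrable_of_continuous_of_support (s0 k) (s1 k) (s2 k) (by fun_prop)
      fun t z0 z1 _ => by simp [z0, z1]
  · have e0 := c0 k
    have e1 := c1 k
    have e2 := c2 k
    exact integrable_of_continuous_of_support (s0 k) (s1 k) (s2 k) (by fun_prop)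
      fun t z0 z1 z2 => by simp [z0, z1, z2]
  · rw [integral_const_mul]
    exact mode_inequality (d0 k) (d1 k) (c2 k) (s0 k) (s1 k) (s2 k) (hC k).1 (hC k).2

end

end HardyRellich

end

/-! ### Conclusion -/

theorem theorem1p4 {d : ℕ} (hd : 2 ≤ d) (a : HardyRellich.S d → ℝ)
    (ha : MemLp a ∞ (HardyRellich.σ d)) (ha0 : ∀ᵐ θ ∂(HardyRellich.σ d), 0 ≤ a θ) :
    (∃ μ : ℕ → ℝ, HardyRellich.IsAngularEigenvalueSeq a μ) ∧
    ∀ μ : ℕ → ℝ, HardyRellich.IsAngularEigenvalueSeq a μ →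
      essInf a (HardyRellich.σ d) ≤ μ 0 ∧
      ∀ α : ℝ,
        -- the infima in the formula of the constant are minima
        ((d : ℝ) - α - 4 ≠ 0 →
          IsLeast (range fun k => HardyRellich.quotient d α (μ k))
            (HardyRellich.hrConst d α μ)) ∧
        IsLeast (range μ \ {0}) (sInf (range μ \ {0})) ∧
        ∀ ψ : HardyRellich.E d → ℂ, HardyRellich.IsTestFunction ψ →
          Integrable (fun x => ‖HardyRellich.electricOp a ψ x‖ ^ 2 / ‖x‖ ^ α) ∧
          Integrable (fun x => HardyRellich.gradSq ψ x / ‖x‖ ^ (α + 2)) ∧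
          Integrable (fun x => HardyRellich.homExt a x * ‖ψ x‖ ^ 2 / ‖x‖ ^ (α + 4)) ∧
          HardyRellich.hrConst d α μ *
              ((∫ x, HardyRellich.gradSq ψ x / ‖x‖ ^ (α + 2)) +
                ∫ x, HardyRellich.homExt a x * ‖ψ x‖ ^ 2 / ‖x‖ ^ (α + 4))
            ≤ ∫ x, ‖HardyRellich.electricOp a ψ x‖ ^ 2 / ‖x‖ ^ α := by
  have hd1 : 1 ≤ d := by omega
  refine ⟨HardyRellich.exists_angularEigenvalueSeq hd ha ha0, ?_⟩
  rintro μ ⟨-, hμ, u, hu⟩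
  have hμ0 : ∀ k, 0 ≤ μ k := fun k =>
    HardyRellich.le_of_isAngularEigenfunction hd ha ha0 (hu k)
  refine ⟨HardyRellich.essInf_le_of_isAngularEigenfunction hd ha ha0 (hu 0), fun α => ?_⟩
  have h1 : (d : ℝ) - α - 4 ≠ 0 → IsLeast (range fun k => HardyRellich.quotient d α (μ k))
      (HardyRellich.hrConst d α μ) := fun hδ => HardyRellich.isLeast_quotient hμ hδ
  have h2 := HardyRellich.isLeast_nonzero hμ
  exact ⟨h1, h2, fun ψ hψ => ⟨hψ.integrable_electricOp hd1 ha α, hψ.integrable_gradSq _,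
    hψ.integrable_potential hd1 ha _, HardyRellich.hardyRellich_inequality hd1 ha hu hμ0 rfl
      (HardyRellich.hrConst_nonneg hμ0 h1 h2) (HardyRellich.hrConst_bounds rfl hμ0 h1 h2)
      hψ⟩⟩
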